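/- **Theorem (generalized Bochner–Weitzenböck identity).** Let $M$ be a smooth manifold of dimension $n\ge 1$ with a Riemannian metric $g$ that is locally Lipschitz, i.e. $g\in C^{0,1}_{\mathrm{loc}}$, and let $X$ be a vector field in $W^{1,\infty^-}_{\mathrm{loc}}(TM)$, i.e. the components of $X$ in every smooth chart lie in $W^{1,p}_{\mathrm{loc}}$ for all $1\le p<\infty$. Then $\mathrm{Ric}(X,X)$, $\Delta\frac{|X|^2}{2}$, $|\nabla X|^2$ and $g(\Delta_H X,X)$ are elements of $W^{-1,1+\frac1n}_{\mathrm{loc}}(M)\subseteq\mathcal D'(M)$, and $$\mathrm{Ric}(X,X)=\Delta\frac{|X|^2}{2}-|\nabla X|^2+g(\Delta_H X,X)\qquad\text{in } W^{-1,1+\frac1n}_{\mathrm{loc}}(M).$$ Here $\mathcal D'(M)$ is the dual of the space of smooth compactly supported volume densities, and $W^{-1,q}_{\mathrm{loc}}(M)$ consists of the distributions $T$ whose pushforward to the image of every smooth chart, multiplied by any test function, is of the form $f_0+\sum_i\partial_i f_i$ with $f_0,\dots,f_n\in L^q$. All operations are those of the Levi-Civita connection $\nabla$ of $g$, with Christoffel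 symbols $\Gamma^k_{ij}=\frac12 g^{kl}(\partial_i g_{jl}+\partial_j g_{il}-\partial_l g_{ij})\in L^\infty_{\mathrm{loc}}$ and derivatives in the sense of distributions; a product of a function in $W^{1,n+1}_{\mathrm{loc}}$ and a distribution in $W^{-1,1+\frac1n}_{\mathrm{loc}}$ is understood by continuous extension of the product of smooth functions and distributions. The Ricci tensor is $\mathrm{Ric}(Y,Z)=\mathrm{tr}\big(V\mapsto \nabla_V\nabla_Y Z-\nabla_Y\nabla_V Z-\nabla_{[V,Y]}Z\big)$ (positive on round spheres of dimension at least two), $\Delta_H X=(\Delta_H X^\flat)^\sharp$ with the Hodge Laplacian $\Delta_H=\delta d+d\delta$ on 1-forms, where $\delta\omega=-\sum_i(\nabla_{e_i}\omega)(e_i)$ and $\delta\eta(V)=-\sum_i(\nabla_{e_i}\eta)(e_i,V)$ for a local orthonormal frame $(e_i)$, and $\Delta f=-\delta\,df$. -/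

import Mathlib

open MeasureTheory TopologicalSpace Set
open scoped Distributions LineDeriv Manifold ContDiff ENNReal

noncomputable section

namespace LowReg

/-- The model space `ℝⁿ`. -/
abbrev Euc (n : ℕ) : Type := EuclideanSpace ℝ (Fin n)

/-- The standard basis vector `∂ᵢ` of `ℝⁿ`. -/
abbrev unitVec {n : ℕ} (i : Fin n) : Euc n := EuclideanSpace.single i (1 : ℝ)

section Local

variable {n : ℕ} {Ω : Opens (Euc n)}

/-! ### Distributions and Sobolev spaces on an open subset of `ℝⁿ`

`𝓓'(Ω, ℝ)` is the space of distributions on `Ω`. Functions are total functions on `ℝⁿ`; only their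
values on `Ω` matter, and only up to null sets. -/

/-- The distribution `φ ↦ ∫ f φ` defined by a function `f` that is locally integrable on `Ω`. -/
def ofFun (Ω : Opens (Euc n)) (f : Euc n → ℝ) : 𝓓'(Ω, ℝ) :=
  ContinuousLinearMap.toUniformConvergenceCLM (RingHom.id ℝ) ℝ _
    (TestFunction.integralAgainstBilinCLM (ContinuousLinearMap.mul ℝ ℝ) volume f)

/-- `f ∈ L^p_loc(Ω)`. -/
def MemLpLoc (Ω : Opens (Euc n)) (p : ℝ≥0∞) (f : Euc n → ℝ) : Prop :=
  ∀ K : Set (Euc n), IsCompact K → K ⊆ Ω → MemLp f p (volume.restrict K)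

/-- `f ∈ W^{1,p}_loc(Ω)`: `f` and its first distributional derivatives are in `L^p_loc(Ω)`. -/
def MemW1Loc (Ω : Opens (Euc n)) (p : ℝ≥0∞) (f : Euc n → ℝ) : Prop :=
  MemLpLoc Ω p f ∧ ∀ i : Fin n, ∃ h : Euc n → ℝ, MemLpLoc Ω p h ∧ ∂_{unitVec i} (ofFun Ω f) = ofFun Ω h

open Classical in
/-- The weak partial derivative `∂ᵢ f`, as a locally integrable function on `Ω` (well defined up to
null sets). -/
def weakDeriv (Ω : Opens (Euc n)) (i : Fin n) (f : Euc n → ℝ) : Euc n → ℝ :=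
  if h : ∃ v : Euc n → ℝ, LocallyIntegrableOn v Ω volume ∧ ∂_{unitVec i} (ofFun Ω f) = ofFun Ω v
  then h.choose else 0

/-- The product of two test functions. -/
def mulTest (φ ψ : 𝓓(Ω, ℝ)) : 𝓓(Ω, ℝ) where
  toFun x := φ x * ψ x
  contDiff' := φ.contDiff.mul ψ.contDiff
  hasCompactSupport' := φ.hasCompactSupport.mul_right
  tsupport_subset' := (tsupport_mul_subset_left (f := φ) (g := ψ)).trans φ.tsupport_subset

/-- `T ∈ W^{-1,q}_loc(Ω)`: for every `φ ∈ C_c^∞(Ω)` there are `f₀, f₁, …, fₙ ∈ L^q(Ω)` with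
`φ T = f₀ + ∑ᵢ ∂ᵢ fᵢ`. -/
def MemWNegOneLoc (q : ℝ≥0∞) (T : 𝓓'(Ω, ℝ)) : Prop :=
  ∀ φ : 𝓓(Ω, ℝ), ∃ (f₀ : Euc n → ℝ) (f : Fin n → Euc n → ℝ),
    MemLp f₀ q (volume.restrict Ω) ∧ (∀ i, MemLp (f i) q (volume.restrict Ω)) ∧
    ∀ ψ : 𝓓(Ω, ℝ), T (mulTest φ ψ) = (ofFun Ω f₀ + ∑ i, ∂_{unitVec i} (ofFun Ω (f i))) ψ

/-- The exponent `1 + 1/n`. -/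
def expo (n : ℕ) : ℝ≥0∞ := 1 + (n : ℝ≥0∞)⁻¹

/-- `S = u T` for `u ∈ W^{1,n+1}_loc(Ω)` and `T ∈ W^{-1,1+1/n}_loc(Ω)`: the distribution
`⟨u T, φ⟩ = ⟨T, u φ⟩`, where `T = f₀ + ∑ᵢ ∂ᵢ fᵢ` with `f₀, …, fₙ ∈ L^{1+1/n}_loc(Ω)` acts on compactly
supported `w ∈ W^{1,n+1}` by `⟨T, w⟩ = ∫ f₀ w - ∑ᵢ ∫ fᵢ ∂ᵢ w`. This is the extension by continuity of
the multiplication of distributions by smooth functions; it does not depend on the `fᵢ`. -/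
def IsProduct (u : Euc n → ℝ) (T S : 𝓓'(Ω, ℝ)) : Prop :=
  MemW1Loc Ω (n + 1) u ∧
  ∃ (f₀ : Euc n → ℝ) (f : Fin n → Euc n → ℝ),
    MemLpLoc Ω (expo n) f₀ ∧ (∀ i, MemLpLoc Ω (expo n) (f i)) ∧
    T = ofFun Ω f₀ + ∑ i, ∂_{unitVec i} (ofFun Ω (f i)) ∧
    S = ofFun Ω (fun x => u x * f₀ x - ∑ i, weakDeriv Ω i u x * f i x)
      + ∑ i, ∂_{unitVec i} (ofFun Ω (fun x => u x * f i x))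

open Classical in
/-- The product `u T` of `u ∈ W^{1,n+1}_loc(Ω)` and `T ∈ W^{-1,1+1/n}_loc(Ω)`. -/
def prod (u : Euc n → ℝ) (T : 𝓓'(Ω, ℝ)) : 𝓓'(Ω, ℝ) :=
  if h : ∃ S, IsProduct u T S then h.choose else 0

/-! ### Riemannian geometry in coordinates

`G` is the matrix `(g_{ij})` of a metric on `Ω` in coordinates. -/

/-- The components `g^{ij}` of the inverse metric. -/
def ginv (G : Fin n → Fin n → Euc n → ℝ) (i j : Fin n) : Euc n → ℝ :=
  fun y => (Matrix.of fun a b => G a b y)⁻¹ i j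

/-- The Christoffel symbols `Γ^k_{ij} = ½ ∑ₗ g^{kl} (∂ᵢ g_{jl} + ∂ⱼ g_{il} - ∂ₗ g_{ij})`. -/
def christoffel (Ω : Opens (Euc n)) (G : Fin n → Fin n → Euc n → ℝ) (k i j : Fin n) :
    Euc n → ℝ :=
  fun y => (1 / 2) * ∑ l, ginv G k l y *
    (weakDeriv Ω i (G j l) y + weakDeriv Ω j (G i l) y - weakDeriv Ω l (G i j) y)

/-- The covariant derivative of a vector field with distributional first derivatives:
`(∇ᵢ V)^l = ∂ᵢ V^l + ∑ₘ Γ^l_{im} V^m`, as a distribution. -/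
def nablaVecDist (G : Fin n → Fin n → Euc n → ℝ) (V : Fin n → Euc n → ℝ) (i l : Fin n) :
    𝓓'(Ω, ℝ) :=
  ∂_{unitVec i} (ofFun Ω (V l)) + ofFun Ω (fun y => ∑ m, christoffel Ω G l i m y * V m y)

/-- The curvature `(Riem(∂ᵢ, ∂ⱼ) ∂ₖ)^l = (∇ᵢ ∇ⱼ ∂ₖ - ∇ⱼ ∇ᵢ ∂ₖ)^l`, as a distribution; note that
`∇ⱼ ∂ₖ` has the components `Γ^m_{jk}`. -/
def riem (G : Fin n → Fin n → Euc n → ℝ) (i j k l : Fin n) : 𝓓'(Ω, ℝ) :=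
  nablaVecDist G (fun m => christoffel Ω G m j k) i l
    - nablaVecDist G (fun m => christoffel Ω G m i k) j l

/-- The Ricci tensor `Ric(∂ⱼ, ∂ₖ) = tr (V ↦ Riem(V, ∂ⱼ) ∂ₖ)`, as a distribution. -/
def ric (G : Fin n → Fin n → Euc n → ℝ) (j k : Fin n) : 𝓓'(Ω, ℝ) :=
  ∑ i, riem G i j k i

/-- `Ric(X, X) = ∑ X^j X^k Ric(∂ⱼ, ∂ₖ)`. -/
def ricciLocal (G : Fin n → Fin n → Euc n → ℝ) (X : Fin n → Euc n → ℝ) : 𝓓'(Ω, ℝ) :=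
  ∑ j, ∑ k, prod (fun y => X j y * X k y) (ric G j k)

/-- The covariant derivative `(∇ₐ X)^i = ∂ₐ X^i + ∑_b Γ^i_{ab} X^b` of a weakly differentiable
vector field. -/
def nablaVec (Ω : Opens (Euc n)) (G : Fin n → Fin n → Euc n → ℝ) (X : Fin n → Euc n → ℝ)
    (a i : Fin n) : Euc n → ℝ :=
  fun y => weakDeriv Ω a (X i) y + ∑ b, christoffel Ω G i a b y * X b y

/-- The function `|∇X|² = ∑ g^{ab} g_{ij} (∇ₐ X)^i (∇_b X)^j`. -/
def normSqNabla (Ω : Opens (Euc n)) (G : Fin n → Fin n → Euc n → ℝ) (X : Fin n → Euc n → ℝ) :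
    Euc n → ℝ :=
  fun y => ∑ a, ∑ b, ∑ i, ∑ j,
    ginv G a b y * G i j y * nablaVec Ω G X a i y * nablaVec Ω G X b j y

/-- The codifferential `δθ = -∑ g^{ab} (∇ₐ θ)_b` of a 1-form, where
`(∇ₐ θ)_b = ∂ₐ θ_b - ∑_c Γ^c_{ab} θ_c`, as a distribution. -/
def codiffOne (G : Fin n → Fin n → Euc n → ℝ) (θ : Fin n → Euc n → ℝ) : 𝓓'(Ω, ℝ) :=
  -∑ a, ∑ b, prod (ginv G a b)
    (∂_{unitVec a} (ofFun Ω (θ b)) - ofFun Ω (fun y => ∑ c, christoffel Ω G c a b y * θ c y))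

/-- The codifferential `(δη)_c = -∑ g^{ab} (∇ₐ η)_{bc}` of a 2-form, where
`(∇ₐ η)_{bc} = ∂ₐ η_{bc} - ∑_l (Γ^l_{ab} η_{lc} + Γ^l_{ac} η_{bl})`, as a distribution. -/
def codiffTwo (G : Fin n → Fin n → Euc n → ℝ) (η : Fin n → Fin n → Euc n → ℝ) (c : Fin n) :
    𝓓'(Ω, ℝ) :=
  -∑ a, ∑ b, prod (ginv G a b)
    (∂_{unitVec a} (ofFun Ω (η b c)) - ofFun Ω (fun y => ∑ l,
      (christoffel Ω G l a b y * η l c y + christoffel Ω G l a c y * η b l y)))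

/-- The exterior derivative `(dθ)_{ab} = ∂ₐ θ_b - ∂_b θₐ` of a weakly differentiable 1-form. -/
def extDeriv (Ω : Opens (Euc n)) (θ : Fin n → Euc n → ℝ) (a b : Fin n) : Euc n → ℝ :=
  fun y => weakDeriv Ω a (θ b) y - weakDeriv Ω b (θ a) y

/-- The Hodge Laplacian `Δ_H θ = δ d θ + d δ θ` of a 1-form; its components are distributions. -/
def hodgeForm (G : Fin n → Fin n → Euc n → ℝ) (θ : Fin n → Euc n → ℝ) (c : Fin n) : 𝓓'(Ω, ℝ) :=
  codiffTwo G (extDeriv Ω θ) c + ∂_{unitVec c} (codiffOne (Ω := Ω) G θ)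

/-- The 1-form `X^♭`, with components `∑_b g_{ab} X^b`. -/
def flat (G : Fin n → Fin n → Euc n → ℝ) (X : Fin n → Euc n → ℝ) (a : Fin n) : Euc n → ℝ :=
  fun y => ∑ b, G a b y * X b y

/-- The Hodge Laplacian `Δ_H X = (Δ_H X^♭)^♯` of a vector field; its components are
distributions. -/
def hodgeVec (G : Fin n → Fin n → Euc n → ℝ) (X : Fin n → Euc n → ℝ) (a : Fin n) : 𝓓'(Ω, ℝ) :=
  ∑ c, prod (ginv G a c) (hodgeForm G (flat G X) c)

/-- `g(Δ_H X, X) = ∑ (g_{ab} X^b) (Δ_H X)^a`. -/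
def hodgeLocal (G : Fin n → Fin n → Euc n → ℝ) (X : Fin n → Euc n → ℝ) : 𝓓'(Ω, ℝ) :=
  ∑ a, ∑ b, prod (fun y => G a b y * X b y) (hodgeVec G X a)

/-- The Laplace-Beltrami operator `Δ f = -δ d f` on a weakly differentiable function. -/
def laplaceLocal (G : Fin n → Fin n → Euc n → ℝ) (f : Euc n → ℝ) : 𝓓'(Ω, ℝ) :=
  -codiffOne G (fun a => weakDeriv Ω a f)

end Local

section Manifold

variable {n : ℕ} {M : Type*} [TopologicalSpace M] [ChartedSpace (Euc n) M]

/-! ### Distributions and tensor fields on a smooth manifold -/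

variable (n M) in
/-- The smooth charts of `M` (all charts of the maximal smooth atlas). -/
abbrev Chart : Type _ := {e : OpenPartialHomeomorph M (Euc n) //
  e ∈ IsManifold.maximalAtlas (𝓡 n) ∞ M}

/-- The image of a chart, an open subset of `ℝⁿ`. -/
def Chart.img (e : Chart n M) : Opens (Euc n) := ⟨e.1.target, e.1.open_target⟩

/-- The test functions `φ` on the image of `e` and `φ'` on the image of `e'` represent the same
smooth volume density `φ |dx| = φ' |dx'|` with compact support in the common domain of the charts
`e` and `e'`. -/
def SameDensity (e e' : Chart n M) (φ : 𝓓(e.img, ℝ)) (φ' : 𝓓(e'.img, ℝ)) : Prop :=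
  tsupport φ ⊆ (e.1.symm.trans e'.1).source ∧ tsupport φ' ⊆ (e'.1.symm.trans e.1).source ∧
  ∀ y ∈ (e'.1.symm.trans e.1).source,
    φ' y = φ (e.1 (e'.1.symm y)) * |(fderiv ℝ (fun z => e.1 (e'.1.symm z)) y).det|

variable (n M) in
/-- The space `𝓓'(M)` of distributions on `M`, that is, of continuous functionals on smooth
compactly supported volume densities. A distribution `T` is given by its pushforwards
`φ ↦ ⟨T, (φ ∘ e) |dx¹ ∧ … ∧ dxⁿ|⟩` along all smooth charts `e`: these are distributions on the
images of the charts that take the same value on any two test functions which represent the same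
volume density. -/
def Distr : Submodule ℝ (∀ e : Chart n M, 𝓓'(e.img, ℝ)) where
  carrier := {T | ∀ (e e' : Chart n M) (φ : 𝓓(e.img, ℝ)) (φ' : 𝓓(e'.img, ℝ)),
    SameDensity e e' φ φ' → T e φ = T e' φ'}
  zero_mem' := fun _ _ _ _ _ => rfl
  add_mem' := fun {S T} hS hT e e' φ φ' h => by
    change S e φ + T e φ = S e' φ' + T e' φ'
    rw [hS e e' φ φ' h, hT e e' φ φ' h]
  smul_mem' := fun c T hT e e' φ φ' h => by
    change c * T e φ = c * T e' φ'
    rw [hT e e' φ φ' h]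

variable (n M) in
/-- `W^{-1,q}_loc(M)`: the distributions on `M` whose pushforward along every smooth chart is in
`W^{-1,q}_loc` of the image of the chart. -/
def WNegOneLoc (q : ℝ≥0∞) : Set (∀ e : Chart n M, 𝓓'(e.img, ℝ)) :=
  {T | T ∈ Distr n M ∧ ∀ e : Chart n M, MemWNegOneLoc q (T e)}

/-- A Riemannian metric on `M`: an inner product on every tangent space, without any regularity. -/
abbrev Metric (n : ℕ) (M : Type*) [TopologicalSpace M] [ChartedSpace (Euc n) M] :=
  Bundle.RiemannianMetric (fun x : M => TangentSpace (𝓡 n) x)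

/-- The coordinate vector field `∂ᵢ` of a chart, at the point with coordinates `y`. -/
def coordVec (e : Chart n M) (i : Fin n) (y : Euc n) : TangentSpace (𝓡 n) (e.1.symm y) :=
  mfderiv (𝓡 n) (𝓡 n) e.1.symm y (unitVec i : Euc n)

/-- The components `g_{ij} = g(∂ᵢ, ∂ⱼ)` of a metric in a chart. -/
def metricCoord (g : Metric n M) (e : Chart n M) (i j : Fin n) (y : Euc n) : ℝ :=
  g.inner (e.1.symm y) (coordVec e i y) (coordVec e j y)

/-- The components `X^i = dx^i(X)` of a vector field in a chart. -/
def vecCoord (X : ∀ x : M, TangentSpace (𝓡 n) x) (e : Chart n M) (i : Fin n) (y : Euc n) : ℝ :=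
  (show Euc n from mfderiv (𝓡 n) (𝓡 n) e.1 (e.1.symm y) (X (e.1.symm y))) i

/-- `g ∈ C^{0,1}_loc`: the components of `g` in every smooth chart are locally Lipschitz. -/
def IsLocLipschitzMetric (g : Metric n M) : Prop :=
  ∀ (e : Chart n M) (i j : Fin n), LocallyLipschitzOn e.1.target (metricCoord g e i j)

/-- `X ∈ W^{1,∞⁻}_loc(TM)`: the components of `X` in every smooth chart are in `W^{1,p}_loc` for all
`1 ≤ p < ∞`. -/
def MemW1InftyMinusLoc (X : ∀ x : M, TangentSpace (𝓡 n) x) : Prop :=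
  ∀ (e : Chart n M) (i : Fin n) (p : ℝ≥0∞), 1 ≤ p → p < ⊤ → MemW1Loc e.img p (vecCoord X e i)

/-- `Ric(X, X)`. -/
def ricci (g : Metric n M) (X : ∀ x : M, TangentSpace (𝓡 n) x) (e : Chart n M) : 𝓓'(e.img, ℝ) :=
  ricciLocal (metricCoord g e) (vecCoord X e)

/-- `Δ f`. -/
def laplace (g : Metric n M) (f : M → ℝ) (e : Chart n M) : 𝓓'(e.img, ℝ) :=
  laplaceLocal (metricCoord g e) (fun y => f (e.1.symm y))

/-- `|∇X|²`. -/
def gradNormSq (g : Metric n M) (X : ∀ x : M, TangentSpace (𝓡 n) x) (e : Chart n M) :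
    𝓓'(e.img, ℝ) :=
  ofFun e.img (normSqNabla e.img (metricCoord g e) (vecCoord X e))

/-- `g(Δ_H X, X)`. -/
def hodge (g : Metric n M) (X : ∀ x : M, TangentSpace (𝓡 n) x) (e : Chart n M) : 𝓓'(e.img, ℝ) :=
  hodgeLocal (metricCoord g e) (vecCoord X e)

end Manifold

end LowReg

end

/-! The identity is a computation in one chart, carried out in a calculus weak enough for Lipschitz
metrics. The components of `X`, `g` and `g⁻¹` lie in W^{1,p}_loc for every finite p, a class closed
under products, and the Christoffel symbols Γ lie in L^p_loc for every finite p. Each distribution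
that occurs is of the form f₀ + ∑ᵢ ∂ᵢ fᵢ with coefficients in all these L^p_loc (`HasDivForm`).
Multiplication by W^{1,p} functions preserves this form (`prod_divForm`), is additive and
associative, and obeys the Leibniz rule. The choice hidden in `prod` is harmless
(`IsProduct.unique`): a relation f₀ + ∑ᵢ ∂ᵢ fᵢ = 0 persists when tested against compactly supported
W^{1,p} functions, by mollification (`pairing_eq_zero`).

The classical computation is then arranged so that only functions and divergences of vector fields
remain. With A = ∇X and div X = tr A, Ric(X,X) = div(∇_X X - (div X) X) + (div X)² - tr(A∘A)
(`ricciLocal_eq`), Δ(|X|²/2) = div((½ d|X|²)^♯) (`laplaceLocal_halfSq`), and g(Δ_H X, X) is the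
right side of the first line, plus |∇X|², minus the right side of the second (`hodgeLocal_eq`). The
identity follows by addition. Distributional second derivatives of X are commuted only in ∂ₐ(u ∂_b
v) - ∂_b(u ∂ₐ v), where they cancel (`distDeriv_mul_weakDeriv_sub`).

It remains to see that the local expressions define one distribution on M. This is checked on the
functions and divergences above. The law of change of Γ makes ∇X a tensor almost everywhere, so the
functions are invariant and the vector fields transform correctly; the divergence is invariant by
the Piola identity together with the law for the contracted symbols Γ^i_{ia}. For the Hodge term
nothing new is needed: compatibility between charts is inherited from the identity. -/

open scoped Convolution

/-! ### Mollification: testing against compactly supported Sobolev functions -/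

namespace LowReg

section Pairing

variable {n : ℕ} {p q : ℝ≥0∞}

/-- Translation is strongly continuous on L^p for finite p, and the Hölder pairing with a fixed
element of L^q is bounded. -/
theorem continuous_integral_mul_translate [q.HolderConjugate p] (hp : p ≠ ⊤) {f h : Euc n → ℝ}
    (hf : MemLp f q volume) (hh : MemLp h p volume) :
    Continuous fun t : Euc n => ∫ x, f x * h (x - t) := by
  have hpq : q.HolderConjugate p := inferInstance
  have : Fact (1 ≤ p) := ⟨ENNReal.HolderConjugate.one_le p q⟩
  have : Fact (1 ≤ q) := ⟨ENNReal.HolderConjugate.one_le q p⟩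
  -- The translations are packaged as a continuous family of maps, the form in which continuity of
  -- composition on L^p is stated.
  let g : C(Euc n, C(Euc n, Euc n)) :=
    (ContinuousMap.mk (fun a : Euc n × Euc n => a.2 - a.1) (by fun_prop)).curry
  have hg : ∀ t, MeasurePreserving (g t) (volume : Measure (Euc n)) volume := fun t =>
    measurePreserving_sub_right volume t
  have hc : Continuous fun t : Euc n => (ContinuousLinearMap.mul ℝ ℝ).lpPairing volume q p
      (hf.toLp f) (Lp.compMeasurePreserving (g t) (hg t) (hh.toLp h)) :=
    (ContinuousLinearMap.continuous _).comp
      (Continuous.compMeasurePreservingLp (continuous_const) g.continuous hg hp)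
  refine hc.congr fun t => ?_
  rw [ContinuousLinearMap.lpPairing_eq_integral]
  refine integral_congr_ae ?_
  filter_upwards [hf.coeFn_toLp, Lp.coeFn_compMeasurePreserving (hh.toLp h) (hg t),
    (hg t).quasiMeasurePreserving.ae_eq_comp hh.coeFn_toLp] with x h1 h2 h3
  rw [h1, h2, h3]
  rfl

/-- Fubini. Joint integrability holds because the inner integral of absolute values is finite by
Hölder and continuous in t, while ρ is continuous with compact support. -/
theorem integral_mul_convolution [q.HolderConjugate p] (hp : p ≠ ⊤) {f h ρ : Euc n → ℝ}
    (hf : MemLp f q volume) (hh : MemLp h p volume) (hρ : Continuous ρ) (hρc : HasCompactSupport ρ) :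
    ∫ x, f x * ∫ t, ρ t * h (x - t) = ∫ t, ρ t * ∫ x, f x * h (x - t) := by
  have hint : Integrable (fun z : Euc n × Euc n => f z.1 * (ρ z.2 * h (z.1 - z.2)))
      (volume.prod volume) := by
    have hm : AEStronglyMeasurable (fun z : Euc n × Euc n => f z.1 * (ρ z.2 * h (z.1 - z.2)))
        (volume.prod volume) :=
      hf.aestronglyMeasurable.comp_fst.mul
        (hρ.aestronglyMeasurable.convolution_integrand (ContinuousLinearMap.mul ℝ ℝ)
          hh.aestronglyMeasurable)
    rw [integrable_prod_iff' hm]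
    constructor
    · refine Filter.Eventually.of_forall fun t => ?_
      have h1 : MemLp (fun x => h (x - t)) p volume :=
        hh.comp_measurePreserving (measurePreserving_sub_right volume t)
      have := (hf.integrable_mul h1).const_mul (ρ t)
      refine this.congr (Filter.Eventually.of_forall fun x => ?_)
      simp only [Pi.mul_apply]; ring
    · have h1 := continuous_integral_mul_translate hp hf.norm hh.norm
      have h2 : Integrable (fun t => ‖ρ t‖ * ∫ x, ‖f x‖ * ‖h (x - t)‖) volume :=
        (hρ.norm.mul h1).integrable_of_hasCompactSupport hρc.norm.mul_right
      refine h2.congr (Filter.Eventually.of_forall fun t => ?_)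
      simp only [norm_mul]
      rw [← integral_const_mul]
      congr 1; ext x; ring
  have := integral_integral_swap (f := fun x t => f x * (ρ t * h (x - t))) hint
  simp only [integral_const_mul] at this
  rw [this]
  congr 1; ext t
  rw [← integral_const_mul]
  congr 1; ext x; ring

/-- The derivative of a convolution falls on the smooth factor ρ. It is moved to w by testing the
weak derivative against the reflected translate s ↦ ρ(x - s), whose derivative has the opposite
sign. -/
theorem fderiv_mollify {w w' ρ : Euc n → ℝ} (i : Fin n) (hw : LocallyIntegrable w volume)
    (hd : ∀ φ : Euc n → ℝ, ContDiff ℝ ∞ φ → HasCompactSupport φ →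
      ∫ x, w x * fderiv ℝ φ x (unitVec i) = -∫ x, w' x * φ x)
    (hρ : ContDiff ℝ ∞ ρ) (hρc : HasCompactSupport ρ) (x : Euc n) :
    fderiv ℝ (fun x => ∫ t, ρ t * w (x - t)) x (unitVec i) = ∫ t, ρ t * w' (x - t) := by
  have hρ1 : ContDiff ℝ 1 ρ := hρ.of_le (by exact_mod_cast le_top)
  have h1 := hρc.hasFDerivAt_convolution_left (ContinuousLinearMap.mul ℝ ℝ) hρ1 hw x
  have h2 : fderiv ℝ (fun x => ∫ t, ρ t * w (x - t)) x = _ := h1.fderiv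
  rw [h2]
  have hex : ConvolutionExistsAt (fderiv ℝ ρ) w x
      ((ContinuousLinearMap.mul ℝ ℝ).precompL (Euc n)) volume :=
    (hρc.fderiv ℝ).convolutionExists_left _ (hρ1.continuous_fderiv (by simp)) hw x
  rw [convolution_def, ContinuousLinearMap.integral_apply hex]
  have h3 : ∀ t, (((ContinuousLinearMap.mul ℝ ℝ).precompL (Euc n)) (fderiv ℝ ρ t) (w (x - t)))
      (unitVec i) = fderiv ℝ ρ t (unitVec i) * w (x - t) := fun t => by
    simp [ContinuousLinearMap.precompL_apply]
  simp only [h3]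
  have h4 : ∀ s, fderiv ℝ (fun s => ρ (x - s)) s (unitVec i) = -fderiv ℝ ρ (x - s) (unitVec i) := by
    intro s
    have := ((hρ1.differentiable (by simp) (x - s)).hasFDerivAt).comp s
      ((hasFDerivAt_id s).const_sub x)
    rw [show (fun s => ρ (x - s)) = ρ ∘ HSub.hSub x from rfl, this.fderiv]
    simp
  have h5 := hd (fun s => ρ (x - s)) (hρ.comp (contDiff_const.sub contDiff_id))
    (hρc.comp_homeomorph (Homeomorph.subLeft x))
  simp only [h4] at h5
  rw [← integral_sub_left_eq_self (fun t => fderiv ℝ ρ t (unitVec i) * w (x - t)) volume x,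
    ← integral_sub_left_eq_self (fun t => ρ t * w' (x - t)) volume x]
  simp only [sub_sub_cancel, mul_neg, integral_neg, neg_inj] at h5 ⊢
  simpa only [mul_comm] using h5

/-- If `f₀ + ∑ᵢ ∂ᵢ fᵢ = 0` in the sense of distributions, with coefficients in `L^q_loc`, then this
remains true when tested against compactly supported functions in `W^{1,p}`. -/
theorem pairing_eq_zero [q.HolderConjugate p] (hp : p ≠ ⊤) {Ω : Opens (Euc n)}
    {f₀ : Euc n → ℝ} {f : Fin n → Euc n → ℝ} (hf₀ : MemLpLoc Ω q f₀) (hf : ∀ i, MemLpLoc Ω q (f i))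
    (hT : ∀ φ : Euc n → ℝ, ContDiff ℝ ∞ φ → HasCompactSupport φ → tsupport φ ⊆ Ω →
      (∫ x, f₀ x * φ x) - ∑ i, ∫ x, f i x * fderiv ℝ φ x (unitVec i) = 0)
    {w : Euc n → ℝ} {w' : Fin n → Euc n → ℝ} {K : Set (Euc n)} (hK : IsCompact K) (hKΩ : K ⊆ Ω)
    (hw : MemLp w p volume) (hw' : ∀ i, MemLp (w' i) p volume) (hw0 : ∀ x ∉ K, w x = 0)
    (hw'0 : ∀ i, ∀ x ∉ K, w' i x = 0)
    (hd : ∀ i, ∀ φ : Euc n → ℝ, ContDiff ℝ ∞ φ → HasCompactSupport φ →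
      ∫ x, w x * fderiv ℝ φ x (unitVec i) = -∫ x, w' i x * φ x) :
    (∫ x, f₀ x * w x) - ∑ i, ∫ x, f i x * w' i x = 0 := by
  have hp1 : 1 ≤ p := ENNReal.HolderConjugate.one_le p q
  -- The margin δ leaves room for mollifying at radius at most δ without leaving Ω.
  obtain ⟨δ, hδ, hδΩ⟩ := hK.exists_cthickening_subset_open Ω.2 hKΩ
  set K₁ := Metric.cthickening δ K with hK₁
  have hK₁c : IsCompact K₁ := hK.cthickening
  have hind : ∀ {u : Euc n → ℝ}, MemLpLoc Ω q u → MemLp (K₁.indicator u) q volume := fun hu =>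
    (memLp_indicator_iff_restrict hK₁c.measurableSet).2 (hu K₁ hK₁c hδΩ)
  have hmul : ∀ (u v : Euc n → ℝ), (∀ x ∉ K₁, v x = 0) → ∀ x, K₁.indicator u x * v x = u x * v x := by
    intro u v hv x
    by_cases hx : x ∈ K₁
    · rw [indicator_of_mem hx]
    · rw [hv x hx, mul_zero, mul_zero]
  have hKK₁ : K ⊆ K₁ := Metric.self_subset_cthickening K
  -- c(t) is the relation tested against the translate of w by t; the goal is c(0) = 0. Cutting the
  -- coefficients off to K₁ puts them in L^q of the whole space, so that c is defined and continuous
  -- for all t.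
  set c : Euc n → ℝ := fun t => (∫ x, K₁.indicator f₀ x * w (x - t))
    - ∑ i, ∫ x, K₁.indicator (f i) x * w' i (x - t) with hc
  have hcc : Continuous c := (continuous_integral_mul_translate hp (hind hf₀) hw).sub
    (continuous_finsetSum _ fun i _ => continuous_integral_mul_translate hp (hind (hf i)) (hw' i))
  -- The mollification of w is an admissible test function supported in K₁, and Fubini turns the
  -- tested relation into ∫ ρ c = 0.
  have hzero : ∀ ρ : ContDiffBump (0 : Euc n), ρ.rOut ≤ δ →
      ∫ t, ρ.normed volume t * c t = 0 := by
    intro ρ hρδ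
    set r := ρ.normed volume with hr
    have hrs : ContDiff ℝ ∞ r := ρ.contDiff_normed
    have hrc : HasCompactSupport r := ρ.hasCompactSupport_normed
    have hsupp : ∀ v : Euc n → ℝ, (∀ x ∉ K, v x = 0) → ∀ x ∉ K₁, ∫ t, r t * v (x - t) = 0 := by
      intro v hv x hx
      refine integral_eq_zero_of_ae (Filter.Eventually.of_forall fun t => ?_)
      by_cases ht : r t = 0
      · simp [ht]
      · have h1 : t ∈ Function.support r := ht
        rw [hr, ρ.support_normed_eq, mem_ball_zero_iff] at h1
        have h2 : x - t ∉ K := fun h => hx <| Metric.mem_cthickening_of_dist_le x (x - t) δ K h <| by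
          rw [dist_eq_norm]; simpa using (h1.le.trans hρδ)
        simp [hv _ h2]
    have hsm : ContDiff ℝ ∞ (fun x => ∫ t, r t * w (x - t)) :=
      hrc.contDiff_convolution_left (ContinuousLinearMap.mul ℝ ℝ) hrs (hw.locallyIntegrable hp1)
    have hts : tsupport (fun x => ∫ t, r t * w (x - t)) ⊆ K₁ :=
      closure_minimal (fun x hx => by_contra fun h => hx (hsupp w hw0 x h)) hK₁c.isClosed
    have := hT _ hsm (HasCompactSupport.of_support_subset_isCompact hK₁c
      ((subset_tsupport _).trans hts)) (hts.trans hδΩ)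
    simp only [fun i x => fderiv_mollify i (hw.locallyIntegrable hp1) (hd i) hrs hrc x] at this
    have e0 : ∀ (u v : Euc n → ℝ), (∀ x ∉ K, v x = 0) → MemLpLoc Ω q u → MemLp v p volume →
        ∫ x, u x * ∫ t, r t * v (x - t) = ∫ t, r t * ∫ x, K₁.indicator u x * v (x - t) := by
      intro u v hv hu hvp
      rw [← integral_mul_convolution hp (hind hu) hvp hrs.continuous hrc]
      exact integral_congr_ae (Filter.Eventually.of_forall fun x => (hmul u _ (hsupp v hv) x).symm)
    rw [e0 f₀ w hw0 hf₀ hw] at this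
    simp only [fun i => e0 (f i) (w' i) (hw'0 i) (hf i) (hw' i)] at this
    have hi : ∀ u v : Euc n → ℝ, MemLpLoc Ω q u → MemLp v p volume →
        Integrable fun t => r t * ∫ x, K₁.indicator u x * v (x - t) := fun u v hu hv =>
      (hrs.continuous.mul (continuous_integral_mul_translate hp (hind hu) hv)).integrable_of_hasCompactSupport
        hrc.mul_right
    rw [← this, hc]
    simp only [mul_sub, Finset.mul_sum]
    rw [integral_sub (hi _ _ hf₀ hw) (integrable_finsetSum _ fun i _ => hi _ _ (hf i) (hw' i)),
      integral_finsetSum _ fun i _ => hi _ _ (hf i) (hw' i)]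
  have hlim : c 0 = 0 := by
    -- Outer radii δ/(k+1) tend to zero and never exceed δ.
    let b : ℕ → ContDiffBump (0 : Euc n) := fun k =>
      ⟨δ / (k + 2), δ / (k + 1), by positivity, by gcongr; linarith⟩
    have hb : Filter.Tendsto (fun k => (b k).rOut) Filter.atTop (nhds 0) :=
by
      have := (tendsto_one_div_add_atTop_nhds_zero_nat (𝕜 := ℝ)).const_mul δ
      simpa [b, div_eq_mul_inv] using this
    -- The averages ∫ ρ c are convolutions at 0 of ρ with t ↦ c(-t), hence the reflection.
    have ht := ContDiffBump.convolution_tendsto_right_of_continuous (μ := volume) hb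
      (hcc.comp continuous_neg) 0
    have hz : ∀ k, ((b k).normed volume ⋆[ContinuousLinearMap.lsmul ℝ ℝ, volume]
        (c ∘ Neg.neg)) 0 = 0 := fun k => by
      have := hzero (b k) (div_le_self hδ.le (by linarith [(Nat.cast_nonneg k : (0:ℝ) ≤ k)]))
      simpa [convolution_def] using this
    simp only [hz] at ht
    simpa using (tendsto_nhds_unique ht tendsto_const_nhds)
  have hfin : ∀ (u v : Euc n → ℝ), (∀ x ∉ K, v x = 0) →
      ∫ x, K₁.indicator u x * v (x - 0) = ∫ x, u x * v x := fun u v hv => by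
    simp only [sub_zero]
    exact integral_congr_ae (Filter.Eventually.of_forall
      (hmul u v fun x hx => hv x fun h => hx (hKK₁ h)))
  rw [hc] at hlim
  simpa only [hfin f₀ w hw0, fun i => hfin (f i) (w' i) (hw'0 i)] using hlim

end Pairing

end LowReg

/-! ### The classes L^{∞⁻}_loc and W^{1,∞⁻}_loc, regular distributions and weak derivatives -/

namespace LowReg

section FunctionSpaces

variable {n : ℕ} {Ω : Opens (Euc n)}

/-- `f ∈ L^p_loc(Ω)` for all `1 ≤ p < ∞`. -/
def MemLFin (Ω : Opens (Euc n)) (f : Euc n → ℝ) : Prop :=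
  ∀ p : ℝ≥0∞, 1 ≤ p → p < ⊤ → MemLpLoc Ω p f

/-- `f ∈ W^{1,p}_loc(Ω)` for all `1 ≤ p < ∞`. -/
def MemWFin (Ω : Opens (Euc n)) (f : Euc n → ℝ) : Prop :=
  ∀ p : ℝ≥0∞, 1 ≤ p → p < ⊤ → MemW1Loc Ω p f

theorem MemLpLoc.locallyIntegrableOn {p : ℝ≥0∞} (hp : 1 ≤ p) {f : Euc n → ℝ}
    (hf : MemLpLoc Ω p f) : LocallyIntegrableOn f Ω volume := by
  rw [locallyIntegrableOn_iff Ω.isOpen.isLocallyClosed]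
  intro K hK hKc
  have : IsFiniteMeasure (volume.restrict K : Measure (Euc n)) :=
    isFiniteMeasure_restrict.2 hKc.measure_lt_top.ne
  exact (hf K hKc hK).integrable hp

theorem MemLpLoc.congr {p : ℝ≥0∞} {f g : Euc n → ℝ} (hf : MemLpLoc Ω p f)
    (h : f =ᵐ[volume.restrict Ω] g) : MemLpLoc Ω p g := fun K hK hKΩ =>
  (memLp_congr_ae (ae_restrict_of_ae_restrict_of_subset hKΩ h)).1 (hf K hK hKΩ)

theorem MemLpLoc.mono {p : ℝ≥0∞} {f : Euc n → ℝ} {Ω' : Opens (Euc n)} (hf : MemLpLoc Ω p f)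
    (h : Ω' ≤ Ω) : MemLpLoc Ω' p f := fun K hK hKΩ => hf K hK (hKΩ.trans h)

theorem MemLFin.locallyIntegrableOn {f : Euc n → ℝ} (hf : MemLFin Ω f) :
    LocallyIntegrableOn f Ω volume :=
  (hf 1 le_rfl ENNReal.one_lt_top).locallyIntegrableOn le_rfl

theorem MemLFin.congr {f g : Euc n → ℝ} (hf : MemLFin Ω f) (h : f =ᵐ[volume.restrict Ω] g) :
    MemLFin Ω g := fun p h1 h2 => (hf p h1 h2).congr h

theorem MemLFin.mono {f : Euc n → ℝ} {Ω' : Opens (Euc n)} (hf : MemLFin Ω f) (h : Ω' ≤ Ω) :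
    MemLFin Ω' f := fun p h1 h2 => (hf p h1 h2).mono h

theorem MemLFin.add {f g : Euc n → ℝ} (hf : MemLFin Ω f) (hg : MemLFin Ω g) :
    MemLFin Ω fun x => f x + g x := fun p h1 h2 K hK hKΩ =>
  (hf p h1 h2 K hK hKΩ).add (hg p h1 h2 K hK hKΩ)

theorem MemLFin.sub {f g : Euc n → ℝ} (hf : MemLFin Ω f) (hg : MemLFin Ω g) :
    MemLFin Ω fun x => f x - g x := fun p h1 h2 K hK hKΩ =>
  (hf p h1 h2 K hK hKΩ).sub (hg p h1 h2 K hK hKΩ)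

theorem MemLFin.neg {f : Euc n → ℝ} (hf : MemLFin Ω f) : MemLFin Ω fun x => -f x :=
  fun p h1 h2 K hK hKΩ => (hf p h1 h2 K hK hKΩ).neg

/-- Hölder with exponents 2p and 2p. This closure under products is the reason for working with all
finite exponents at once. -/
theorem MemLFin.mul {f g : Euc n → ℝ} (hf : MemLFin Ω f) (hg : MemLFin Ω g) :
    MemLFin Ω fun x => f x * g x := fun p h1 h2 K hK hKΩ => by
  have h3 : 1 ≤ p * 2 := h1.trans (le_mul_of_one_le_right' (by norm_num))
  have h4 : p * 2 < ⊤ := ENNReal.mul_lt_top h2 (by simp)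
  have : ENNReal.HolderTriple (p * 2) (p * 2) p := ⟨by
    rw [← two_mul, ENNReal.mul_inv (by simp) (by simp), mul_comm, mul_assoc,
      ENNReal.inv_mul_cancel (by simp) (by simp), mul_one]⟩
  exact MemLp.mul' (hg _ h3 h4 K hK hKΩ) (hf _ h3 h4 K hK hKΩ)

theorem ContinuousOn.memLFin {f : Euc n → ℝ} (hf : ContinuousOn f Ω) : MemLFin Ω f :=
  fun p _ _ K hK hKΩ => by
    have : IsFiniteMeasure (volume.restrict K : Measure (Euc n)) :=
      isFiniteMeasure_restrict.2 hK.measure_lt_top.ne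
    obtain ⟨C, hC⟩ := hK.exists_bound_of_continuousOn (hf.mono hKΩ)
    exact MemLp.of_bound ((hf.mono hKΩ).aestronglyMeasurable hK.measurableSet) C
      ((ae_restrict_iff' hK.measurableSet).2 (Filter.Eventually.of_forall hC))

theorem memLFin_const (c : ℝ) : MemLFin Ω fun _ => c := ContinuousOn.memLFin continuousOn_const

theorem MemLFin.sum {ι : Type*} {s : Finset ι} {f : ι → Euc n → ℝ} (hf : ∀ i ∈ s, MemLFin Ω (f i)) :
    MemLFin Ω fun x => ∑ i ∈ s, f i x := by
  classical
  induction s using Finset.induction_on with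
  | empty => simpa using memLFin_const 0
  | insert a s ha ih =>
    simp only [Finset.sum_insert ha]
    exact (hf a (Finset.mem_insert_self a s)).add
      (ih fun i hi => hf i (Finset.mem_insert_of_mem hi))

theorem _root_.MeasureTheory.LocallyIntegrableOn.congr_ae_restrict {f g : Euc n → ℝ}
    (hf : LocallyIntegrableOn f Ω volume) (h : f =ᵐ[volume.restrict Ω] g) :
    LocallyIntegrableOn g Ω volume := by
  rw [locallyIntegrableOn_iff Ω.isOpen.isLocallyClosed] at hf ⊢
  exact fun K hK hKc =>
    (hf K hK hKc).congr (ae_restrict_of_ae_restrict_of_subset hK h)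

/-! ### Test functions and regular distributions -/

theorem integrable_mul_test {f φ : Euc n → ℝ} (hf : LocallyIntegrableOn f Ω volume)
    (hφ : Continuous φ) (hc : HasCompactSupport φ) (hs : tsupport φ ⊆ Ω) :
    Integrable fun x => f x * φ x := by
  have h1 : IntegrableOn (fun x => f x * φ x) (tsupport φ) volume :=
    (hf.integrableOn_compact_subset hs hc).mul_continuousOn hφ.continuousOn hc
  refine (integrableOn_iff_integrable_of_support_subset fun x hx => subset_tsupport φ ?_).1 h1
  exact fun h => hx (by simp [h])

/-- The test function given by a smooth function with compact support in `Ω`. -/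
def mkTest (φ : Euc n → ℝ) (h1 : ContDiff ℝ ∞ φ) (h2 : HasCompactSupport φ)
    (h3 : tsupport φ ⊆ Ω) : 𝓓(Ω, ℝ) := ⟨φ, h1, h2, h3⟩

theorem ofFun_apply {f : Euc n → ℝ} (hf : LocallyIntegrableOn f Ω volume) (φ : 𝓓(Ω, ℝ)) :
    ofFun Ω f φ = ∫ x, f x * φ x := by
  have : ofFun Ω f φ = ∫ x, φ x * f x :=
    TestFunction.integralAgainstBilinCLM_eq_integral (B := ContinuousLinearMap.mul ℝ ℝ) hf
  simpa only [mul_comm] using this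

theorem testDeriv_apply (φ : 𝓓(Ω, ℝ)) (v x : Euc n) :
    (∂_{v} φ : 𝓓(Ω, ℝ)) x = fderiv ℝ φ x v := by
  rw [TestFunction.lineDerivOp_eq_lineDerivCLM (𝕜 := ℝ),
    TestFunction.lineDerivCLM_apply_of_le (by simp)]
  exact (φ.contDiff.differentiable (by simp)).differentiableAt.lineDeriv_eq_fderiv

theorem distDeriv_apply (T : 𝓓'(Ω, ℝ)) (v : Euc n) (φ : 𝓓(Ω, ℝ)) :
    (∂_{v} T) φ = -T (∂_{v} φ) := by
  rw [Distribution.lineDerivOp_apply_apply, map_neg]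

theorem distDeriv_ofFun_apply {f : Euc n → ℝ} (hf : LocallyIntegrableOn f Ω volume) (v : Euc n)
    (φ : 𝓓(Ω, ℝ)) : (∂_{v} (ofFun Ω f)) φ = -∫ x, f x * fderiv ℝ φ x v := by
  rw [distDeriv_apply, ofFun_apply hf]
  simp only [testDeriv_apply]

theorem ofFun_congr {f g : Euc n → ℝ} (h : f =ᵐ[volume.restrict Ω] g) : ofFun Ω f = ofFun Ω g := by
  by_cases hf : LocallyIntegrableOn f Ω volume
  · have hg := hf.congr_ae_restrict h
    ext φ
    rw [ofFun_apply hf, ofFun_apply hg]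
    refine integral_congr_ae ?_
    rw [Filter.EventuallyEq, ae_restrict_iff' Ω.isOpen.measurableSet] at h
    filter_upwards [h] with x hx
    by_cases hxΩ : x ∈ (Ω : Set (Euc n))
    · rw [hx hxΩ]
    · rw [image_eq_zero_of_notMem_tsupport fun hx => hxΩ (φ.tsupport_subset hx), mul_zero, mul_zero]
  -- Both sides take the default value 0 assigned to functions that are not locally integrable.
  · have hg : ¬LocallyIntegrableOn g Ω volume := fun hg => hf (hg.congr_ae_restrict h.symm)
    simp only [ofFun, TestFunction.integralAgainstBilinCLM_eq_zero hf,
      TestFunction.integralAgainstBilinCLM_eq_zero hg]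

theorem ofFun_add {f g : Euc n → ℝ} (hf : MemLFin Ω f) (hg : MemLFin Ω g) :
    ofFun Ω (fun x => f x + g x) = ofFun Ω f + ofFun Ω g := by
  ext φ
  change _ = ofFun Ω f φ + ofFun Ω g φ
  rw [ofFun_apply (hf.add hg).locallyIntegrableOn, ofFun_apply hf.locallyIntegrableOn,
    ofFun_apply hg.locallyIntegrableOn, ← integral_add
      (integrable_mul_test hf.locallyIntegrableOn φ.continuous φ.hasCompactSupport φ.tsupport_subset)
      (integrable_mul_test hg.locallyIntegrableOn φ.continuous φ.hasCompactSupport φ.tsupport_subset)]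
  simp only [add_mul]

theorem ofFun_neg {f : Euc n → ℝ} (hf : MemLFin Ω f) :
    ofFun Ω (fun x => -f x) = -ofFun Ω f := by
  ext φ
  change _ = -(ofFun Ω f φ)
  rw [ofFun_apply hf.neg.locallyIntegrableOn, ofFun_apply hf.locallyIntegrableOn, ← integral_neg]
  simp only [neg_mul]

theorem ofFun_sub {f g : Euc n → ℝ} (hf : MemLFin Ω f) (hg : MemLFin Ω g) :
    ofFun Ω (fun x => f x - g x) = ofFun Ω f - ofFun Ω g := by
  simp only [sub_eq_add_neg]
  rw [ofFun_add hf hg.neg, ofFun_neg hg]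

theorem ofFun_zero : ofFun Ω (fun _ : Euc n => (0 : ℝ)) = 0 := by
  ext φ
  rw [ofFun_apply (memLFin_const 0).locallyIntegrableOn]
  simp

theorem ofFun_sum {ι : Type*} {s : Finset ι} {f : ι → Euc n → ℝ} (hf : ∀ i ∈ s, MemLFin Ω (f i)) :
    ofFun Ω (fun x => ∑ i ∈ s, f i x) = ∑ i ∈ s, ofFun Ω (f i) := by
  classical
  induction s using Finset.induction_on with
  | empty => simpa using ofFun_zero
  | insert a s ha ih =>
    simp only [Finset.sum_insert ha]
    rw [ofFun_add (hf a (Finset.mem_insert_self a s))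
      (MemLFin.sum fun i hi => hf i (Finset.mem_insert_of_mem hi)),
      ih fun i hi => hf i (Finset.mem_insert_of_mem hi)]

/-- The fundamental lemma of the calculus of variations. -/
theorem ae_eq_of_ofFun_eq {f g : Euc n → ℝ} (hf : LocallyIntegrableOn f Ω volume)
    (hg : LocallyIntegrableOn g Ω volume) (h : ofFun Ω f = ofFun Ω g) :
    f =ᵐ[volume.restrict Ω] g := by
  have := Ω.isOpen.ae_eq_zero_of_integral_contDiff_smul_eq_zero (hf.sub hg) fun φ h1 h2 h3 => by
    have h4 : ofFun Ω f (mkTest φ h1 h2 h3) = ofFun Ω g (mkTest φ h1 h2 h3) := by rw [h]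
    rw [ofFun_apply hf, ofFun_apply hg] at h4
    have h5 : ∫ x, f x * φ x = ∫ x, g x * φ x := h4
    have := integral_sub (integrable_mul_test hf h1.continuous h2 h3)
      (integrable_mul_test hg h1.continuous h2 h3)
    rw [h5, sub_self] at this
    rw [← this]
    congr 1; ext x; simp; ring
  rw [Filter.EventuallyEq, ae_restrict_iff' Ω.isOpen.measurableSet]
  filter_upwards [this] with x hx hxΩ
  exact sub_eq_zero.1 (hx hxΩ)

/-- `h = ∂ᵢ f` weakly on `Ω`, in terms of test functions. -/
def IsWeakDeriv (Ω : Opens (Euc n)) (i : Fin n) (f h : Euc n → ℝ) : Prop :=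
  ∀ φ : Euc n → ℝ, ContDiff ℝ ∞ φ → HasCompactSupport φ → tsupport φ ⊆ Ω →
    ∫ x, f x * fderiv ℝ φ x (unitVec i) = -∫ x, h x * φ x

theorem isWeakDeriv_iff {f h : Euc n → ℝ} {i : Fin n} (hf : LocallyIntegrableOn f Ω volume)
    (hh : LocallyIntegrableOn h Ω volume) :
    IsWeakDeriv Ω i f h ↔ ∂_{unitVec i} (ofFun Ω f) = ofFun Ω h := by
  constructor
  · intro H
    ext φ
    rw [distDeriv_ofFun_apply hf, ofFun_apply hh,
      H φ φ.contDiff φ.hasCompactSupport φ.tsupport_subset, neg_neg]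
  · intro H φ h1 h2 h3
    have := congrArg (fun T : 𝓓'(Ω, ℝ) => T (mkTest φ h1 h2 h3)) H
    rw [distDeriv_ofFun_apply hf, ofFun_apply hh] at this
    exact neg_eq_iff_eq_neg.1 this

theorem IsWeakDeriv.mono {f h : Euc n → ℝ} {i : Fin n} (H : IsWeakDeriv Ω i f h)
    {Ω' : Opens (Euc n)} (hΩ : Ω' ≤ Ω) : IsWeakDeriv Ω' i f h :=
  fun φ h1 h2 h3 => H φ h1 h2 (h3.trans hΩ)

theorem IsWeakDeriv.unique {f h h' : Euc n → ℝ} {i : Fin n}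
    (hh : LocallyIntegrableOn h Ω volume)
    (hh' : LocallyIntegrableOn h' Ω volume) (H : IsWeakDeriv Ω i f h) (H' : IsWeakDeriv Ω i f h') :
    h =ᵐ[volume.restrict Ω] h' := by
  refine ae_eq_of_ofFun_eq hh hh' ?_
  ext φ
  rw [ofFun_apply hh, ofFun_apply hh', ← neg_inj,
    ← H φ φ.contDiff φ.hasCompactSupport φ.tsupport_subset,
    ← H' φ φ.contDiff φ.hasCompactSupport φ.tsupport_subset]

theorem weakDeriv_spec {f h : Euc n → ℝ} {i : Fin n} (hh : LocallyIntegrableOn h Ω volume)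
    (H : ∂_{unitVec i} (ofFun Ω f) = ofFun Ω h) :
    LocallyIntegrableOn (weakDeriv Ω i f) Ω volume ∧
      ∂_{unitVec i} (ofFun Ω f) = ofFun Ω (weakDeriv Ω i f) := by
  have hex : ∃ v : Euc n → ℝ, LocallyIntegrableOn v Ω volume ∧
    ∂_{unitVec i} (ofFun Ω f) = ofFun Ω v := ⟨h, hh, H⟩
  rw [weakDeriv, dif_pos hex]
  exact hex.choose_spec

theorem MemWFin.memLFin {f : Euc n → ℝ} (hf : MemWFin Ω f) : MemLFin Ω f :=
  fun p h1 h2 => (hf p h1 h2).1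

theorem MemWFin.distDeriv {f : Euc n → ℝ} (hf : MemWFin Ω f) (i : Fin n) :
    ∂_{unitVec i} (ofFun Ω f) = ofFun Ω (weakDeriv Ω i f) := by
  obtain ⟨h, h1, h2⟩ := (hf 1 le_rfl ENNReal.one_lt_top).2 i
  exact (weakDeriv_spec (h1.locallyIntegrableOn le_rfl) h2).2

/-- The hypothesis allows a different representative of the derivative for each p. All of them agree
almost everywhere with the single chosen one, which therefore lies in every L^p_loc. -/
theorem MemWFin.weakDeriv {f : Euc n → ℝ} (hf : MemWFin Ω f) (i : Fin n) :
    MemLFin Ω (weakDeriv Ω i f) := by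
  intro p hp1 hp2
  obtain ⟨h, h1, h2⟩ := (hf p hp1 hp2).2 i
  have h3 := weakDeriv_spec (h1.locallyIntegrableOn hp1) h2
  exact h1.congr (ae_eq_of_ofFun_eq (h1.locallyIntegrableOn hp1) h3.1 (h2.symm.trans h3.2))

theorem MemWFin.isWeakDeriv {f : Euc n → ℝ} (hf : MemWFin Ω f) (i : Fin n) :
    IsWeakDeriv Ω i f (LowReg.weakDeriv Ω i f) :=
  (isWeakDeriv_iff hf.memLFin.locallyIntegrableOn (hf.weakDeriv i).locallyIntegrableOn).2
    (hf.distDeriv i)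

theorem MemWFin.of_isWeakDeriv {f : Euc n → ℝ} {h : Fin n → Euc n → ℝ} (hf : MemLFin Ω f)
    (hh : ∀ i, MemLFin Ω (h i)) (H : ∀ i, IsWeakDeriv Ω i f (h i)) : MemWFin Ω f :=
  fun p h1 h2 => ⟨hf p h1 h2, fun i => ⟨h i, hh i p h1 h2,
    (isWeakDeriv_iff hf.locallyIntegrableOn (hh i).locallyIntegrableOn).1 (H i)⟩⟩

theorem MemWFin.weakDeriv_ae_eq {f h : Euc n → ℝ} {i : Fin n} (hf : MemWFin Ω f)
    (hh : MemLFin Ω h) (H : IsWeakDeriv Ω i f h) :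
    LowReg.weakDeriv Ω i f =ᵐ[volume.restrict Ω] h :=
  (hf.isWeakDeriv i).unique (hf.weakDeriv i).locallyIntegrableOn hh.locallyIntegrableOn H

end FunctionSpaces

end LowReg

/-! ### Testing against u φ with u Sobolev, and the Leibniz rule -/

namespace LowReg

section Products

variable {n : ℕ} {Ω : Opens (Euc n)}

theorem contDiff_fderiv_apply {φ : Euc n → ℝ} (h : ContDiff ℝ ∞ φ) (v : Euc n) :
    ContDiff ℝ ∞ fun x => fderiv ℝ φ x v :=
  (h.fderiv_right (m := ∞) (by simp)).clm_apply contDiff_const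

theorem tsupport_fderiv_apply_subset' (φ : Euc n → ℝ) (v : Euc n) :
    tsupport (fun x => fderiv ℝ φ x v) ⊆ tsupport φ :=
  tsupport_fderiv_apply_subset ℝ v

/-- A relation `f₀ + ∑ᵢ ∂ᵢ fᵢ = 0` between functions in `L^q_loc` may be tested against `u φ` with
`u ∈ W^{1,p}_loc` and `φ` a test function. -/
theorem pairing_mul_test_eq_zero {p q : ℝ≥0∞} [q.HolderConjugate p] (hp : p ≠ ⊤)
    {f₀ : Euc n → ℝ} {f : Fin n → Euc n → ℝ} (hf₀ : MemLpLoc Ω q f₀) (hf : ∀ i, MemLpLoc Ω q (f i))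
    (hT : ∀ φ : Euc n → ℝ, ContDiff ℝ ∞ φ → HasCompactSupport φ → tsupport φ ⊆ Ω →
      (∫ x, f₀ x * φ x) - ∑ i, ∫ x, f i x * fderiv ℝ φ x (unitVec i) = 0)
    {u : Euc n → ℝ} {u' : Fin n → Euc n → ℝ} (hu : MemLpLoc Ω p u) (hu' : ∀ i, MemLpLoc Ω p (u' i))
    (hd : ∀ i, IsWeakDeriv Ω i u (u' i)) {φ : Euc n → ℝ} (h1 : ContDiff ℝ ∞ φ)
    (h2 : HasCompactSupport φ) (h3 : tsupport φ ⊆ Ω) :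
    (∫ x, f₀ x * (u x * φ x))
      - ∑ i, ∫ x, f i x * (u' i x * φ x + u x * fderiv ℝ φ x (unitVec i)) = 0 := by
  have hp1 : 1 ≤ p := ENNReal.HolderConjugate.one_le p q
  have hmem : ∀ v ψ : Euc n → ℝ, MemLpLoc Ω p v → Continuous ψ → tsupport ψ ⊆ tsupport φ →
      MemLp (fun x => v x * ψ x) p volume := by
    intro v ψ hv hψ hs
    have hi : (tsupport φ).indicator (fun x => v x * ψ x) = fun x => v x * ψ x := by
      ext x
      by_cases hx : x ∈ tsupport φ
      · rw [indicator_of_mem hx]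
      · rw [indicator_of_notMem hx,
          image_eq_zero_of_notMem_tsupport fun h => hx (hs h), mul_zero]
    rw [← hi, memLp_indicator_iff_restrict h2.measurableSet]
    -- A continuous factor is bounded on the compact support, hence an L^∞ multiplier of L^p.
    have : MemLp ψ ⊤ (volume.restrict (tsupport φ)) := by
      obtain ⟨C, hC⟩ := h2.exists_bound_of_continuousOn hψ.continuousOn
      exact memLp_top_of_bound hψ.aestronglyMeasurable C
        ((ae_restrict_iff' h2.measurableSet).2 (Filter.Eventually.of_forall hC))
    exact MemLp.mul' this (hv _ h2 h3)
  have hφ' : ∀ i, Continuous fun x => fderiv ℝ φ x (unitVec i) := fun i =>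
    (contDiff_fderiv_apply h1 _).continuous
  -- The test function is w = u φ, with w'ᵢ = u'ᵢ φ + u ∂ᵢφ.
  refine pairing_eq_zero hp hf₀ hf hT (K := tsupport φ) h2 h3
    (hmem u φ hu h1.continuous le_rfl)
    (fun i => (hmem (u' i) φ (hu' i) h1.continuous le_rfl).add
      (hmem u _ hu (hφ' i) (tsupport_fderiv_apply_subset' φ _)))
    (fun x hx => by rw [image_eq_zero_of_notMem_tsupport hx, mul_zero])
    (fun i x hx => by
      rw [image_eq_zero_of_notMem_tsupport hx,
        image_eq_zero_of_notMem_tsupport fun h => hx (tsupport_fderiv_apply_subset' φ _ h),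
        mul_zero, mul_zero, add_zero])
    (fun i ψ hψ1 hψ2 => ?_)
  -- The weak derivative of w is needed on all of ℝⁿ. The test function ψ may leave Ω, but φ ψ does
  -- not, so the derivative of u can be tested against φ ψ.
  have hψs : tsupport (fun x => φ x * ψ x) ⊆ Ω := (tsupport_mul_subset_left (f := φ) (g := ψ)).trans h3
  have key := hd i (fun x => φ x * ψ x) (h1.mul hψ1) h2.mul_right hψs
  have e : ∀ x, fderiv ℝ (fun x => φ x * ψ x) x (unitVec i)
      = φ x * fderiv ℝ ψ x (unitVec i) + fderiv ℝ φ x (unitVec i) * ψ x := fun x => by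
    rw [fderiv_fun_mul (h1.differentiable (by simp) x) (hψ1.differentiable (by simp) x)]
    simp; ring
  simp only [e] at key ⊢
  have hul := hu.locallyIntegrableOn hp1
  have i1 : Integrable fun x => u x * (φ x * fderiv ℝ ψ x (unitVec i)) :=
    integrable_mul_test hul (h1.continuous.mul (contDiff_fderiv_apply hψ1 _).continuous)
      h2.mul_right ((tsupport_mul_subset_left (f := φ)).trans h3)
  have i2 : Integrable fun x => u x * (fderiv ℝ φ x (unitVec i) * ψ x) :=
    integrable_mul_test hul ((hφ' i).mul hψ1.continuous)
      hψ2.mul_left ((tsupport_mul_subset_left (f := fun x => fderiv ℝ φ x (unitVec i))).trans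
        ((tsupport_fderiv_apply_subset' φ _).trans h3))
  have i3 : Integrable fun x => u' i x * (φ x * ψ x) :=
    integrable_mul_test ((hu' i).locallyIntegrableOn hp1) (h1.continuous.mul hψ1.continuous)
      h2.mul_right hψs
  simp only [mul_add] at key
  rw [integral_add i1 i2] at key
  have e1 : ∫ x, u x * φ x * fderiv ℝ ψ x (unitVec i)
      = ∫ x, u x * (φ x * fderiv ℝ ψ x (unitVec i)) := by congr 1; ext x; ring
  have e2 : ∫ x, (u' i x * φ x + u x * fderiv ℝ φ x (unitVec i)) * ψ x
      = (∫ x, u' i x * (φ x * ψ x)) + ∫ x, u x * (fderiv ℝ φ x (unitVec i) * ψ x) := by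
    rw [← integral_add i3 i2]; congr 1; ext x; ring
  rw [e1, e2]
  linarith

/-! ### The algebra `W^{1,∞⁻}_loc` -/

/-- Used to feed a single derivative ∂ᵢ into relations that carry a full family of n coefficients.
-/
theorem sum_integral_single {i : Fin n} {v : Euc n → ℝ} (F : Fin n → Euc n → ℝ) :
    ∑ j, ∫ x, (if j = i then v x else 0) * F j x = ∫ x, v x * F i x := by
  rw [Finset.sum_eq_single i (fun j _ hj => by simp [hj]) (by simp)]
  simp

theorem MemLFin.ite {v : Euc n → ℝ} (hv : MemLFin Ω v) (P : Prop) [Decidable P] :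
    MemLFin Ω fun x => if P then v x else 0 := by
  by_cases h : P
  · simpa [h] using hv
  · simpa [h] using memLFin_const 0

/-- The definition of ∂ᵢ v is itself a relation f₀ + ∂ᵢ fᵢ = 0, with f₀ = ∂ᵢ v and fᵢ = -v. Testing
it against u φ instead of φ is the Leibniz rule; the conjugate exponents 2 and 2 suffice. -/
theorem IsWeakDeriv.mul {u v : Euc n → ℝ} (i : Fin n) (hu : MemWFin Ω u) (hv : MemWFin Ω v) :
    IsWeakDeriv Ω i (fun x => u x * v x)
      fun x => weakDeriv Ω i u x * v x + u x * weakDeriv Ω i v x := by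
  intro φ h1 h2 h3
  have : ENNReal.HolderConjugate 2 2 := inferInstance
  have key := pairing_mul_test_eq_zero (p := 2) (q := 2) (by simp)
    (f₀ := weakDeriv Ω i v) (f := fun j x => if j = i then -v x else 0)
    (hv.weakDeriv i 2 (by simp) (by simp)) (fun j => (hv.memLFin.neg.ite (j = i)) 2 (by simp) (by simp))
    (fun φ h1 h2 h3 => by
      rw [sum_integral_single (v := fun x => -v x)]
      simp only [neg_mul, integral_neg]
      rw [hv.isWeakDeriv i φ h1 h2 h3]
      ring)
    (hu.memLFin 2 (by simp) (by simp)) (fun j => hu.weakDeriv j 2 (by simp) (by simp))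
    hu.isWeakDeriv h1 h2 h3
  rw [sum_integral_single (v := fun x => -v x)] at key
  have iL : ∀ {w ψ : Euc n → ℝ}, MemLFin Ω w → Continuous ψ → tsupport ψ ⊆ tsupport φ →
      Integrable fun x => w x * ψ x := fun hw hψ hs =>
    integrable_mul_test hw.locallyIntegrableOn hψ (h2.of_isClosed_subset (isClosed_tsupport _) hs)
      (hs.trans h3)
  have hφ' := (contDiff_fderiv_apply h1 (unitVec i)).continuous
  have hs' := tsupport_fderiv_apply_subset' φ (unitVec i)
  have i1 := iL ((hu.weakDeriv i).mul hv.memLFin) h1.continuous le_rfl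
  have i2 := iL (hu.memLFin.mul (hv.weakDeriv i)) h1.continuous le_rfl
  have i3 := iL (hu.memLFin.mul hv.memLFin) hφ' hs'
  have e1 : ∫ x, -v x * (weakDeriv Ω i u x * φ x + u x * fderiv ℝ φ x (unitVec i))
      = -(∫ x, weakDeriv Ω i u x * v x * φ x) - ∫ x, u x * v x * fderiv ℝ φ x (unitVec i) := by
    have := integral_sub i1.neg i3
    simp only [Pi.neg_apply, integral_neg] at this
    rw [← this]
    congr 1; ext x; ring
  have e2 : ∫ x, (weakDeriv Ω i u x * v x + u x * weakDeriv Ω i v x) * φ x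
      = (∫ x, weakDeriv Ω i u x * v x * φ x) + ∫ x, u x * weakDeriv Ω i v x * φ x := by
    rw [← integral_add i1 i2]
    congr 1; ext x; ring
  have e3 : ∫ x, weakDeriv Ω i v x * (u x * φ x) = ∫ x, u x * weakDeriv Ω i v x * φ x := by
    congr 1; ext x; ring
  rw [e1, e3] at key
  rw [e2]
  linarith

theorem MemWFin.mul {u v : Euc n → ℝ} (hu : MemWFin Ω u) (hv : MemWFin Ω v) :
    MemWFin Ω fun x => u x * v x :=
  .of_isWeakDeriv (hu.memLFin.mul hv.memLFin)
    (fun i => ((hu.weakDeriv i).mul hv.memLFin).add (hu.memLFin.mul (hv.weakDeriv i)))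
    fun i => IsWeakDeriv.mul i hu hv

theorem weakDeriv_mul {u v : Euc n → ℝ} (hu : MemWFin Ω u) (hv : MemWFin Ω v) (i : Fin n) :
    weakDeriv Ω i (fun x => u x * v x) =ᵐ[volume.restrict Ω]
      fun x => weakDeriv Ω i u x * v x + u x * weakDeriv Ω i v x :=
  (hu.mul hv).weakDeriv_ae_eq
    (((hu.weakDeriv i).mul hv.memLFin).add (hu.memLFin.mul (hv.weakDeriv i))) (.mul i hu hv)

theorem isWeakDeriv_of_ofFun {f h : Euc n → ℝ} {i : Fin n} (hf : MemLFin Ω f) (hh : MemLFin Ω h)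
    (H : ∂_{unitVec i} (ofFun Ω f) = ofFun Ω h) : IsWeakDeriv Ω i f h :=
  (isWeakDeriv_iff hf.locallyIntegrableOn hh.locallyIntegrableOn).2 H

theorem IsWeakDeriv.sum {ι : Type*} {s : Finset ι} {u : ι → Euc n → ℝ} (i : Fin n)
    (hu : ∀ j ∈ s, MemWFin Ω (u j)) :
    IsWeakDeriv Ω i (fun x => ∑ j ∈ s, u j x) fun x => ∑ j ∈ s, weakDeriv Ω i (u j) x := by
  refine isWeakDeriv_of_ofFun (.sum fun j hj => (hu j hj).memLFin)
    (.sum fun j hj => (hu j hj).weakDeriv i) ?_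
  rw [ofFun_sum fun j hj => (hu j hj).memLFin, ofFun_sum fun j hj => (hu j hj).weakDeriv i,
    LineDeriv.lineDerivOp_sum]
  exact Finset.sum_congr rfl fun j hj => (hu j hj).distDeriv i

theorem MemWFin.sum {ι : Type*} {s : Finset ι} {u : ι → Euc n → ℝ}
    (hu : ∀ j ∈ s, MemWFin Ω (u j)) : MemWFin Ω fun x => ∑ j ∈ s, u j x :=
  .of_isWeakDeriv (.sum fun j hj => (hu j hj).memLFin)
    (fun i => .sum fun j hj => (hu j hj).weakDeriv i) fun i => .sum i hu

theorem weakDeriv_sum {ι : Type*} {s : Finset ι} {u : ι → Euc n → ℝ} (i : Fin n)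
    (hu : ∀ j ∈ s, MemWFin Ω (u j)) :
    weakDeriv Ω i (fun x => ∑ j ∈ s, u j x) =ᵐ[volume.restrict Ω]
      fun x => ∑ j ∈ s, weakDeriv Ω i (u j) x :=
  (MemWFin.sum hu).weakDeriv_ae_eq (.sum fun j hj => (hu j hj).weakDeriv i) (.sum i hu)

/-- An equality of functions and not only almost everywhere, since `weakDeriv` sees its argument
only through the distribution it defines. -/
theorem weakDeriv_congr {u v : Euc n → ℝ} (i : Fin n) (h : u =ᵐ[volume.restrict Ω] v) :
    weakDeriv Ω i u = weakDeriv Ω i v := by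
  unfold weakDeriv
  rw [ofFun_congr h]

theorem MemWFin.congr {u v : Euc n → ℝ} (hu : MemWFin Ω u) (h : u =ᵐ[volume.restrict Ω] v) :
    MemWFin Ω v := fun p h1 h2 =>
  ⟨(hu p h1 h2).1.congr h, fun i => by rw [← ofFun_congr h]; exact (hu p h1 h2).2 i⟩

/-- Integration by parts against the constant 1. -/
theorem integral_fderiv_eq_zero {φ : Euc n → ℝ} (h1 : ContDiff ℝ ∞ φ) (h2 : HasCompactSupport φ)
    (v : Euc n) : ∫ x, fderiv ℝ φ x v = 0 := by
  have h3 : Integrable fun x => fderiv ℝ φ x v :=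
    (contDiff_fderiv_apply h1 v).continuous.integrable_of_hasCompactSupport (h2.fderiv_apply ℝ v)
  have h4 : Integrable φ := h1.continuous.integrable_of_hasCompactSupport h2
  have := integral_mul_fderiv_eq_neg_fderiv_mul_of_integrable (μ := (volume : Measure (Euc n)))
    (f := fun _ => (1 : ℝ)) (g := φ) (v := v) (by simp) (by simpa using h3) (by simpa using h4)
    (by fun_prop) (fun x _ => h1.differentiable (by simp) x)
  simpa using this

theorem memWFin_const (c : ℝ) : MemWFin Ω fun _ => c :=
  .of_isWeakDeriv (h := fun _ _ => 0) (memLFin_const c) (fun _ => memLFin_const 0)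
    fun i φ h1 h2 _ => by
      rw [integral_const_mul, integral_fderiv_eq_zero h1 h2]; simp

theorem weakDeriv_const (c : ℝ) (i : Fin n) :
    weakDeriv Ω i (fun _ => c) =ᵐ[volume.restrict Ω] fun _ => 0 :=
  (memWFin_const c).weakDeriv_ae_eq (memLFin_const 0) fun φ h1 h2 _ => by
    rw [integral_const_mul, integral_fderiv_eq_zero h1 h2]; simp

theorem weakDeriv_const_mul {u : Euc n → ℝ} (c : ℝ) (hu : MemWFin Ω u) (i : Fin n) :
    weakDeriv Ω i (fun x => c * u x) =ᵐ[volume.restrict Ω] fun x => c * weakDeriv Ω i u x := by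
  filter_upwards [weakDeriv_mul (memWFin_const c) hu i, weakDeriv_const (Ω := Ω) c i] with x h1 h2
  rw [h1, h2]; ring

end Products

end LowReg

/-! ### Products of Sobolev functions with distributions of order one -/

namespace LowReg

section DistributionProducts

variable {n : ℕ}

/-- Duality between W^{1,n+1} and W^{-1,1+1/n} rests on this. It covers n = 0 as well, where the
exponents are ⊤ and 1. -/
instance holderConjugate_expo (n : ℕ) : (expo n).HolderConjugate (n + 1) := by
  constructor
  rw [expo, inv_one]
  rcases Nat.eq_zero_or_pos n with rfl | hn
  · simp
  · have h0 : (n : ℝ≥0∞) ≠ 0 := by exact_mod_cast hn.ne'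
    have ht : (n : ℝ≥0∞) ≠ ⊤ := ENNReal.natCast_ne_top n
    have h1 : (1 : ℝ≥0∞) + (n : ℝ≥0∞)⁻¹ = (n + 1) * (n : ℝ≥0∞)⁻¹ := by
      rw [add_mul, ENNReal.mul_inv_cancel h0 ht, one_mul]
    have hs0 : ((n : ℝ≥0∞) + 1) ≠ 0 := by simp
    have hst : ((n : ℝ≥0∞) + 1) ≠ ⊤ := by simp
    rw [h1, ENNReal.mul_inv (Or.inl hs0) (Or.inl hst), inv_inv]
    nth_rw 2 [← mul_one ((n : ℝ≥0∞) + 1)⁻¹]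
    rw [← mul_add, ENNReal.inv_mul_cancel hs0 hst]

theorem one_le_expo : 1 ≤ expo n := by simp [expo]

/-- This is where the dimension must be positive: for n = 0 the convention 0⁻¹ = ⊤ makes the
exponent infinite, outside the range covered by `MemLFin`. -/
theorem expo_lt_top [NeZero n] : expo n < ⊤ := by
  simp [expo, Nat.pos_of_neZero n]

variable {Ω : Opens (Euc n)}

/-- The distribution `f₀ + ∑ᵢ ∂ᵢ fᵢ`. -/
noncomputable def divForm (Ω : Opens (Euc n)) (f₀ : Euc n → ℝ) (f : Fin n → Euc n → ℝ) : 𝓓'(Ω, ℝ) :=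
  ofFun Ω f₀ + ∑ i, ∂_{unitVec i} (ofFun Ω (f i))

theorem distr_sum_apply {ι : Type*} (s : Finset ι) (T : ι → 𝓓'(Ω, ℝ)) (φ : 𝓓(Ω, ℝ)) :
    (∑ i ∈ s, T i) φ = ∑ i ∈ s, T i φ := by
  classical
  induction s using Finset.induction_on with
  | empty => simp
  | insert a s ha ih => rw [Finset.sum_insert ha, Finset.sum_insert ha, ← ih]; rfl

theorem divForm_apply {f₀ : Euc n → ℝ} {f : Fin n → Euc n → ℝ}
    (hf₀ : LocallyIntegrableOn f₀ Ω volume) (hf : ∀ i, LocallyIntegrableOn (f i) Ω volume)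
    (φ : 𝓓(Ω, ℝ)) :
    divForm Ω f₀ f φ = (∫ x, f₀ x * φ x) - ∑ i, ∫ x, f i x * fderiv ℝ φ x (unitVec i) := by
  change ofFun Ω f₀ φ + (∑ i, ∂_{unitVec i} (ofFun Ω (f i))) φ = _
  rw [ofFun_apply hf₀, distr_sum_apply, sub_eq_add_neg, ← Finset.sum_neg_distrib]
  simp only [fun i => distDeriv_ofFun_apply (hf i)]

theorem MemW1Loc.weakDeriv {p : ℝ≥0∞} (hp : 1 ≤ p) {u : Euc n → ℝ} (hu : MemW1Loc Ω p u) (i : Fin n) :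
    MemLpLoc Ω p (weakDeriv Ω i u) ∧ IsWeakDeriv Ω i u (weakDeriv Ω i u) := by
  obtain ⟨h, h1, h2⟩ := hu.2 i
  have h3 := weakDeriv_spec (h1.locallyIntegrableOn hp) h2
  exact ⟨h1.congr (ae_eq_of_ofFun_eq (h1.locallyIntegrableOn hp) h3.1 (h2.symm.trans h3.2)),
    (isWeakDeriv_iff (hu.1.locallyIntegrableOn hp) h3.1).2 h3.2⟩

theorem MemLpLoc.mul_locallyIntegrableOn {p q : ℝ≥0∞} [q.HolderConjugate p] {f u : Euc n → ℝ}
    (hf : MemLpLoc Ω q f) (hu : MemLpLoc Ω p u) :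
    LocallyIntegrableOn (fun x => f x * u x) Ω volume := by
  rw [locallyIntegrableOn_iff Ω.isOpen.isLocallyClosed]
  exact fun K hK hKc => (hf K hKc hK).integrable_mul (hu K hKc hK)

/-- The right side is T = f₀ + ∑ᵢ ∂ᵢ fᵢ evaluated formally at u φ. In this form the dependence on
the coefficients is linear, so two representations of T can be subtracted. -/
theorem productForm_apply {p q : ℝ≥0∞} [q.HolderConjugate p]
    {f₀ : Euc n → ℝ} {f : Fin n → Euc n → ℝ} (hf₀ : MemLpLoc Ω q f₀) (hf : ∀ i, MemLpLoc Ω q (f i))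
    {u : Euc n → ℝ} (hu : MemW1Loc Ω p u) (φ : 𝓓(Ω, ℝ)) :
    divForm Ω (fun x => u x * f₀ x - ∑ i, weakDeriv Ω i u x * f i x) (fun i x => u x * f i x) φ
      = (∫ x, f₀ x * (u x * φ x))
        - ∑ i, ∫ x, f i x * (weakDeriv Ω i u x * φ x + u x * fderiv ℝ φ x (unitVec i)) := by
  have hp : 1 ≤ p := ENNReal.HolderConjugate.one_le p q
  have l0 : LocallyIntegrableOn (fun x => u x * f₀ x) Ω volume := by
    simpa only [mul_comm] using hf₀.mul_locallyIntegrableOn hu.1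
  have l1 : ∀ i, LocallyIntegrableOn (fun x => u x * f i x) Ω volume := fun i => by
    simpa only [mul_comm] using (hf i).mul_locallyIntegrableOn hu.1
  have l2 : ∀ i, LocallyIntegrableOn (fun x => weakDeriv Ω i u x * f i x) Ω volume := fun i => by
    simpa only [mul_comm] using (hf i).mul_locallyIntegrableOn (hu.weakDeriv hp i).1
  have l3 : LocallyIntegrableOn (fun x => ∑ i, weakDeriv Ω i u x * f i x) Ω volume := by
    rw [locallyIntegrableOn_iff Ω.isOpen.isLocallyClosed]
    exact fun K hK hKc => integrable_finsetSum _ fun i _ => (l2 i).integrableOn_compact_subset hK hKc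
  have T : ∀ {w : Euc n → ℝ}, LocallyIntegrableOn w Ω volume → Integrable fun x => w x * φ x :=
    fun hw => integrable_mul_test hw φ.continuous φ.hasCompactSupport φ.tsupport_subset
  have T' : ∀ {w : Euc n → ℝ} (i : Fin n), LocallyIntegrableOn w Ω volume →
      Integrable fun x => w x * fderiv ℝ φ x (unitVec i) :=
    fun i hw => integrable_mul_test hw (contDiff_fderiv_apply φ.contDiff _).continuous
      (φ.hasCompactSupport.fderiv_apply ℝ _)
      ((tsupport_fderiv_apply_subset' _ _).trans φ.tsupport_subset)
  have l4 : LocallyIntegrableOn (fun x => u x * f₀ x - ∑ i, weakDeriv Ω i u x * f i x) Ω volume :=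
    l0.sub l3
  rw [divForm_apply l4 l1]
  have e1 : ∀ i, ∫ x, f i x * (weakDeriv Ω i u x * φ x + u x * fderiv ℝ φ x (unitVec i))
      = (∫ x, weakDeriv Ω i u x * f i x * φ x) + ∫ x, u x * f i x * fderiv ℝ φ x (unitVec i) :=
    fun i => by
      rw [← integral_add (T (l2 i)) (T' i (l1 i))]
      congr 1; ext x; ring
  simp only [e1, Finset.sum_add_distrib, sub_mul]
  rw [integral_sub (T l0) (T l3)]
  simp only [Finset.sum_mul]
  rw [integral_finsetSum _ fun i _ => T (l2 i)]
  have e2 : ∫ x, f₀ x * (u x * φ x) = ∫ x, u x * f₀ x * φ x := by congr 1; ext x; ring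
  rw [e2]; ring

/-- The difference of two representations of T is a relation f₀ + ∑ᵢ ∂ᵢ fᵢ = 0, which remains true
when tested against u φ. This makes the choice in `prod` immaterial. -/
theorem IsProduct.unique {u : Euc n → ℝ} {T S S' : 𝓓'(Ω, ℝ)} (h : IsProduct u T S)
    (h' : IsProduct u T S') : S = S' := by
  obtain ⟨hu, f₀, f, hf₀, hf, rfl, rfl⟩ := h
  obtain ⟨-, g₀, g, hg₀, hg, hT, rfl⟩ := h'
  change divForm Ω f₀ f = divForm Ω g₀ g at hT
  change divForm Ω _ _ = divForm Ω _ _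
  have hp1 : (1 : ℝ≥0∞) ≤ n + 1 := by simp
  have hq : 1 ≤ expo n := one_le_expo
  have L : ∀ {w : Euc n → ℝ}, MemLpLoc Ω (expo n) w → LocallyIntegrableOn w Ω volume :=
    fun hw => hw.locallyIntegrableOn hq
  ext φ
  rw [productForm_apply hf₀ hf hu, productForm_apply hg₀ hg hu]
  have key := pairing_mul_test_eq_zero (p := n + 1) (q := expo n) (by simp)
    (f₀ := fun x => f₀ x - g₀ x) (f := fun i x => f i x - g i x)
    (fun K hK hKΩ => (hf₀ K hK hKΩ).sub (hg₀ K hK hKΩ))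
    (fun i K hK hKΩ => (hf i K hK hKΩ).sub (hg i K hK hKΩ))
    (fun φ h1 h2 h3 => by
      have := congrArg (fun T : 𝓓'(Ω, ℝ) => T (mkTest φ h1 h2 h3)) hT
      rw [divForm_apply (L hf₀) fun i => L (hf i), divForm_apply (L hg₀) fun i => L (hg i)] at this
      change (∫ x, f₀ x * φ x) - ∑ i, ∫ x, f i x * fderiv ℝ φ x (unitVec i)
        = (∫ x, g₀ x * φ x) - ∑ i, ∫ x, g i x * fderiv ℝ φ x (unitVec i) at this
      have T : ∀ {w : Euc n → ℝ}, LocallyIntegrableOn w Ω volume → Integrable fun x => w x * φ x :=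
        fun hw => integrable_mul_test hw h1.continuous h2 h3
      have T' : ∀ {w : Euc n → ℝ} (i : Fin n), LocallyIntegrableOn w Ω volume →
          Integrable fun x => w x * fderiv ℝ φ x (unitVec i) :=
        fun i hw => integrable_mul_test hw (contDiff_fderiv_apply h1 _).continuous
          (h2.fderiv_apply ℝ _) ((tsupport_fderiv_apply_subset' _ _).trans h3)
      simp only [sub_mul]
      rw [integral_sub (T (L hf₀)) (T (L hg₀))]
      simp only [fun i => integral_sub (T' i (L (hf i))) (T' i (L (hg i))), Finset.sum_sub_distrib]
      linarith)
    hu.1 (fun i => (hu.weakDeriv hp1 i).1) (fun i => (hu.weakDeriv hp1 i).2)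
    φ.contDiff φ.hasCompactSupport φ.tsupport_subset
  have I0 : ∀ {w : Euc n → ℝ}, MemLpLoc Ω (expo n) w → Integrable fun x => w x * (u x * φ x) :=
    fun hw => by
      simpa only [mul_assoc] using integrable_mul_test (hw.mul_locallyIntegrableOn hu.1)
        φ.continuous φ.hasCompactSupport φ.tsupport_subset
  have I1 : ∀ {w : Euc n → ℝ} (i : Fin n), MemLpLoc Ω (expo n) w → Integrable fun x =>
      w x * (weakDeriv Ω i u x * φ x + u x * fderiv ℝ φ x (unitVec i)) := fun i hw => by
    have h1 := integrable_mul_test (hw.mul_locallyIntegrableOn (hu.weakDeriv hp1 i).1)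
        φ.continuous φ.hasCompactSupport φ.tsupport_subset
    have h2 := integrable_mul_test (hw.mul_locallyIntegrableOn hu.1)
      (contDiff_fderiv_apply φ.contDiff (unitVec i)).continuous
      (φ.hasCompactSupport.fderiv_apply ℝ _)
      ((tsupport_fderiv_apply_subset' _ _).trans φ.tsupport_subset)
    simpa only [mul_add, mul_assoc, Pi.add_def] using h1.add h2
  simp only [sub_mul] at key
  rw [integral_sub (I0 hf₀) (I0 hg₀)] at key
  simp only [fun i => integral_sub (I1 i (hf i)) (I1 i (hg i)), Finset.sum_sub_distrib] at key
  linarith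

theorem IsProduct.prod_eq {u : Euc n → ℝ} {T S : 𝓓'(Ω, ℝ)} (h : IsProduct u T S) :
    prod u T = S := by
  have hex : ∃ S, IsProduct u T S := ⟨S, h⟩
  rw [prod, dif_pos hex]
  exact hex.choose_spec.unique h

theorem MemWFin.memW1Loc {u : Euc n → ℝ} (hu : MemWFin Ω u) : MemW1Loc Ω (n + 1) u :=
  hu _ (by simp) (by finiteness)

theorem MemLFin.memLpLoc_expo [NeZero n] {f : Euc n → ℝ} (hf : MemLFin Ω f) :
    MemLpLoc Ω (expo n) f := hf _ one_le_expo expo_lt_top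

theorem divForm_congr {f₀ g₀ : Euc n → ℝ} {f g : Fin n → Euc n → ℝ}
    (h₀ : f₀ =ᵐ[volume.restrict Ω] g₀) (h : ∀ i, f i =ᵐ[volume.restrict Ω] g i) :
    divForm Ω f₀ f = divForm Ω g₀ g := by
  rw [divForm, divForm, ofFun_congr h₀]
  simp only [fun i => ofFun_congr (h i)]

theorem divForm_add {f₀ g₀ : Euc n → ℝ} {f g : Fin n → Euc n → ℝ} (hf₀ : MemLFin Ω f₀)
    (hf : ∀ i, MemLFin Ω (f i)) (hg₀ : MemLFin Ω g₀) (hg : ∀ i, MemLFin Ω (g i)) :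
    divForm Ω (fun x => f₀ x + g₀ x) (fun i x => f i x + g i x)
      = divForm Ω f₀ f + divForm Ω g₀ g := by
  simp only [divForm, ofFun_add hf₀ hg₀, fun i => ofFun_add (hf i) (hg i),
    LineDeriv.lineDerivOp_add, Finset.sum_add_distrib]
  abel

theorem divForm_neg {f₀ : Euc n → ℝ} {f : Fin n → Euc n → ℝ} (hf₀ : MemLFin Ω f₀)
    (hf : ∀ i, MemLFin Ω (f i)) :
    divForm Ω (fun x => -f₀ x) (fun i x => -f i x) = -divForm Ω f₀ f := by
  simp only [divForm, ofFun_neg hf₀, fun i => ofFun_neg (hf i), LineDeriv.lineDerivOp_neg,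
    Finset.sum_neg_distrib, neg_add]

theorem distDeriv_zero (v : Euc n) : ∂_{v} (0 : 𝓓'(Ω, ℝ)) = 0 :=
  map_zero (Distribution.lineDerivCLM v)

theorem divForm_single (a : Fin n) (f₀ f : Euc n → ℝ) :
    divForm Ω f₀ (fun i x => if i = a then f x else 0)
      = ofFun Ω f₀ + ∂_{unitVec a} (ofFun Ω f) := by
  rw [divForm, Finset.sum_eq_single a (fun i _ hi => by
    simp only [hi, if_false, ofFun_zero, distDeriv_zero]) (by simp)]
  simp

/-- `T = f₀ + ∑ᵢ ∂ᵢ fᵢ` with coefficients in `L^{∞⁻}_loc`. -/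
def HasDivForm (T : 𝓓'(Ω, ℝ)) : Prop :=
  ∃ (f₀ : Euc n → ℝ) (f : Fin n → Euc n → ℝ), MemLFin Ω f₀ ∧ (∀ i, MemLFin Ω (f i)) ∧
    T = divForm Ω f₀ f

theorem hasDivForm_ofFun {f : Euc n → ℝ} (hf : MemLFin Ω f) : HasDivForm (ofFun Ω f) :=
  ⟨f, fun _ _ => 0, hf, fun _ => memLFin_const 0, by simp [divForm, ofFun_zero]⟩

theorem hasDivForm_distDeriv {f : Euc n → ℝ} (hf : MemLFin Ω f) (a : Fin n) :
    HasDivForm (∂_{unitVec a} (ofFun Ω f)) :=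
  ⟨fun _ => 0, fun i x => if i = a then f x else 0, memLFin_const 0, fun _ => hf.ite _, by
    rw [divForm_single, ofFun_zero, zero_add]⟩

theorem HasDivForm.add {S T : 𝓓'(Ω, ℝ)} (hS : HasDivForm S) (hT : HasDivForm T) :
    HasDivForm (S + T) := by
  obtain ⟨f₀, f, hf₀, hf, rfl⟩ := hS
  obtain ⟨g₀, g, hg₀, hg, rfl⟩ := hT
  exact ⟨_, _, hf₀.add hg₀, fun i => (hf i).add (hg i), (divForm_add hf₀ hf hg₀ hg).symm⟩

theorem HasDivForm.neg {S : 𝓓'(Ω, ℝ)} (hS : HasDivForm S) : HasDivForm (-S) := by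
  obtain ⟨f₀, f, hf₀, hf, rfl⟩ := hS
  exact ⟨_, _, hf₀.neg, fun i => (hf i).neg, (divForm_neg hf₀ hf).symm⟩

theorem HasDivForm.sub {S T : 𝓓'(Ω, ℝ)} (hS : HasDivForm S) (hT : HasDivForm T) :
    HasDivForm (S - T) := by
  rw [sub_eq_add_neg]; exact hS.add hT.neg

theorem HasDivForm.sum {ι : Type*} {s : Finset ι} {T : ι → 𝓓'(Ω, ℝ)}
    (hT : ∀ j ∈ s, HasDivForm (T j)) : HasDivForm (∑ j ∈ s, T j) := by
  refine Finset.sum_induction _ HasDivForm (fun _ _ => .add) ?_ hT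
  rw [← ofFun_zero]
  exact hasDivForm_ofFun (memLFin_const 0)

/-- By duality, the symmetry of second derivatives of test functions. -/
theorem distDeriv_comm (T : 𝓓'(Ω, ℝ)) (v w : Euc n) : ∂_{v} (∂_{w} T) = ∂_{w} (∂_{v} T) := by
  ext φ
  simp only [distDeriv_apply, neg_neg]
  congr 1
  ext x
  have h2 : ContDiff ℝ 2 φ := contDiff_infty.1 φ.contDiff 2
  have hd : ∀ a b : Euc n, fderiv ℝ (∂_{a} φ : 𝓓(Ω, ℝ)) x b = fderiv ℝ (fderiv ℝ φ) x b a := by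
    intro a b
    have : ((∂_{a} φ : 𝓓(Ω, ℝ)) : Euc n → ℝ) = fun x => fderiv ℝ φ x a := by
      ext y; exact testDeriv_apply φ a y
    rw [this, fderiv_clm_apply ((h2.fderiv_right (m := 1) (by norm_num)).differentiable (by simp) x)
      (by fun_prop)]
    simp
  rw [testDeriv_apply, testDeriv_apply, hd, hd]
  exact (h2.contDiffAt.isSymmSndFDerivAt (by simp)) _ _

variable [NeZero n]

/-- The working formula for products: it replaces the chosen value of `prod` by explicit
coefficients, and every algebraic rule below is read off from it. -/
theorem prod_divForm {u f₀ : Euc n → ℝ} {f : Fin n → Euc n → ℝ} (hu : MemWFin Ω u)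
    (hf₀ : MemLFin Ω f₀) (hf : ∀ i, MemLFin Ω (f i)) :
    prod u (divForm Ω f₀ f)
      = divForm Ω (fun x => u x * f₀ x - ∑ i, weakDeriv Ω i u x * f i x) fun i x => u x * f i x :=
  IsProduct.prod_eq ⟨hu.memW1Loc, f₀, f, hf₀.memLpLoc_expo, fun i => (hf i).memLpLoc_expo, rfl, rfl⟩

theorem HasDivForm.prod {u : Euc n → ℝ} {T : 𝓓'(Ω, ℝ)} (hu : MemWFin Ω u) (hT : HasDivForm T) :
    HasDivForm (prod u T) := by
  obtain ⟨f₀, f, hf₀, hf, rfl⟩ := hT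
  rw [prod_divForm hu hf₀ hf]
  exact ⟨_, _, (hu.memLFin.mul hf₀).sub (.sum fun i _ => (hu.weakDeriv i).mul (hf i)),
    fun i => hu.memLFin.mul (hf i), rfl⟩

theorem prod_add {u : Euc n → ℝ} {S T : 𝓓'(Ω, ℝ)} (hu : MemWFin Ω u) (hS : HasDivForm S)
    (hT : HasDivForm T) : prod u (S + T) = prod u S + prod u T := by
  obtain ⟨f₀, f, hf₀, hf, rfl⟩ := hS
  obtain ⟨g₀, g, hg₀, hg, rfl⟩ := hT
  rw [← divForm_add hf₀ hf hg₀ hg, prod_divForm hu hf₀ hf, prod_divForm hu hg₀ hg,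
    prod_divForm hu (hf₀.add hg₀) fun i => (hf i).add (hg i), ← divForm_add
      ((hu.memLFin.mul hf₀).sub (.sum fun i _ => (hu.weakDeriv i).mul (hf i)))
      (fun i => hu.memLFin.mul (hf i))
      ((hu.memLFin.mul hg₀).sub (.sum fun i _ => (hu.weakDeriv i).mul (hg i)))
      (fun i => hu.memLFin.mul (hg i))]
  simp only [mul_add, Finset.sum_add_distrib]
  congr 1; ext x; ring

theorem prod_neg {u : Euc n → ℝ} {S : 𝓓'(Ω, ℝ)} (hu : MemWFin Ω u) (hS : HasDivForm S) :
    prod u (-S) = -prod u S := by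
  obtain ⟨f₀, f, hf₀, hf, rfl⟩ := hS
  rw [← divForm_neg hf₀ hf, prod_divForm hu hf₀ hf,
    prod_divForm hu hf₀.neg fun i => (hf i).neg, ← divForm_neg
      ((hu.memLFin.mul hf₀).sub (.sum fun i _ => (hu.weakDeriv i).mul (hf i)))
      (fun i => hu.memLFin.mul (hf i))]
  simp only [mul_neg, Finset.sum_neg_distrib]
  congr 1; ext x; ring

theorem prod_sub {u : Euc n → ℝ} {S T : 𝓓'(Ω, ℝ)} (hu : MemWFin Ω u) (hS : HasDivForm S)
    (hT : HasDivForm T) : prod u (S - T) = prod u S - prod u T := by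
  rw [sub_eq_add_neg, prod_add hu hS hT.neg, prod_neg hu hT, sub_eq_add_neg]

theorem prod_ofFun {u f : Euc n → ℝ} (hu : MemWFin Ω u) (hf : MemLFin Ω f) :
    prod u (ofFun Ω f) = ofFun Ω fun x => u x * f x := by
  have := prod_divForm hu hf fun _ => memLFin_const 0
  simpa [divForm, ofFun_zero, distDeriv_zero] using this

theorem prod_distDeriv {u f : Euc n → ℝ} (hu : MemWFin Ω u) (hf : MemLFin Ω f) (a : Fin n) :
    prod u (∂_{unitVec a} (ofFun Ω f))
      = ∂_{unitVec a} (ofFun Ω fun x => u x * f x) - ofFun Ω fun x => weakDeriv Ω a u x * f x := by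
  have h := prod_divForm (f₀ := fun _ => 0) hu (memLFin_const 0) fun i => hf.ite (i = a)
  simp only [mul_ite, mul_zero, Finset.sum_ite_eq', Finset.mem_univ, if_true,
    zero_sub] at h
  rw [divForm_single, divForm_single, ofFun_zero, zero_add,
    ofFun_neg ((hu.weakDeriv a).mul hf)] at h
  rw [h]; abel

theorem prod_zero {u : Euc n → ℝ} (hu : MemWFin Ω u) : prod u (0 : 𝓓'(Ω, ℝ)) = 0 := by
  rw [← ofFun_zero, prod_ofFun hu (memLFin_const 0)]
  simp

theorem prod_sum {ι : Type*} {s : Finset ι} {u : Euc n → ℝ} {T : ι → 𝓓'(Ω, ℝ)} (hu : MemWFin Ω u)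
    (hT : ∀ j ∈ s, HasDivForm (T j)) : prod u (∑ j ∈ s, T j) = ∑ j ∈ s, prod u (T j) := by
  classical
  induction s using Finset.induction_on with
  | empty => simpa using prod_zero hu
  | insert a s ha ih =>
    rw [Finset.sum_insert ha, Finset.sum_insert ha, prod_add hu (hT a (Finset.mem_insert_self a s))
      (.sum fun i hi => hT i (Finset.mem_insert_of_mem hi)),
      ih fun i hi => hT i (Finset.mem_insert_of_mem hi)]

/-- The coefficients of ∂ᵢ multiply associatively on the nose; the terms of order zero agree almost
everywhere by the product rule for ∂ᵢ(u v). -/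
theorem prod_prod {u v : Euc n → ℝ} {T : 𝓓'(Ω, ℝ)} (hu : MemWFin Ω u) (hv : MemWFin Ω v)
    (hT : HasDivForm T) : prod u (prod v T) = prod (fun x => u x * v x) T := by
  obtain ⟨f₀, f, hf₀, hf, rfl⟩ := hT
  rw [prod_divForm hv hf₀ hf, prod_divForm hu
    ((hv.memLFin.mul hf₀).sub (.sum fun i _ => (hv.weakDeriv i).mul (hf i)))
    (fun i => hv.memLFin.mul (hf i)), prod_divForm (hu.mul hv) hf₀ hf]
  refine divForm_congr ?_ fun i => Filter.Eventually.of_forall fun x => (mul_assoc _ _ _).symm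
  filter_upwards [ae_all_iff.2 fun i => weakDeriv_mul hu hv i] with x hx
  simp only [hx, mul_sub, add_mul, Finset.sum_add_distrib, Finset.mul_sum]
  have : ∀ i, u x * (weakDeriv Ω i v x * f i x) = u x * weakDeriv Ω i v x * f i x := fun i => by ring
  have h' : ∀ i, weakDeriv Ω i u x * (v x * f i x) = weakDeriv Ω i u x * v x * f i x :=
    fun i => by ring
  simp only [this, h']
  ring

theorem prod_congr_left {u v : Euc n → ℝ} {T : 𝓓'(Ω, ℝ)} (hu : MemWFin Ω u)
    (h : u =ᵐ[volume.restrict Ω] v) (hT : HasDivForm T) : prod u T = prod v T := by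
  obtain ⟨f₀, f, hf₀, hf, rfl⟩ := hT
  rw [prod_divForm hu hf₀ hf, prod_divForm (hu.congr h) hf₀ hf]
  refine divForm_congr ?_ fun i => ?_
  · simp only [fun i => weakDeriv_congr i h]
    filter_upwards [h] with x hx
    rw [hx]
  · filter_upwards [h] with x hx
    rw [hx]

theorem prod_sum_left {ι : Type*} {s : Finset ι} {u : ι → Euc n → ℝ} {T : 𝓓'(Ω, ℝ)}
    (hu : ∀ j ∈ s, MemWFin Ω (u j)) (hT : HasDivForm T) :
    ∑ j ∈ s, prod (u j) T = prod (fun x => ∑ j ∈ s, u j x) T := by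
  obtain ⟨f₀, f, hf₀, hf, rfl⟩ := hT
  have m₀ : ∀ j ∈ s, MemLFin Ω fun x => u j x * f₀ x - ∑ i, weakDeriv Ω i (u j) x * f i x :=
    fun j hj => ((hu j hj).memLFin.mul hf₀).sub (.sum fun i _ => ((hu j hj).weakDeriv i).mul (hf i))
  rw [prod_divForm (.sum hu) hf₀ hf, Finset.sum_congr rfl fun j hj => prod_divForm (hu j hj) hf₀ hf]
  simp only [divForm]
  rw [Finset.sum_add_distrib, ← ofFun_sum m₀, Finset.sum_comm]
  congr 1
  · refine ofFun_congr ?_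
    filter_upwards [ae_all_iff.2 fun i => weakDeriv_sum i hu] with x hx
    simp only [hx, Finset.sum_sub_distrib, Finset.sum_mul]
    rw [Finset.sum_comm]
  · refine Finset.sum_congr rfl fun i _ => ?_
    rw [← LineDeriv.lineDerivOp_sum, ← ofFun_sum fun j hj => (hu j hj).memLFin.mul (hf i)]
    simp only [Finset.sum_mul]

/-- `∂ₐ (u ∂_b v) - ∂_b (u ∂ₐ v) = ∂ₐ u ∂_b v - ∂_b u ∂ₐ v`. -/
theorem distDeriv_mul_weakDeriv_sub {u v : Euc n → ℝ} (hu : MemWFin Ω u) (hv : MemWFin Ω v)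
    (a b : Fin n) :
    ∂_{unitVec a} (ofFun Ω fun x => u x * weakDeriv Ω b v x)
      - ∂_{unitVec b} (ofFun Ω fun x => u x * weakDeriv Ω a v x)
    = ofFun Ω fun x => weakDeriv Ω a u x * weakDeriv Ω b v x
      - weakDeriv Ω b u x * weakDeriv Ω a v x := by
  have h1 := prod_distDeriv hu (hv.weakDeriv b) a
  have h2 := prod_distDeriv hu (hv.weakDeriv a) b
  -- Both products are u times the same second derivative of v, so the two Leibniz expansions can be
  -- equated.
  rw [← hv.distDeriv, distDeriv_comm, hv.distDeriv, h2] at h1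
  rw [ofFun_sub ((hu.weakDeriv a).mul (hv.weakDeriv b)) ((hu.weakDeriv b).mul (hv.weakDeriv a))]
  rw [sub_eq_sub_iff_add_eq_add] at h1 ⊢
  rw [← h1, add_comm]

end DistributionProducts

end LowReg

/-! ### Locally Lipschitz functions are in W^{1,∞⁻}_loc -/

namespace LowReg

section Lipschitz

variable {n : ℕ} {Ω : Opens (Euc n)}

/-- Reduces local statements to globally Lipschitz functions, for which bounds on line derivatives
and integration by parts apply. Agreement on a neighbourhood of K, not just on K, is what makes the
derivatives agree on K. -/
theorem _root_.LocallyLipschitzOn.exists_lipschitzWith_extension {f : Euc n → ℝ}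
    (hf : LocallyLipschitzOn Ω f) {K : Set (Euc n)} (hK : IsCompact K) (hKΩ : K ⊆ Ω) :
    ∃ C, ∃ F : Euc n → ℝ, LipschitzWith C F ∧ ∃ U : Set (Euc n), IsOpen U ∧ K ⊆ U ∧ EqOn f F U := by
  obtain ⟨K', hK', h1, h2⟩ := exists_compact_between hK Ω.isOpen hKΩ
  obtain ⟨C, hC⟩ := (hf.mono h2).exists_lipschitzOnWith_of_compact hK'
  obtain ⟨F, hF, hFe⟩ := hC.extend_real
  exact ⟨C, F, hF, interior K', isOpen_interior, h1, hFe.mono interior_subset⟩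

theorem lineDeriv_eq_of_eqOn {f F : Euc n → ℝ} {U : Set (Euc n)} (hU : IsOpen U) (h : EqOn f F U)
    {x : Euc n} (hx : x ∈ U) (v : Euc n) : lineDeriv ℝ f x v = lineDeriv ℝ F x v :=
  Filter.EventuallyEq.lineDeriv_eq (h.eventuallyEq_of_mem (hU.mem_nhds hx))

theorem _root_.LocallyLipschitzOn.memLFin_lineDeriv {f : Euc n → ℝ} (hf : LocallyLipschitzOn Ω f)
    (v : Euc n) : MemLFin Ω fun x => lineDeriv ℝ f x v := by
  intro p _ _ K hK hKΩ
  obtain ⟨C, F, hF, U, hU, hKU, hFU⟩ := hf.exists_lipschitzWith_extension hK hKΩ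
  have : IsFiniteMeasure (volume.restrict K : Measure (Euc n)) :=
    isFiniteMeasure_restrict.2 hK.measure_lt_top.ne
  have h1 : MemLp (fun x => lineDeriv ℝ F x v) p (volume.restrict K) :=
    ((hF.memLp_lineDeriv v).restrict K).mono_exponent le_top
  refine (memLp_congr_ae ?_).1 h1
  rw [Filter.EventuallyEq, ae_restrict_iff' hK.measurableSet]
  exact Filter.Eventually.of_forall fun x hx => (lineDeriv_eq_of_eqOn hU hFU (hKU hx) v).symm

theorem _root_.LocallyLipschitzOn.isWeakDeriv_lineDeriv {f : Euc n → ℝ}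
    (hf : LocallyLipschitzOn Ω f) (i : Fin n) :
    IsWeakDeriv Ω i f fun x => lineDeriv ℝ f x (unitVec i) := by
  intro φ h1 h2 h3
  obtain ⟨C, F, hF, U, hU, hKU, hFU⟩ := hf.exists_lipschitzWith_extension h2 h3
  obtain ⟨D, hD⟩ := (contDiff_infty.1 h1 1).lipschitzWith_of_hasCompactSupport h2 (by simp)
  -- Integration by parts for the extension F; f may then be replaced by F, since all integrands
  -- vanish off the support of φ.
  have key := hF.integral_lineDeriv_mul_eq (μ := (volume : Measure (Euc n))) hD h2 (unitVec i)
  have e1 : ∀ x, f x * fderiv ℝ φ x (unitVec i) = -(lineDeriv ℝ φ x (-unitVec i) * F x) := by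
    intro x
    rw [((contDiff_infty.1 h1 1).differentiable (by simp) x).lineDeriv_eq_fderiv, map_neg]
    by_cases hx : x ∈ tsupport φ
    · rw [hFU (hKU hx)]; ring
    · have : fderiv ℝ φ x (unitVec i) = 0 := image_eq_zero_of_notMem_tsupport
        (f := fun x => fderiv ℝ φ x (unitVec i))
        fun h => hx (tsupport_fderiv_apply_subset' φ _ h)
      rw [this]; ring
  have e2 : ∀ x, lineDeriv ℝ f x (unitVec i) * φ x = lineDeriv ℝ F x (unitVec i) * φ x := by
    intro x
    by_cases hx : x ∈ tsupport φ
    · rw [lineDeriv_eq_of_eqOn hU hFU (hKU hx)]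
    · rw [image_eq_zero_of_notMem_tsupport hx, mul_zero, mul_zero]
  simp only [e1, e2, integral_neg]
  rw [key]

theorem _root_.LocallyLipschitzOn.memWFin {f : Euc n → ℝ} (hf : LocallyLipschitzOn Ω f) :
    MemWFin Ω f :=
  .of_isWeakDeriv (ContinuousOn.memLFin hf.continuousOn)
    (fun _ => hf.memLFin_lineDeriv _) fun i => hf.isWeakDeriv_lineDeriv i

theorem _root_.LocallyLipschitzOn.pi {α ι : Type*} [PseudoMetricSpace α] [Fintype ι]
    {β : ι → Type*} [∀ i, PseudoMetricSpace (β i)] {s : Set α} {f : ∀ i, α → β i}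
    (hf : ∀ i, LocallyLipschitzOn s (f i)) : LocallyLipschitzOn s fun x i => f i x := by
  intro x hx
  choose K t ht hK using fun i => hf i hx
  refine ⟨∑ i, K i, ⋂ i, t i, Filter.iInter_mem.2 ht, LipschitzOnWith.of_dist_le_mul fun a ha b hb => ?_⟩
  refine (dist_pi_le_iff (by positivity)).2 fun i => ?_
  refine ((hK i).dist_le_mul a (mem_iInter.1 ha i) b (mem_iInter.1 hb i)).trans ?_
  gcongr
  exact Finset.single_le_sum (f := K) (fun _ _ => by positivity) (Finset.mem_univ i)

theorem _root_.LocallyLipschitzOn.contDiffAt_comp {α E F : Type*} [PseudoMetricSpace α]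
    [NormedAddCommGroup E] [NormedSpace ℝ E] [NormedAddCommGroup F] [NormedSpace ℝ F]
    {s : Set α} {f : α → E} {Φ : E → F}
    (hf : LocallyLipschitzOn s f) (hΦ : ∀ x ∈ s, ContDiffAt ℝ 1 Φ (f x)) :
    LocallyLipschitzOn s fun x => Φ (f x) := by
  intro x hx
  obtain ⟨K, t, ht, hK⟩ := hf hx
  obtain ⟨C, u, hu, hC⟩ := (hΦ x hx).exists_lipschitzOnWith
  exact ⟨C * K, t ∩ f ⁻¹' u, Filter.inter_mem ht (hf.continuousOn x hx hu),
    hC.comp (hK.mono inter_subset_left) fun y hy => hy.2⟩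

theorem contDiff_det_of {E : Type*} [NormedAddCommGroup E] [NormedSpace ℝ E] {k : WithTop ℕ∞}
    {m : Fin n → Fin n → E → ℝ} (hm : ∀ i j, ContDiff ℝ k (m i j)) :
    ContDiff ℝ k fun x => (Matrix.of fun i j => m i j x).det := by
  simp only [Matrix.det_apply, Matrix.of_apply]
  exact ContDiff.sum fun σ _ => (contDiff_prod fun i _ => hm _ _).const_smul _

/-- Cramer's rule: an entry of the inverse is a polynomial in the entries divided by the
determinant. -/
theorem contDiffAt_inv_apply {k : WithTop ℕ∞} {m : Fin n → Fin n → ℝ} (hm : (Matrix.of m).det ≠ 0)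
    (i j : Fin n) :
    ContDiffAt ℝ k (fun m : Fin n → Fin n → ℝ => (Matrix.of m)⁻¹ i j) m := by
  have h1 : ContDiff ℝ k fun m : Fin n → Fin n → ℝ => (Matrix.of m).det :=
    contDiff_det_of fun i j => contDiff_apply_apply ℝ ℝ i j
  have h2 : ContDiff ℝ k fun m : Fin n → Fin n → ℝ => (Matrix.of m).adjugate i j := by
    simp only [Matrix.adjugate_apply]
    -- An adjugate entry is the determinant of the matrix with one row replaced by a constant unit
    -- vector, so its entries are constants or coordinates.
    refine contDiff_det_of (m := fun a b m => (Matrix.of m).updateRow j (Pi.single i 1) a b)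
      fun a b => ?_
    by_cases h : a = j
    · simp only [h, Matrix.updateRow_self]; exact contDiff_const
    · simp only [Matrix.updateRow_ne h]; exact contDiff_apply_apply ℝ ℝ a b
  have h3 := (h1.contDiffAt (x := m)).inv hm
  refine (h3.mul h2.contDiffAt).congr_of_eventuallyEq (Filter.Eventually.of_forall fun m => ?_)
  simp [Matrix.inv_def, Ring.inverse_eq_inv']

end Lipschitz

/-! ### The inverse metric, Christoffel symbols and metric compatibility -/

section MetricCoefficients

variable {n : ℕ} {Ω : Opens (Euc n)} {G : Fin n → Fin n → Euc n → ℝ}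

/-- `G` is the coefficient matrix of a locally Lipschitz, nondegenerate symmetric bilinear form. -/
structure IsLipMetric (Ω : Opens (Euc n)) (G : Fin n → Fin n → Euc n → ℝ) : Prop where
  lip : ∀ i j, LocallyLipschitzOn Ω (G i j)
  symm : ∀ y ∈ Ω, ∀ i j, G i j y = G j i y
  det_ne : ∀ y ∈ Ω, (Matrix.of fun a b => G a b y).det ≠ 0

namespace IsLipMetric

theorem memWFin (hG : IsLipMetric Ω G) (i j : Fin n) : MemWFin Ω (G i j) := (hG.lip i j).memWFin

/-- Inversion is smooth near invertible matrices, so the inverse metric is again locally Lipschitz.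
-/
theorem memWFin_ginv (hG : IsLipMetric Ω G) (i j : Fin n) : MemWFin Ω (ginv G i j) :=
  LocallyLipschitzOn.memWFin <| LocallyLipschitzOn.contDiffAt_comp
    (f := fun y a b => G a b y) (Φ := fun m => (Matrix.of m)⁻¹ i j)
    (.pi fun a => .pi fun b => hG.lip a b) fun y hy => contDiffAt_inv_apply (hG.det_ne y hy) i j

theorem sum_mul_ginv (hG : IsLipMetric Ω G) {y : Euc n} (hy : y ∈ Ω) (i j : Fin n) :
    ∑ k, G i k y * ginv G k j y = if i = j then 1 else 0 := by
  have := Matrix.mul_nonsing_inv (Matrix.of fun a b => G a b y)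
    (isUnit_iff_ne_zero.2 (hG.det_ne y hy))
  have := congrFun (congrFun this i) j
  simpa [Matrix.mul_apply, Matrix.one_apply, ginv] using this

theorem sum_ginv_mul (hG : IsLipMetric Ω G) {y : Euc n} (hy : y ∈ Ω) (i j : Fin n) :
    ∑ k, ginv G i k y * G k j y = if i = j then 1 else 0 := by
  have := Matrix.nonsing_inv_mul (Matrix.of fun a b => G a b y)
    (isUnit_iff_ne_zero.2 (hG.det_ne y hy))
  have := congrFun (congrFun this i) j
  simpa [Matrix.mul_apply, Matrix.one_apply, ginv] using this

theorem ginv_symm (hG : IsLipMetric Ω G) {y : Euc n} (hy : y ∈ Ω) (i j : Fin n) :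
    ginv G i j y = ginv G j i y := by
  have h : (Matrix.of fun a b => G a b y).transpose = Matrix.of fun a b => G a b y := by
    ext a b; exact hG.symm y hy b a
  have := congrFun (congrFun (Matrix.transpose_nonsing_inv (Matrix.of fun a b => G a b y)) j) i
  rw [h] at this
  exact this

theorem weakDeriv_symm (hG : IsLipMetric Ω G) (k i j : Fin n) :
    weakDeriv Ω k (G i j) = weakDeriv Ω k (G j i) :=
  weakDeriv_congr k <| (ae_restrict_iff' Ω.isOpen.measurableSet).2 <|
    Filter.Eventually.of_forall fun y hy => hG.symm y hy i j

theorem memLFin_christoffel (hG : IsLipMetric Ω G) (k i j : Fin n) :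
    MemLFin Ω (christoffel Ω G k i j) :=
  (memLFin_const _).mul <| .sum fun l _ => (hG.memWFin_ginv k l).memLFin.mul <|
    (((hG.memWFin j l).weakDeriv i).add ((hG.memWFin i l).weakDeriv j)).sub
      ((hG.memWFin i j).weakDeriv l)

theorem christoffel_symm (hG : IsLipMetric Ω G) (k i j : Fin n) :
    christoffel Ω G k i j = christoffel Ω G k j i := by
  ext y
  simp only [christoffel, hG.weakDeriv_symm _ i j]
  congr 1
  exact Finset.sum_congr rfl fun l _ => by ring

/-- Lowering the upper index cancels g⁻¹ and leaves the Christoffel symbols of the first kind. These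
equations characterize Γ and are all that is used of its formula in the change of coordinates. -/
theorem sum_mul_christoffel (hG : IsLipMetric Ω G) {y : Euc n} (hy : y ∈ Ω) (l i j : Fin n) :
    ∑ k, G l k y * christoffel Ω G k i j y
      = (1 / 2) * (weakDeriv Ω i (G j l) y + weakDeriv Ω j (G i l) y - weakDeriv Ω l (G i j) y) := by
  have h : ∀ k, G l k y * christoffel Ω G k i j y = ∑ m, (1 / 2) * (G l k y * ginv G k m y) *
      (weakDeriv Ω i (G j m) y + weakDeriv Ω j (G i m) y - weakDeriv Ω m (G i j) y) := fun k => by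
    simp only [christoffel, Finset.mul_sum]
    exact Finset.sum_congr rfl fun m _ => by ring
  simp only [h]
  rw [Finset.sum_comm]
  simp only [← Finset.sum_mul, ← Finset.mul_sum, hG.sum_mul_ginv hy]
  simp

/-- The Christoffel symbols define a metric connection. -/
theorem weakDeriv_metric (hG : IsLipMetric Ω G) {y : Euc n} (hy : y ∈ Ω) (i j k : Fin n) :
    weakDeriv Ω i (G j k) y = ∑ l, (G j l y * christoffel Ω G l i k y
      + G k l y * christoffel Ω G l i j y) := by
  rw [Finset.sum_add_distrib, hG.sum_mul_christoffel hy, hG.sum_mul_christoffel hy,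
    hG.weakDeriv_symm i k j, hG.weakDeriv_symm k i j]
  ring

/-- Differentiating g g⁻¹ = 1 gives ∂ᵢ g⁻¹ = -g⁻¹ (∂ᵢ g) g⁻¹; metric compatibility then replaces ∂ᵢ
g by Christoffel symbols. In other words, g⁻¹ is parallel. -/
theorem weakDeriv_ginv (hG : IsLipMetric Ω G) (i : Fin n) :
    ∀ᵐ y ∂volume.restrict Ω, ∀ j k, weakDeriv Ω i (ginv G j k) y
      = -∑ l, (christoffel Ω G j i l y * ginv G l k y + christoffel Ω G k i l y * ginv G l j y) := by
  have h1 : ∀ᵐ y ∂volume.restrict Ω, ∀ p k, ∑ q, (weakDeriv Ω i (G p q) y * ginv G q k y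
      + G p q y * weakDeriv Ω i (ginv G q k) y) = 0 := by
    refine ae_all_iff.2 fun p => ae_all_iff.2 fun k => ?_
    have e : (fun y => ∑ q, G p q y * ginv G q k y) =ᵐ[volume.restrict Ω]
        fun _ => if p = k then 1 else 0 :=
      (ae_restrict_iff' Ω.isOpen.measurableSet).2 <|
        Filter.Eventually.of_forall fun y hy => hG.sum_mul_ginv hy p k
    filter_upwards [weakDeriv_const (Ω := Ω) (if p = k then 1 else 0) i,
      weakDeriv_sum (s := Finset.univ) i fun q _ => (hG.memWFin p q).mul (hG.memWFin_ginv q k),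
      ae_all_iff.2 fun q => weakDeriv_mul (hG.memWFin p q) (hG.memWFin_ginv q k) i] with y h1 h2 h3
    rw [← weakDeriv_congr i e, h2] at h1
    simpa only [h3] using h1
  filter_upwards [h1, ae_restrict_mem Ω.isOpen.measurableSet] with y h1 hy j k
  have h2 : ∑ p, ginv G j p y * ∑ q, (weakDeriv Ω i (G p q) y * ginv G q k y
      + G p q y * weakDeriv Ω i (ginv G q k) y) = 0 := by simp [h1]
  have h3 : ∑ p, ginv G j p y * ∑ q, G p q y * weakDeriv Ω i (ginv G q k) y
      = weakDeriv Ω i (ginv G j k) y := by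
    simp only [Finset.mul_sum, ← mul_assoc]
    rw [Finset.sum_comm]
    simp only [← Finset.sum_mul, hG.sum_ginv_mul hy]
    simp
  have h4 : ∑ p, ginv G j p y * ∑ q, weakDeriv Ω i (G p q) y * ginv G q k y
      = ∑ l, (christoffel Ω G j i l y * ginv G l k y + christoffel Ω G k i l y * ginv G l j y) := by
    have e1 : ∑ p, ∑ q, ∑ l, ginv G j p y * (G p l y * christoffel Ω G l i q y) * ginv G q k y
        = ∑ q, christoffel Ω G j i q y * ginv G q k y := by
      rw [Finset.sum_comm]
      refine Finset.sum_congr rfl fun q _ => ?_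
      rw [Finset.sum_comm]
      have : ∀ l, ∑ p, ginv G j p y * (G p l y * christoffel Ω G l i q y) * ginv G q k y
          = (∑ p, ginv G j p y * G p l y) * (christoffel Ω G l i q y * ginv G q k y) := fun l => by
        rw [Finset.sum_mul]; exact Finset.sum_congr rfl fun p _ => by ring
      simp only [this, hG.sum_ginv_mul hy]
      simp
    have e2 : ∑ p, ∑ q, ∑ l, ginv G j p y * (G q l y * christoffel Ω G l i p y) * ginv G q k y
        = ∑ p, christoffel Ω G k i p y * ginv G p j y := by
      refine Finset.sum_congr rfl fun p _ => ?_
      rw [Finset.sum_comm]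
      have : ∀ l, ∑ q, ginv G j p y * (G q l y * christoffel Ω G l i p y) * ginv G q k y
          = (∑ q, ginv G k q y * G q l y) * (christoffel Ω G l i p y * ginv G p j y) := fun l => by
        rw [Finset.sum_mul]
        exact Finset.sum_congr rfl fun q _ => by
          rw [hG.ginv_symm hy q k, hG.ginv_symm hy p j]; ring
      simp only [this, hG.sum_ginv_mul hy]
      simp
    rw [Finset.sum_add_distrib, ← e1, ← e2]
    simp only [← Finset.sum_add_distrib, hG.weakDeriv_metric hy, Finset.mul_sum, Finset.sum_mul]
    refine Finset.sum_congr rfl fun p _ => Finset.sum_congr rfl fun q _ =>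
      Finset.sum_congr rfl fun l _ => by ring
  simp only [Finset.sum_add_distrib (s := Finset.univ) (f := fun q => weakDeriv Ω i (G _ q) y * _),
    mul_add] at h2
  rw [Finset.sum_add_distrib, h3, h4] at h2
  linarith

end IsLipMetric

end MetricCoefficients

end LowReg

/-! ### The divergence of vector fields with L^{∞⁻}_loc components -/

namespace LowReg

section Divergence

variable {n : ℕ} {Ω : Opens (Euc n)} {G : Fin n → Fin n → Euc n → ℝ}

/-- The contracted Christoffel symbols `∑ᵢ Γ^i_{ia}`. -/
noncomputable def christoffelTrace (Ω : Opens (Euc n)) (G : Fin n → Fin n → Euc n → ℝ) (a : Fin n) :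
    Euc n → ℝ :=
  fun y => ∑ i, christoffel Ω G i i a y

/-- The divergence `∑ₐ (∂ₐ F^a + ∑ᵢ Γ^i_{ia} F^a)` of a vector field, as a distribution. -/
noncomputable def divVec (G : Fin n → Fin n → Euc n → ℝ) (F : Fin n → Euc n → ℝ) : 𝓓'(Ω, ℝ) :=
  divForm Ω (fun y => ∑ a, christoffelTrace Ω G a y * F a y) F

theorem IsLipMetric.memLFin_christoffelTrace (hG : IsLipMetric Ω G) (a : Fin n) :
    MemLFin Ω (christoffelTrace Ω G a) :=
  .sum fun i _ => hG.memLFin_christoffel i i a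

theorem IsLipMetric.memLFin_trace_mul (hG : IsLipMetric Ω G) {F : Fin n → Euc n → ℝ}
    (hF : ∀ a, MemLFin Ω (F a)) : MemLFin Ω fun y => ∑ a, christoffelTrace Ω G a y * F a y :=
  .sum fun a _ => (hG.memLFin_christoffelTrace a).mul (hF a)

theorem IsLipMetric.hasDivForm_divVec (hG : IsLipMetric Ω G) {F : Fin n → Euc n → ℝ}
    (hF : ∀ a, MemLFin Ω (F a)) : HasDivForm (divVec (Ω := Ω) G F) :=
  ⟨_, _, hG.memLFin_trace_mul hF, hF, rfl⟩

theorem divVec_congr {F F' : Fin n → Euc n → ℝ} (h : ∀ a, F a =ᵐ[volume.restrict Ω] F' a) :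
    divVec (Ω := Ω) G F = divVec G F' := by
  refine divForm_congr ?_ h
  filter_upwards [ae_all_iff.2 h] with y hy
  simp only [hy]

theorem divVec_add (hG : IsLipMetric Ω G) {F F' : Fin n → Euc n → ℝ}
    (hF : ∀ a, MemLFin Ω (F a)) (hF' : ∀ a, MemLFin Ω (F' a)) :
    divVec (Ω := Ω) G (fun a y => F a y + F' a y) = divVec G F + divVec G F' := by
  rw [divVec, divVec, divVec, ← divForm_add (hG.memLFin_trace_mul hF) hF
    (hG.memLFin_trace_mul hF') hF']
  simp only [mul_add, Finset.sum_add_distrib]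

theorem divVec_neg (hG : IsLipMetric Ω G) {F : Fin n → Euc n → ℝ} (hF : ∀ a, MemLFin Ω (F a)) :
    divVec (Ω := Ω) G (fun a y => -F a y) = -divVec G F := by
  rw [divVec, divVec, ← divForm_neg (hG.memLFin_trace_mul hF) hF]
  simp only [mul_neg, Finset.sum_neg_distrib]

theorem divVec_sub (hG : IsLipMetric Ω G) {F F' : Fin n → Euc n → ℝ}
    (hF : ∀ a, MemLFin Ω (F a)) (hF' : ∀ a, MemLFin Ω (F' a)) :
    divVec (Ω := Ω) G (fun a y => F a y - F' a y) = divVec G F - divVec G F' := by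
  simp only [sub_eq_add_neg]
  rw [divVec_add hG hF fun a => (hF' a).neg, divVec_neg hG hF']

theorem divVec_zero : divVec (Ω := Ω) G (fun _ _ => 0) = 0 := by
  simp [divVec, divForm, ofFun_zero]

theorem divVec_sum (hG : IsLipMetric Ω G) {ι : Type*} {s : Finset ι} {F : ι → Fin n → Euc n → ℝ}
    (hF : ∀ j ∈ s, ∀ a, MemLFin Ω (F j a)) :
    divVec (Ω := Ω) G (fun a y => ∑ j ∈ s, F j a y) = ∑ j ∈ s, divVec G (F j) := by
  classical
  induction s using Finset.induction_on with
  | empty => simpa using divVec_zero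
  | insert b s hb ih =>
    simp only [Finset.sum_insert hb]
    rw [divVec_add hG (hF b (Finset.mem_insert_self b s))
      fun a => .sum fun i hi => hF i (Finset.mem_insert_of_mem hi) a,
      ih fun i hi => hF i (Finset.mem_insert_of_mem hi)]

/-- Trades a coordinate divergence, which has no invariant meaning, for the invariant one and a
function. -/
theorem sum_distDeriv_eq (F : Fin n → Euc n → ℝ) :
    ∑ a, ∂_{unitVec a} (ofFun Ω (F a))
      = divVec G F - ofFun Ω fun y => ∑ a, christoffelTrace Ω G a y * F a y := by
  rw [divVec, divForm]; abel

theorem divVec_of_memWFin (hG : IsLipMetric Ω G) {F : Fin n → Euc n → ℝ}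
    (hF : ∀ a, MemWFin Ω (F a)) :
    divVec (Ω := Ω) G F
      = ofFun Ω fun y => ∑ a, (weakDeriv Ω a (F a) y + christoffelTrace Ω G a y * F a y) := by
  simp only [Finset.sum_add_distrib]
  rw [divVec, divForm, ofFun_add (.sum fun a _ => (hF a).weakDeriv a)
    (hG.memLFin_trace_mul fun a => (hF a).memLFin), ofFun_sum fun a _ => (hF a).weakDeriv a,
    add_comm]
  simp only [fun a => (hF a).distDeriv a]

variable [NeZero n]

/-- The Leibniz rule u div F = div(u F) - du(F); the trace terms need no correction, being of order
zero in F. -/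
theorem prod_divVec (hG : IsLipMetric Ω G) {u : Euc n → ℝ} (hu : MemWFin Ω u)
    {F : Fin n → Euc n → ℝ} (hF : ∀ a, MemLFin Ω (F a)) :
    prod u (divVec (Ω := Ω) G F) = divVec G (fun a y => u y * F a y)
      - ofFun Ω fun y => ∑ a, weakDeriv Ω a u y * F a y := by
  have hD : MemLFin Ω fun y => ∑ a, weakDeriv Ω a u y * F a y :=
    .sum fun a _ => (hu.weakDeriv a).mul (hF a)
  have hT := hG.memLFin_trace_mul fun a => hu.memLFin.mul (hF a)
  rw [divVec, prod_divForm hu (hG.memLFin_trace_mul hF) hF, divVec, divForm, divForm]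
  have : (fun x => u x * ∑ a, christoffelTrace Ω G a x * F a x - ∑ i, weakDeriv Ω i u x * F i x)
      = fun x => (∑ a, christoffelTrace Ω G a x * (u x * F a x))
        - ∑ i, weakDeriv Ω i u x * F i x := by
    ext x; rw [Finset.mul_sum]
    congr 1
    exact Finset.sum_congr rfl fun a _ => by ring
  rw [this, ofFun_sub hT hD]
  abel

/-- `∑_{ab} g^{ab} (∇ₐ θ)_b = div (θ^♯)`. -/
theorem sum_prod_ginv_nabla (hG : IsLipMetric Ω G) {θ : Fin n → Euc n → ℝ}
    (hθ : ∀ a, MemLFin Ω (θ a)) :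
    ∑ a, ∑ b, prod (ginv G a b) (∂_{unitVec a} (ofFun Ω (θ b))
        - ofFun Ω (fun y => ∑ c, christoffel Ω G c a b y * θ c y))
      = divVec G fun a y => ∑ b, ginv G a b y * θ b y := by
  have hK : ∀ a b, MemLFin Ω fun y => ∑ c, christoffel Ω G c a b y * θ c y := fun a b =>
    .sum fun c _ => (hG.memLFin_christoffel c a b).mul (hθ c)
  have hg : ∀ a b, MemLFin Ω (ginv G a b) := fun a b => (hG.memWFin_ginv a b).memLFin
  have hF : ∀ a, MemLFin Ω fun y => ∑ b, ginv G a b y * θ b y := fun a =>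
    .sum fun b _ => (hg a b).mul (hθ b)
  have m1 : ∀ a b, MemLFin Ω fun y => weakDeriv Ω a (ginv G a b) y * θ b y := fun a b =>
    ((hG.memWFin_ginv a b).weakDeriv a).mul (hθ b)
  have m2 := fun a b => (hg a b).mul (hK a b)
  have e1 : ∀ a b, prod (ginv G a b) (∂_{unitVec a} (ofFun Ω (θ b))
        - ofFun Ω (fun y => ∑ c, christoffel Ω G c a b y * θ c y))
      = ∂_{unitVec a} (ofFun Ω fun y => ginv G a b y * θ b y)
        - ofFun Ω fun y => weakDeriv Ω a (ginv G a b) y * θ b y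
          + ginv G a b y * ∑ c, christoffel Ω G c a b y * θ c y := fun a b => by
    rw [prod_sub (hG.memWFin_ginv a b) (hasDivForm_distDeriv (hθ b) a) (hasDivForm_ofFun (hK a b)),
      prod_distDeriv (hG.memWFin_ginv a b) (hθ b), prod_ofFun (hG.memWFin_ginv a b) (hK a b),
      ofFun_add (m1 a b) (m2 a b)]
    abel
  simp only [e1, Finset.sum_sub_distrib]
  have e2 : ∀ a, ∑ b, ∂_{unitVec a} (ofFun Ω fun y => ginv G a b y * θ b y)
      = ∂_{unitVec a} (ofFun Ω fun y => ∑ b, ginv G a b y * θ b y) := fun a => by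
    rw [← LineDeriv.lineDerivOp_sum, ofFun_sum fun b _ => (hg a b).mul (hθ b)]
  simp only [e2]
  rw [sum_distDeriv_eq, sub_sub]
  simp only [← fun a => ofFun_sum (s := Finset.univ) fun b _ => (m1 a b).add (m2 a b)]
  rw [← ofFun_sum fun a _ => MemLFin.sum fun b _ => (m1 a b).add (m2 a b),
    ← ofFun_add (hG.memLFin_trace_mul hF) (.sum fun a _ => .sum fun b _ => (m1 a b).add (m2 a b))]
  -- What is left over is a function: a contraction of ∂g⁻¹ + Γ g⁻¹ + g⁻¹ Γ with θ, which vanishes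
  -- because g⁻¹ is parallel.
  rw [sub_eq_self, ← ofFun_zero]
  refine ofFun_congr ?_
  filter_upwards [ae_all_iff.2 fun i => hG.weakDeriv_ginv i,
    ae_restrict_mem Ω.isOpen.measurableSet] with y hy hyΩ
  simp only [hy, christoffelTrace, neg_mul, Finset.sum_add_distrib, add_mul, Finset.sum_neg_distrib,
    Finset.sum_mul, Finset.mul_sum]
  have s1 : ∑ a, ∑ b, ∑ l, christoffel Ω G a a l y * ginv G l b y * θ b y
      = ∑ a, ∑ b, ∑ i, christoffel Ω G i i a y * (ginv G a b y * θ b y) := by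
    rw [Finset.sum_comm]
    rw [Finset.sum_comm (s := Finset.univ (α := Fin n)) (t := Finset.univ) (f := fun a b =>
      ∑ i, christoffel Ω G i i a y * (ginv G a b y * θ b y))]
    refine Finset.sum_congr rfl fun b _ => ?_
    rw [Finset.sum_comm]
    exact Finset.sum_congr rfl fun a _ => Finset.sum_congr rfl fun i _ => by ring
  have s2 : ∑ a, ∑ b, ∑ l, christoffel Ω G b a l y * ginv G l a y * θ b y
      = ∑ a, ∑ b, ∑ c, ginv G a b y * (christoffel Ω G c a b y * θ c y) := by
    refine Finset.sum_congr rfl fun a _ => ?_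
    rw [Finset.sum_comm]
    exact Finset.sum_congr rfl fun b _ => Finset.sum_congr rfl fun c _ => by
      rw [hG.ginv_symm hyΩ b a]; ring
  have s3 : ∑ a, ∑ b, ∑ i, christoffel Ω G i i a y * (ginv G a b y * θ b y)
    = ∑ a, ∑ i, ∑ b, christoffel Ω G i i a y * (ginv G a b y * θ b y) :=
    Finset.sum_congr rfl fun a _ => Finset.sum_comm
  rw [s1, s2, s3]
  ring

end Divergence

end LowReg

/-! ### The Laplacian of |X|²/2 and the codifferential of X^♭ -/

namespace LowReg

section Bochner

variable {n : ℕ} {Ω : Opens (Euc n)} {G : Fin n → Fin n → Euc n → ℝ} {X : Fin n → Euc n → ℝ}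

/-- The divergence `tr ∇X` of a weakly differentiable vector field. -/
noncomputable def trNabla (Ω : Opens (Euc n)) (G : Fin n → Fin n → Euc n → ℝ)
    (X : Fin n → Euc n → ℝ) : Euc n → ℝ :=
  fun y => ∑ a, nablaVec Ω G X a a y

/-- The vector field `(½ d|X|²)^♯`, with components `∑ g^{ab} g_{cd} X^c (∇_b X)^d`. -/
noncomputable def gradHalfSq (Ω : Opens (Euc n)) (G : Fin n → Fin n → Euc n → ℝ)
    (X : Fin n → Euc n → ℝ) (a : Fin n) : Euc n → ℝ :=
  fun y => ∑ b, ginv G a b y * ∑ c, ∑ d, G c d y * X c y * nablaVec Ω G X b d y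

/-- The vector field `∇_X X - (div X) X`. -/
noncomputable def ricciFlux (Ω : Opens (Euc n)) (G : Fin n → Fin n → Euc n → ℝ)
    (X : Fin n → Euc n → ℝ) (a : Fin n) : Euc n → ℝ :=
  fun y => ∑ b, X b y * nablaVec Ω G X b a y - trNabla Ω G X y * X a y

/-- The function `(div X)² - tr (∇X ∘ ∇X)`. -/
noncomputable def ricciDensity (Ω : Opens (Euc n)) (G : Fin n → Fin n → Euc n → ℝ)
    (X : Fin n → Euc n → ℝ) : Euc n → ℝ :=
  fun y => trNabla Ω G X y * trNabla Ω G X y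
    - ∑ a, ∑ c, nablaVec Ω G X a c y * nablaVec Ω G X c a y

variable (hG : IsLipMetric Ω G) (hX : ∀ i, MemWFin Ω (X i))

include hG hX

theorem memLFin_nablaVec (a i : Fin n) : MemLFin Ω (nablaVec Ω G X a i) :=
  ((hX i).weakDeriv a).add (.sum fun b _ => (hG.memLFin_christoffel i a b).mul (hX b).memLFin)

theorem memLFin_trNabla : MemLFin Ω (trNabla Ω G X) :=
  .sum fun a _ => memLFin_nablaVec hG hX a a

theorem memLFin_gradHalfSq (a : Fin n) : MemLFin Ω (gradHalfSq Ω G X a) :=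
  .sum fun b _ => (hG.memWFin_ginv a b).memLFin.mul <| .sum fun c _ => .sum fun d _ =>
    ((hG.memWFin c d).memLFin.mul (hX c).memLFin).mul (memLFin_nablaVec hG hX b d)

theorem memLFin_ricciFlux (a : Fin n) : MemLFin Ω (ricciFlux Ω G X a) :=
  (MemLFin.sum fun b _ => (hX b).memLFin.mul (memLFin_nablaVec hG hX b a)).sub
    ((memLFin_trNabla hG hX).mul (hX a).memLFin)

theorem memLFin_ricciDensity : MemLFin Ω (ricciDensity Ω G X) :=
  ((memLFin_trNabla hG hX).mul (memLFin_trNabla hG hX)).sub <| .sum fun a _ => .sum fun c _ =>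
    (memLFin_nablaVec hG hX a c).mul (memLFin_nablaVec hG hX c a)

theorem memLFin_normSqNabla : MemLFin Ω (normSqNabla Ω G X) :=
  .sum fun a _ => .sum fun b _ => .sum fun i _ => .sum fun j _ =>
    (((hG.memWFin_ginv a b).memLFin.mul (hG.memWFin i j).memLFin).mul
      (memLFin_nablaVec hG hX a i)).mul (memLFin_nablaVec hG hX b j)

/-- The metric lowers the covariant derivative: `∂ₐ (X^♭)_b - Γ^c_{ab} (X^♭)_c = g_{bd} (∇ₐ X)^d`. -/
theorem weakDeriv_flat (a b : Fin n) :
    weakDeriv Ω a (flat G X b) =ᵐ[volume.restrict Ω] fun y =>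
      (∑ d, G b d y * nablaVec Ω G X a d y) + ∑ c, christoffel Ω G c a b y * flat G X c y := by
  filter_upwards [weakDeriv_sum (s := Finset.univ) a fun d _ => (hG.memWFin b d).mul (hX d),
    ae_all_iff.2 fun d => weakDeriv_mul (hG.memWFin b d) (hX d) a,
    ae_restrict_mem Ω.isOpen.measurableSet] with y h1 h2 hy
  have h1' : weakDeriv Ω a (flat G X b) y = _ := h1
  rw [h1']
  simp only [h2, hG.weakDeriv_metric hy, nablaVec, flat, mul_add, Finset.mul_sum, Finset.sum_mul,
    Finset.sum_add_distrib, add_mul]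
  have s1 : ∑ d, ∑ l, G b l y * christoffel Ω G l a d y * X d y
      = ∑ d, ∑ c, G b d y * (christoffel Ω G d a c y * X c y) := by
    rw [Finset.sum_comm]
    exact Finset.sum_congr rfl fun c _ => Finset.sum_congr rfl fun d _ => by ring
  have s2 : ∑ d, ∑ l, G d l y * christoffel Ω G l a b y * X d y
      = ∑ c, ∑ d, christoffel Ω G c a b y * (G c d y * X d y) := by
    rw [Finset.sum_comm]
    exact Finset.sum_congr rfl fun c _ => Finset.sum_congr rfl fun d _ => by
      rw [hG.symm y hy d c]; ring
  rw [s1, s2]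
  ring

theorem memWFin_flat (a : Fin n) : MemWFin Ω (flat G X a) :=
  .sum fun b _ => (hG.memWFin a b).mul (hX b)

/-- Written as ½ Xⁱ (X^♭)ᵢ, the function is differentiated by the product rule. The Christoffel
terms coming from X and from X^♭ cancel, and the two remaining halves are equal. -/
theorem weakDeriv_halfSq (b : Fin n) :
    weakDeriv Ω b (fun y => (∑ i, ∑ j, G i j y * X i y * X j y) / 2) =ᵐ[volume.restrict Ω]
      fun y => ∑ c, ∑ d, G c d y * X c y * nablaVec Ω G X b d y := by
  have e : (fun y => (∑ i, ∑ j, G i j y * X i y * X j y) / 2)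
      = fun y => (1 / 2) * ∑ i, X i y * flat G X i y := by
    ext y
    simp only [flat, Finset.mul_sum, Finset.sum_div]
    exact Finset.sum_congr rfl fun c _ => Finset.sum_congr rfl fun d _ => by ring
  rw [e]
  have hm : ∀ i ∈ Finset.univ, MemWFin Ω fun y => X i y * flat G X i y := fun i _ =>
    (hX i).mul (memWFin_flat hG hX i)
  filter_upwards [weakDeriv_const_mul (1 / 2) (.sum hm) b, weakDeriv_sum b hm,
    ae_all_iff.2 fun i => weakDeriv_mul (hX i) (memWFin_flat hG hX i) b,
    ae_all_iff.2 fun i => weakDeriv_flat hG hX b i,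
    ae_restrict_mem Ω.isOpen.measurableSet] with y h1 h2 h3 h4 hy
  rw [h1, h2]
  simp only [h3, h4]
  have s1 : ∑ i, weakDeriv Ω b (X i) y * flat G X i y
      = (∑ c, ∑ d, G c d y * X c y * nablaVec Ω G X b d y)
        - ∑ i, X i y * ∑ c, christoffel Ω G c b i y * flat G X c y := by
    rw [eq_sub_iff_add_eq]
    have : ∑ i, X i y * ∑ c, christoffel Ω G c b i y * flat G X c y
        = ∑ i, (∑ c, christoffel Ω G i b c y * X c y) * flat G X i y := by
      simp only [Finset.mul_sum, Finset.sum_mul]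
      rw [Finset.sum_comm]
      exact Finset.sum_congr rfl fun c _ => Finset.sum_congr rfl fun d _ => by ring
    rw [this, ← Finset.sum_add_distrib]
    simp only [← add_mul]
    rw [Finset.sum_comm]
    refine Finset.sum_congr rfl fun i _ => ?_
    rw [flat, Finset.mul_sum]
    exact Finset.sum_congr rfl fun c _ => by rw [hG.symm y hy i c, nablaVec]; ring
  have s2 : ∑ i, X i y * ∑ d, G i d y * nablaVec Ω G X b d y
      = ∑ c, ∑ d, G c d y * X c y * nablaVec Ω G X b d y := by
    simp only [Finset.mul_sum]
    exact Finset.sum_congr rfl fun c _ => Finset.sum_congr rfl fun d _ => by ring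
  simp only [mul_add, Finset.sum_add_distrib, s1, s2]
  ring

variable [NeZero n]

/-- `Δ (|X|² / 2) = div (½ d|X|²)^♯`. -/
theorem laplaceLocal_halfSq :
    laplaceLocal (Ω := Ω) G (fun y => (∑ i, ∑ j, G i j y * X i y * X j y) / 2)
      = divVec G (gradHalfSq Ω G X) := by
  have hm : ∀ b, MemLFin Ω (weakDeriv Ω b fun y => (∑ i, ∑ j, G i j y * X i y * X j y) / 2) :=
    fun b => (MemLFin.sum fun c _ => .sum fun d _ => ((hG.memWFin c d).memLFin.mul
      (hX c).memLFin).mul (memLFin_nablaVec hG hX b d)).congr (weakDeriv_halfSq hG hX b).symm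
  rw [laplaceLocal, codiffOne, neg_neg, sum_prod_ginv_nabla hG hm]
  refine divVec_congr fun a => ?_
  filter_upwards [ae_all_iff.2 fun b => weakDeriv_halfSq hG hX b] with y hy
  simp only [hy, gradHalfSq]

omit [NeZero n] in
theorem divVec_self : divVec (Ω := Ω) G X = ofFun Ω (trNabla Ω G X) := by
  rw [divVec_of_memWFin hG hX]
  congr 1
  ext y
  simp only [trNabla, nablaVec, christoffelTrace, Finset.sum_add_distrib, Finset.sum_mul]
  rw [Finset.sum_comm]

/-- Raising the index of X^♭ returns X, so the codifferential is minus the divergence of X; that is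
a function, since X is weakly differentiable. -/
theorem codiffOne_flat : codiffOne (Ω := Ω) G (flat G X) = -ofFun Ω (trNabla Ω G X) := by
  rw [codiffOne, sum_prod_ginv_nabla hG fun a => (memWFin_flat hG hX a).memLFin,
    ← divVec_self hG hX]
  congr 1
  refine divVec_congr fun a => ?_
  filter_upwards [ae_restrict_mem Ω.isOpen.measurableSet] with y hy
  simp only [flat, Finset.mul_sum, ← mul_assoc]
  rw [Finset.sum_comm]
  simp only [← Finset.sum_mul, hG.sum_ginv_mul hy]
  simp

end Bochner

end LowReg

/-! ### The Hodge Laplacian paired with X -/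

namespace LowReg

section HodgeRicci

variable {n : ℕ} [NeZero n] {Ω : Opens (Euc n)} {G : Fin n → Fin n → Euc n → ℝ}
  {X : Fin n → Euc n → ℝ}

/-- For fixed c the form η(·, c) is treated as a 1-form: its part of the covariant derivative gives
a divergence, and only the Christoffel term acting on the index c survives as a function. -/
theorem codiffTwo_eq (hG : IsLipMetric Ω G) {η : Fin n → Fin n → Euc n → ℝ}
    (hη : ∀ b c, MemLFin Ω (η b c)) (c : Fin n) :
    codiffTwo (Ω := Ω) G η c = ofFun Ω (fun y => ∑ a, ∑ b, ginv G a b y *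
        ∑ l, christoffel Ω G l a c y * η b l y)
      - divVec G fun a y => ∑ b, ginv G a b y * η b c y := by
  have k1 : ∀ a b, MemLFin Ω fun y => ∑ l, christoffel Ω G l a b y * η l c y := fun a b =>
    .sum fun l _ => (hG.memLFin_christoffel l a b).mul (hη l c)
  have k2 : ∀ a b, MemLFin Ω fun y => ∑ l, christoffel Ω G l a c y * η b l y := fun a b =>
    .sum fun l _ => (hG.memLFin_christoffel l a c).mul (hη b l)
  have k3 : ∀ a b, MemLFin Ω fun y => ginv G a b y * ∑ l, christoffel Ω G l a c y * η b l y :=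
    fun a b => (hG.memWFin_ginv a b).memLFin.mul (k2 a b)
  have e : ∀ a b, prod (ginv G a b) (∂_{unitVec a} (ofFun Ω (η b c)) - ofFun Ω (fun y => ∑ l,
      (christoffel Ω G l a b y * η l c y + christoffel Ω G l a c y * η b l y)))
      = prod (ginv G a b) (∂_{unitVec a} (ofFun Ω (η b c))
          - ofFun Ω (fun y => ∑ l, christoffel Ω G l a b y * η l c y))
        - ofFun Ω fun y => ginv G a b y * ∑ l, christoffel Ω G l a c y * η b l y := fun a b => by
    simp only [Finset.sum_add_distrib]
    rw [ofFun_add (k1 a b) (k2 a b), ← sub_sub, prod_sub (hG.memWFin_ginv a b)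
      ((hasDivForm_distDeriv (hη b c) a).sub (hasDivForm_ofFun (k1 a b)))
      (hasDivForm_ofFun (k2 a b)), prod_ofFun (hG.memWFin_ginv a b) (k2 a b)]
  rw [codiffTwo]
  simp only [e, Finset.sum_sub_distrib]
  rw [sum_prod_ginv_nabla hG (θ := fun b => η b c) fun b => hη b c,
    ofFun_sum fun a _ => MemLFin.sum fun b _ => k3 a b]
  simp only [fun a => ofFun_sum (s := Finset.univ) fun b _ => k3 a b]
  abel

variable (hG : IsLipMetric Ω G) (hX : ∀ i, MemWFin Ω (X i))

include hG hX

omit [NeZero n] in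
-- Antisymmetrizing the covariant derivative of X^♭ removes the Christoffel terms, since the
-- connection is torsion free.
theorem extDeriv_flat (b c : Fin n) :
    extDeriv Ω (flat G X) b c =ᵐ[volume.restrict Ω] fun y =>
      (∑ d, G c d y * nablaVec Ω G X b d y) - ∑ d, G b d y * nablaVec Ω G X c d y := by
  filter_upwards [weakDeriv_flat hG hX b c, weakDeriv_flat hG hX c b] with y h1 h2
  rw [extDeriv, h1, h2]
  simp only [fun l => hG.christoffel_symm l c b]
  ring

omit [NeZero n] in
theorem memLFin_extDeriv_flat (b c : Fin n) : MemLFin Ω (extDeriv Ω (flat G X) b c) :=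
  ((memWFin_flat hG hX c).weakDeriv b).sub ((memWFin_flat hG hX b).weakDeriv c)

omit [NeZero n] in
theorem sum_ginv_extDeriv_flat (a c : Fin n) :
    (fun y => ∑ b, ginv G a b y * extDeriv Ω (flat G X) b c y) =ᵐ[volume.restrict Ω] fun y =>
      (∑ b, ginv G a b y * ∑ d, G c d y * nablaVec Ω G X b d y) - nablaVec Ω G X c a y := by
  filter_upwards [ae_all_iff.2 fun b => extDeriv_flat hG hX b c,
    ae_restrict_mem Ω.isOpen.measurableSet] with y h hy
  simp only [h, mul_sub, Finset.sum_sub_distrib]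
  congr 1
  simp only [Finset.mul_sum, ← mul_assoc]
  rw [Finset.sum_comm]
  simp only [← Finset.sum_mul, hG.sum_ginv_mul hy]
  simp

theorem hodgeForm_flat (c : Fin n) :
    hodgeForm (Ω := Ω) G (flat G X) c
      = ofFun Ω (fun y => ∑ a, ∑ b, ginv G a b y *
          ∑ l, christoffel Ω G l a c y * extDeriv Ω (flat G X) b l y)
        - divVec G (fun a y => ∑ b, ginv G a b y * extDeriv Ω (flat G X) b c y)
        - ∂_{unitVec c} (ofFun Ω (trNabla Ω G X)) := by
  rw [hodgeForm, codiffTwo_eq hG (memLFin_extDeriv_flat hG hX), codiffOne_flat hG hX,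
    LineDeriv.lineDerivOp_neg, ← sub_eq_add_neg]

theorem hasDivForm_hodgeForm (c : Fin n) : HasDivForm (hodgeForm (Ω := Ω) G (flat G X) c) := by
  rw [hodgeForm_flat hG hX]
  refine ((hasDivForm_ofFun ?_).sub (hG.hasDivForm_divVec fun a => ?_)).sub
    (hasDivForm_distDeriv (memLFin_trNabla hG hX) c)
  · exact .sum fun a _ => .sum fun b _ => (hG.memWFin_ginv a b).memLFin.mul <| .sum fun l _ =>
      (hG.memLFin_christoffel l a c).mul (memLFin_extDeriv_flat hG hX b l)
  · exact .sum fun b _ => (hG.memWFin_ginv a b).memLFin.mul (memLFin_extDeriv_flat hG hX b c)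

/-- The sharp in Δ_H X and the flat in the pairing with X cancel. On the level of distributions this
takes associativity of the product and linearity in the function factor, after which G_{ab} X^b
g^{ac} sums to X^c. -/
theorem hodgeLocal_eq_sum_prod :
    hodgeLocal (Ω := Ω) G X = ∑ c, prod (X c) (hodgeForm G (flat G X) c) := by
  have hH := hasDivForm_hodgeForm hG hX
  have m : ∀ a b, MemWFin Ω fun y => G a b y * X b y := fun a b => (hG.memWFin a b).mul (hX b)
  have m' : ∀ a b c, MemWFin Ω fun y => G a b y * X b y * ginv G a c y := fun a b c =>
    (m a b).mul (hG.memWFin_ginv a c)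
  have e : ∀ a b, prod (fun y => G a b y * X b y) (hodgeVec G X a)
      = ∑ c, prod (fun y => G a b y * X b y * ginv G a c y) (hodgeForm G (flat G X) c) :=
    fun a b => by
      rw [hodgeVec, prod_sum (m a b) fun c _ => (hH c).prod (hG.memWFin_ginv a c)]
      exact Finset.sum_congr rfl fun c _ => prod_prod (m a b) (hG.memWFin_ginv a c) (hH c)
  rw [hodgeLocal]
  simp only [e]
  simp only [fun a => Finset.sum_comm (s := Finset.univ) (t := Finset.univ) (f := fun b c =>
    prod (fun y => G a b y * X b y * ginv G a c y) (hodgeForm (Ω := Ω) G (flat G X) c))]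
  rw [Finset.sum_comm]
  refine Finset.sum_congr rfl fun c _ => ?_
  simp only [fun a => prod_sum_left (s := Finset.univ) (fun b _ => m' a b c) (hH c)]
  rw [prod_sum_left (fun a _ => .sum fun b _ => m' a b c) (hH c)]
  refine prod_congr_left (.sum fun a _ => .sum fun b _ => m' a b c) ?_ (hH c)
  filter_upwards [ae_restrict_mem Ω.isOpen.measurableSet] with y hy
  rw [Finset.sum_comm]
  have : ∀ b, ∑ a, G a b y * X b y * ginv G a c y = (∑ a, G b a y * ginv G a c y) * X b y :=
    fun b => by
      rw [Finset.sum_mul]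
      exact Finset.sum_congr rfl fun a _ => by rw [hG.symm y hy a b]; ring
  simp only [this, hG.sum_mul_ginv hy]
  simp

/-- `g(Δ_H X, X) = -div (½ d|X|²)^♯ + |∇X|² + div (∇_X X - (div X) X) + (div X)² - tr (∇X ∘ ∇X)`. -/
theorem hodgeLocal_eq :
    hodgeLocal (Ω := Ω) G X = ofFun Ω (normSqNabla Ω G X) + ofFun Ω (ricciDensity Ω G X)
      + divVec G (ricciFlux Ω G X) - divVec G (gradHalfSq Ω G X) := by
  have hη := memLFin_extDeriv_flat hG hX
  have hA := memLFin_nablaVec hG hX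
  have ht := memLFin_trNabla hG hX
  -- F is dX^♭ with its first index raised, and κ is the Christoffel remainder of its
  -- codifferential.
  set F : Fin n → Fin n → Euc n → ℝ := fun c a y =>
    ∑ b, ginv G a b y * extDeriv Ω (flat G X) b c y with hFdef
  set κ : Fin n → Euc n → ℝ := fun c y => ∑ a, ∑ b, ginv G a b y *
    ∑ l, christoffel Ω G l a c y * extDeriv Ω (flat G X) b l y with hκdef
  have hF : ∀ c a, MemLFin Ω (F c a) := fun c a => .sum fun b _ =>
    (hG.memWFin_ginv a b).memLFin.mul (hη b c)
  have hκ : ∀ c, MemLFin Ω (κ c) := fun c => .sum fun a _ => .sum fun b _ =>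
    (hG.memWFin_ginv a b).memLFin.mul <| .sum fun l _ => (hG.memLFin_christoffel l a c).mul (hη b l)
  have hXF : ∀ c a, MemLFin Ω fun y => X c y * F c a y := fun c a => (hX c).memLFin.mul (hF c a)
  have hXt : ∀ c, MemLFin Ω fun y => X c y * trNabla Ω G X y := fun c => (hX c).memLFin.mul ht
  have h1 : ∀ c, MemLFin Ω fun y => X c y * κ c y := fun c => (hX c).memLFin.mul (hκ c)
  have h2 : ∀ c, MemLFin Ω fun y => ∑ a, weakDeriv Ω a (X c) y * F c a y := fun c =>
    .sum fun a _ => ((hX c).weakDeriv a).mul (hF c a)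
  have h3 : ∀ c, MemLFin Ω fun y => weakDeriv Ω c (X c) y * trNabla Ω G X y := fun c =>
    ((hX c).weakDeriv c).mul ht
  -- The Leibniz rule moves X^c inside both the divergence and the derivative of div X.
  have e : ∀ c, prod (X c) (hodgeForm G (flat G X) c)
      = ofFun Ω (fun y => X c y * κ c y + ∑ a, weakDeriv Ω a (X c) y * F c a y
          + weakDeriv Ω c (X c) y * trNabla Ω G X y)
        - divVec G (fun a y => X c y * F c a y)
        - ∂_{unitVec c} (ofFun Ω fun y => X c y * trNabla Ω G X y) := fun c => by
    rw [hodgeForm_flat hG hX, prod_sub (hX c)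
      ((hasDivForm_ofFun (hκ c)).sub (hG.hasDivForm_divVec (hF c))) (hasDivForm_distDeriv ht c),
      prod_sub (hX c) (hasDivForm_ofFun (hκ c)) (hG.hasDivForm_divVec (hF c)),
      prod_ofFun (hX c) (hκ c), prod_divVec hG (hX c) (hF c), prod_distDeriv (hX c) ht,
      ofFun_add ((h1 c).add (h2 c)) (h3 c), ofFun_add (h1 c) (h2 c)]
    abel
  rw [hodgeLocal_eq_sum_prod hG hX]
  simp only [e, Finset.sum_sub_distrib]
  have hP := MemLFin.sum (s := Finset.univ) fun c _ => ((h1 c).add (h2 c)).add (h3 c)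
  have hFf : ∀ a, MemLFin Ω fun y => ∑ c, X c y * F c a y := fun a => .sum fun c _ => hXF c a
  have hT := hG.memLFin_trace_mul hXt
  rw [← ofFun_sum fun c _ => ((h1 c).add (h2 c)).add (h3 c),
    ← divVec_sum hG (s := Finset.univ) fun c _ => hXF c, sum_distDeriv_eq (G := G),
    sub_sub, add_sub, ← divVec_add hG hFf hXt, ← sub_add, sub_add_eq_add_sub, ← ofFun_add hP hT,
    ← ofFun_add (memLFin_normSqNabla hG hX) (memLFin_ricciDensity hG hX), add_sub_assoc,
    ← divVec_sub hG (memLFin_ricciFlux hG hX) (memLFin_gradHalfSq hG hX), sub_eq_add_neg,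
    ← divVec_neg hG fun a => (hFf a).add (hXt a)]
  -- All terms are now one function plus one divergence on each side, so functions and vector fields
  -- are compared separately.
  congr 1
  · refine ofFun_congr ?_
    filter_upwards [ae_all_iff.2 fun a => ae_all_iff.2 fun c => sum_ginv_extDeriv_flat hG hX a c]
      with y hy
    have hκy : ∀ c, κ c y = ∑ a, ∑ l, christoffel Ω G l a c y * F l a y := fun c => by
      simp only [hκdef, hFdef, Finset.mul_sum]
      refine Finset.sum_congr rfl fun a _ => ?_
      rw [Finset.sum_comm]
      exact Finset.sum_congr rfl fun l _ => Finset.sum_congr rfl fun b _ => by ring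
    -- The Christoffel remainder completes ∂ₐ X^c to (∇ₐ X)^c.
    have s1 : ∑ c, X c y * κ c y + ∑ c, ∑ a, weakDeriv Ω a (X c) y * F c a y
        = ∑ a, ∑ c, nablaVec Ω G X a c y * F c a y := by
      have : ∑ c, X c y * κ c y
          = ∑ a, ∑ l, (∑ c, christoffel Ω G l a c y * X c y) * F l a y := by
        simp only [hκy, Finset.mul_sum, Finset.sum_mul]
        rw [Finset.sum_comm]
        refine Finset.sum_congr rfl fun a _ => ?_
        rw [Finset.sum_comm]
        exact Finset.sum_congr rfl fun l _ => Finset.sum_congr rfl fun c _ => by ring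
      rw [this, Finset.sum_comm (f := fun c a => weakDeriv Ω a (X c) y * F c a y),
        ← Finset.sum_add_distrib]
      refine Finset.sum_congr rfl fun a _ => ?_
      rw [← Finset.sum_add_distrib]
      exact Finset.sum_congr rfl fun c _ => by rw [nablaVec]; ring
    have s2 : ∑ a, ∑ c, nablaVec Ω G X a c y * F c a y = normSqNabla Ω G X y
        - ∑ a, ∑ c, nablaVec Ω G X a c y * nablaVec Ω G X c a y := by
      have : ∀ a c, F c a y = (∑ b, ginv G a b y * ∑ d, G c d y * nablaVec Ω G X b d y)
        - nablaVec Ω G X c a y := fun a c => hy a c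
      simp only [this, mul_sub, Finset.sum_sub_distrib, normSqNabla, Finset.mul_sum]
      congr 1
      refine Finset.sum_congr rfl fun a _ => ?_
      rw [Finset.sum_comm]
      exact Finset.sum_congr rfl fun b _ => Finset.sum_congr rfl fun c _ =>
        Finset.sum_congr rfl fun d _ => by ring
    -- Likewise the trace terms, left over from writing ∑ ∂_c (X^c div X) as an invariant
    -- divergence, complete ∑ ∂_c X^c to div X.
    have s3 : ∑ c, weakDeriv Ω c (X c) y * trNabla Ω G X y
        + ∑ c, christoffelTrace Ω G c y * (X c y * trNabla Ω G X y)
        = trNabla Ω G X y * trNabla Ω G X y := by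
      simp only [← mul_assoc, ← Finset.sum_mul, ← add_mul]
      congr 1
      simp only [trNabla, nablaVec, christoffelTrace, Finset.sum_add_distrib, Finset.sum_mul]
      rw [Finset.sum_comm (f := fun c i => christoffel Ω G i i c y * X c y)]
    rw [Finset.sum_add_distrib, Finset.sum_add_distrib, s1, s2, ricciDensity, ← s3]
    ring
  · refine divVec_congr fun a => ?_
    filter_upwards [ae_all_iff.2 fun c => sum_ginv_extDeriv_flat hG hX a c] with y hy
    have : ∀ c, F c a y = (∑ b, ginv G a b y * ∑ d, G c d y * nablaVec Ω G X b d y)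
        - nablaVec Ω G X c a y := fun c => hy c
    simp only [this, ricciFlux, gradHalfSq, mul_sub, Finset.sum_sub_distrib]
    have : ∑ c, X c y * ∑ b, ginv G a b y * ∑ d, G c d y * nablaVec Ω G X b d y
        = ∑ b, ginv G a b y * ∑ c, ∑ d, G c d y * X c y * nablaVec Ω G X b d y := by
      simp only [Finset.mul_sum]
      rw [Finset.sum_comm]
      exact Finset.sum_congr rfl fun b _ => Finset.sum_congr rfl fun c _ =>
        Finset.sum_congr rfl fun d _ => by ring
    rw [this]
    ring

end HodgeRicci

end LowReg

/-! ### The Ricci curvature paired with X twice -/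

namespace LowReg

section Ricci

variable {n : ℕ} {Ω : Opens (Euc n)} {G : Fin n → Fin n → Euc n → ℝ} {X : Fin n → Euc n → ℝ}

theorem distDeriv_sub (S T : 𝓓'(Ω, ℝ)) (v : Euc n) : ∂_{v} (S - T) = ∂_{v} S - ∂_{v} T :=
  map_sub (Distribution.lineDerivCLM v) S T

/-- For fixed j and k, the terms ∂ᵢ Γ^i_{jk} + Γ^i_{im} Γ^m_{jk} of the contracted curvature form
the divergence of Γ^·_{jk}, read as a vector field in this chart. -/
theorem ric_eq (hG : IsLipMetric Ω G) (j k : Fin n) :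
    ric (Ω := Ω) G j k = divVec G (fun i => christoffel Ω G i j k)
      - ∂_{unitVec j} (ofFun Ω (christoffelTrace Ω G k))
      - ofFun Ω fun y => ∑ i, ∑ m, christoffel Ω G i j m y * christoffel Ω G m i k y := by
  have hΓ := hG.memLFin_christoffel
  have m1 : ∀ i j' k', MemLFin Ω fun y => ∑ m, christoffel Ω G i j' m y * christoffel Ω G m k' k y :=
    fun i j' k' => .sum fun m _ => (hΓ i j' m).mul (hΓ m k' k)
  simp only [ric, riem, nablaVecDist, Finset.sum_sub_distrib, Finset.sum_add_distrib]
  rw [← LineDeriv.lineDerivOp_sum, ← ofFun_sum fun i _ => hΓ i i k, ← ofFun_sum fun i _ => m1 i i j,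
    ← ofFun_sum fun i _ => m1 i j i, divVec, divForm, ← sub_sub, add_comm (ofFun Ω _)]
  congr 4
  ext y
  simp only [christoffelTrace, Finset.sum_mul]
  rw [Finset.sum_comm]

variable [NeZero n] (hG : IsLipMetric Ω G) (hX : ∀ i, MemWFin Ω (X i))

include hG hX

/-- This is the part of the Ricci flux without Christoffel symbols. Its divergence formally contains
second derivatives of X, but in an antisymmetric combination where they cancel, leaving a function.
-/
theorem divVec_commutator :
    divVec (Ω := Ω) G (fun a y => ∑ b, (X b y * weakDeriv Ω b (X a) y
        - weakDeriv Ω b (X b) y * X a y))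
      = ofFun Ω fun y => (∑ a, ∑ b, (weakDeriv Ω a (X b) y * weakDeriv Ω b (X a) y
          - weakDeriv Ω b (X b) y * weakDeriv Ω a (X a) y))
        + ∑ a, christoffelTrace Ω G a y * ∑ b, (X b y * weakDeriv Ω b (X a) y
          - weakDeriv Ω b (X b) y * X a y) := by
  have m1 : ∀ a b c, MemLFin Ω fun y => X a y * weakDeriv Ω b (X c) y := fun a b c =>
    (hX a).memLFin.mul ((hX c).weakDeriv b)
  have m2 : ∀ a b, MemLFin Ω fun y => weakDeriv Ω b (X b) y * X a y := fun a b =>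
    ((hX b).weakDeriv b).mul (hX a).memLFin
  have m3 : ∀ a b, MemLFin Ω fun y => weakDeriv Ω a (X b) y * weakDeriv Ω b (X a) y
      - weakDeriv Ω b (X b) y * weakDeriv Ω a (X a) y := fun a b =>
    (((hX b).weakDeriv a).mul ((hX a).weakDeriv b)).sub
      (((hX b).weakDeriv b).mul ((hX a).weakDeriv a))
  have m4 : ∀ a, MemLFin Ω fun y => ∑ b, (X b y * weakDeriv Ω b (X a) y
        - weakDeriv Ω b (X b) y * X a y) := fun a => .sum fun b _ => (m1 b b a).sub (m2 a b)
  rw [ofFun_add (.sum fun a _ => .sum fun b _ => m3 a b) (hG.memLFin_trace_mul m4), divVec, divForm,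
    add_comm]
  congr 1
  simp only [fun a => ofFun_sum (s := Finset.univ) fun b _ => (m1 b b a).sub (m2 a b),
    fun a b => ofFun_sub (m1 b b a) (m2 a b), LineDeriv.lineDerivOp_sum, distDeriv_sub]
  conv_lhs => simp only [Finset.sum_sub_distrib]
  -- Exchanging a and b in the second sum pairs ∂ₐ(X^b ∂_b X^a) with ∂_b(X^b ∂ₐ X^a).
  rw [Finset.sum_comm (f := fun a b => ∂_{unitVec a}
    (ofFun Ω fun y => weakDeriv Ω b (X b) y * X a y)), ← Finset.sum_sub_distrib,
    ofFun_sum fun a _ => MemLFin.sum fun b _ => m3 a b]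
  refine Finset.sum_congr rfl fun a _ => ?_
  rw [← Finset.sum_sub_distrib, ofFun_sum fun b _ => m3 a b]
  refine Finset.sum_congr rfl fun b _ => ?_
  rw [← distDeriv_mul_weakDeriv_sub (hX b) (hX a) a b]
  simp only [mul_comm]

theorem prod_mul_ric (j k : Fin n) :
    prod (fun y => X j y * X k y) (ric (Ω := Ω) G j k)
      = divVec G (fun i y => X j y * X k y * christoffel Ω G i j k y)
        - ∂_{unitVec j} (ofFun Ω fun y => X j y * (X k y * christoffelTrace Ω G k y))
        + ofFun Ω fun y => (weakDeriv Ω j (X j) y * X k y + X j y * weakDeriv Ω j (X k) y)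
              * christoffelTrace Ω G k y
            - (∑ a, (weakDeriv Ω a (X j) y * X k y + X j y * weakDeriv Ω a (X k) y)
              * christoffel Ω G a j k y)
            - X j y * X k y * ∑ i, ∑ m, christoffel Ω G i j m y * christoffel Ω G m i k y := by
  have hu := (hX j).mul (hX k)
  have hΓ := fun i => hG.memLFin_christoffel i j k
  have hγ := hG.memLFin_christoffelTrace k
  have hQ : MemLFin Ω fun y => ∑ i, ∑ m, christoffel Ω G i j m y * christoffel Ω G m i k y :=
    .sum fun i _ => .sum fun m _ => (hG.memLFin_christoffel i j m).mul (hG.memLFin_christoffel m i k)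
  have hD : ∀ a, MemLFin Ω fun y => weakDeriv Ω a (X j) y * X k y + X j y * weakDeriv Ω a (X k) y :=
    fun a => (((hX j).weakDeriv a).mul (hX k).memLFin).add
      ((hX j).memLFin.mul ((hX k).weakDeriv a))
  have hDΓ : MemLFin Ω fun y => ∑ a, (weakDeriv Ω a (X j) y * X k y + X j y * weakDeriv Ω a (X k) y)
      * christoffel Ω G a j k y := .sum fun a _ => (hD a).mul (hΓ a)
  rw [ric_eq hG, prod_sub hu ((hG.hasDivForm_divVec hΓ).sub (hasDivForm_distDeriv hγ j))
    (hasDivForm_ofFun hQ), prod_sub hu (hG.hasDivForm_divVec hΓ) (hasDivForm_distDeriv hγ j),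
    prod_ofFun hu hQ, prod_distDeriv hu hγ, prod_divVec hG hu hΓ,
    ofFun_sub (((hD j).mul hγ).sub hDΓ) (hu.memLFin.mul hQ), ofFun_sub ((hD j).mul hγ) hDΓ]
  have hw := ae_all_iff.2 fun a => weakDeriv_mul (hX j) (hX k) a
  have e1 : ofFun Ω (fun y => ∑ a, weakDeriv Ω a (fun x => X j x * X k x) y
      * christoffel Ω G a j k y) = ofFun Ω fun y => ∑ a, (weakDeriv Ω a (X j) y * X k y
        + X j y * weakDeriv Ω a (X k) y) * christoffel Ω G a j k y := by
    refine ofFun_congr ?_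
    filter_upwards [hw] with y hy
    simp only [hy]
  have e2 : ofFun Ω (fun y => weakDeriv Ω j (fun x => X j x * X k x) y * christoffelTrace Ω G k y)
      = ofFun Ω fun y => (weakDeriv Ω j (X j) y * X k y + X j y * weakDeriv Ω j (X k) y)
        * christoffelTrace Ω G k y := by
    refine ofFun_congr ?_
    filter_upwards [hw] with y hy
    simp only [hy]
  rw [e1, e2]
  simp only [mul_assoc]
  abel

/-- `Ric(X, X) = div (∇_X X - (div X) X) + (div X)² - tr (∇X ∘ ∇X)`. -/
theorem ricciLocal_eq :
    ricciLocal (Ω := Ω) G X = divVec G (ricciFlux Ω G X) + ofFun Ω (ricciDensity Ω G X) := by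
  have hΓ := hG.memLFin_christoffel
  have hγ := hG.memLFin_christoffelTrace
  have hL := fun i => (hX i).memLFin
  have hD : ∀ a j k, MemLFin Ω fun y =>
      weakDeriv Ω a (X j) y * X k y + X j y * weakDeriv Ω a (X k) y :=
    fun a j k => (((hX j).weakDeriv a).mul (hL k)).add ((hL j).mul ((hX k).weakDeriv a))
  -- R collects the functions produced by moving X^j X^k under the derivatives of the Ricci tensor.
  set R : Fin n → Fin n → Euc n → ℝ := fun j k y =>
    (weakDeriv Ω j (X j) y * X k y + X j y * weakDeriv Ω j (X k) y) * christoffelTrace Ω G k y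
      - (∑ a, (weakDeriv Ω a (X j) y * X k y + X j y * weakDeriv Ω a (X k) y)
        * christoffel Ω G a j k y)
      - X j y * X k y * ∑ i, ∑ m, christoffel Ω G i j m y * christoffel Ω G m i k y with hRdef
  have hR : ∀ j k, MemLFin Ω (R j k) := fun j k =>
    (((hD j j k).mul (hγ k)).sub (.sum fun a _ => (hD a j k).mul (hΓ a j k))).sub
      (((hL j).mul (hL k)).mul (.sum fun i _ => .sum fun m _ => (hΓ i j m).mul (hΓ m i k)))
  set t : Euc n → ℝ := fun y => ∑ k, X k y * christoffelTrace Ω G k y with htdef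
  have ht : MemLFin Ω t := .sum fun k _ => (hL k).mul (hγ k)
  have hXt : ∀ j, MemLFin Ω fun y => X j y * t y := fun j => (hL j).mul ht
  have hXXΓ : ∀ j k i, MemLFin Ω fun y => X j y * X k y * christoffel Ω G i j k y := fun j k i =>
    ((hL j).mul (hL k)).mul (hΓ i j k)
  have hS : ∀ i, MemLFin Ω fun y => ∑ j, ∑ k, X j y * X k y * christoffel Ω G i j k y := fun i =>
    .sum fun j _ => .sum fun k _ => hXXΓ j k i
  have hC : ∀ a, MemLFin Ω fun y => ∑ b, (X b y * weakDeriv Ω b (X a) y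
        - weakDeriv Ω b (X b) y * X a y) := fun a => .sum fun b _ =>
    ((hL b).mul ((hX a).weakDeriv b)).sub (((hX b).weakDeriv b).mul (hL a))
  -- Inserting ∇X = ∂X + ΓX splits the flux into Γ(X,X), a multiple of X by the contracted symbols,
  -- and the Christoffel-free part. The first two are exactly the fluxes that appear in Ric(X,X).
  have hflux : divVec (Ω := Ω) G (ricciFlux Ω G X)
      = divVec G (fun i y => ∑ j, ∑ k, X j y * X k y * christoffel Ω G i j k y)
        - divVec G (fun i y => X i y * t y)
        + divVec G (fun a y => ∑ b, (X b y * weakDeriv Ω b (X a) y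
          - weakDeriv Ω b (X b) y * X a y)) := by
    rw [← divVec_sub hG hS hXt, ← divVec_add hG (fun i => (hS i).sub (hXt i)) hC]
    congr 1
    ext a y
    simp only [ricciFlux, trNabla, nablaVec, htdef, christoffelTrace, mul_add,
      Finset.sum_add_distrib, Finset.sum_sub_distrib, Finset.mul_sum, Finset.sum_mul, add_mul]
    have s1 : ∑ j, ∑ k, X j y * (christoffel Ω G a j k y * X k y)
        = ∑ j, ∑ k, X j y * X k y * christoffel Ω G a j k y :=
      Finset.sum_congr rfl fun j _ => Finset.sum_congr rfl fun k _ => by ring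
    have s2 : ∑ i, ∑ k, christoffel Ω G i i k y * X k y * X a y
        = ∑ k, ∑ i, X a y * (X k y * christoffel Ω G i i k y) := by
      rw [Finset.sum_comm]
      exact Finset.sum_congr rfl fun j _ => Finset.sum_congr rfl fun k _ => by ring
    rw [s1, s2]
    ring
  rw [ricciLocal]
  simp only [prod_mul_ric hG hX, Finset.sum_add_distrib, Finset.sum_sub_distrib]
  have e1 : ∑ j, ∑ k, divVec (Ω := Ω) G (fun i y => X j y * X k y * christoffel Ω G i j k y)
      = divVec G (fun i y => ∑ j, ∑ k, X j y * X k y * christoffel Ω G i j k y) := by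
    rw [divVec_sum hG fun j _ i => .sum fun k _ => hXXΓ j k i]
    exact Finset.sum_congr rfl fun j _ => (divVec_sum hG fun k _ i => hXXΓ j k i).symm
  have e2 : ∑ j, ∑ k, ∂_{unitVec j} (ofFun Ω fun y => X j y * (X k y * christoffelTrace Ω G k y))
      = divVec G (fun i y => X i y * t y)
        - ofFun Ω fun y => ∑ a, christoffelTrace Ω G a y * (X a y * t y) := by
    rw [← sum_distDeriv_eq]
    refine Finset.sum_congr rfl fun j _ => ?_
    rw [← LineDeriv.lineDerivOp_sum, ← ofFun_sum fun k _ => (hL j).mul ((hL k).mul (hγ k))]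
    simp only [htdef, Finset.mul_sum]
  have e3 : ∑ j, ∑ k, ofFun Ω (R j k) = ofFun Ω fun y => ∑ j, ∑ k, R j k y := by
    rw [ofFun_sum fun j _ => MemLFin.sum fun k _ => hR j k]
    exact Finset.sum_congr rfl fun j _ => (ofFun_sum fun k _ => hR j k).symm
  have e3' := e3
  simp only [hRdef] at e3'
  rw [e1, e2, e3', hflux, divVec_commutator hG hX, ← sub_add]
  have hT := hG.memLFin_trace_mul hXt
  have hRR := MemLFin.sum (s := Finset.univ) fun j _ => MemLFin.sum (s := Finset.univ) fun k _ =>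
    hR j k
  have hDD : MemLFin Ω fun y => (∑ a, ∑ b, (weakDeriv Ω a (X b) y * weakDeriv Ω b (X a) y
          - weakDeriv Ω b (X b) y * weakDeriv Ω a (X a) y))
        + ∑ a, christoffelTrace Ω G a y * ∑ b, (X b y * weakDeriv Ω b (X a) y
          - weakDeriv Ω b (X b) y * X a y) :=
    (MemLFin.sum fun a _ => .sum fun b _ => (((hX b).weakDeriv a).mul ((hX a).weakDeriv b)).sub
      (((hX b).weakDeriv b).mul ((hX a).weakDeriv a))).add (hG.memLFin_trace_mul hC)
  rw [add_assoc, add_assoc, ← ofFun_add hT hRR, ← ofFun_add hDD (memLFin_ricciDensity hG hX)]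
  congr 1
  congr 1
  ext y
  -- The divergences have been matched, and pointwise algebra remains: with ∇X = D + N, D = ∂X and N
  -- = ΓX, both sides are compared as polynomials in D, N and the trace of N, which is t.
  set D : Fin n → Fin n → ℝ := fun a c => weakDeriv Ω a (X c) y with hDdef
  set N : Fin n → Fin n → ℝ := fun a c => ∑ b, christoffel Ω G c a b y * X b y with hNdef
  have hAD : ∀ a c, nablaVec Ω G X a c y = D a c + N a c := fun a c => rfl
  have hsym := hG.christoffel_symm
  have T1 : ∑ j, ∑ k, ∑ a, (D a j * X k y + X j y * D a k) * christoffel Ω G a j k y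
      = 2 * ∑ a, ∑ c, D a c * N c a := by
    have a1 : ∑ j, ∑ k, ∑ a, D a j * X k y * christoffel Ω G a j k y = ∑ a, ∑ c, D a c * N c a := by
      rw [Finset.sum_comm (f := fun a c => D a c * N c a)]
      refine Finset.sum_congr rfl fun j _ => ?_
      rw [Finset.sum_comm]
      simp only [hNdef, Finset.mul_sum]
      exact Finset.sum_congr rfl fun a _ => Finset.sum_congr rfl fun k _ => by ring
    have a2 : ∑ j, ∑ k, ∑ a, X j y * D a k * christoffel Ω G a j k y = ∑ a, ∑ c, D a c * N c a := by
      rw [Finset.sum_comm, ← a1]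
      refine Finset.sum_congr rfl fun k _ => Finset.sum_congr rfl fun j _ =>
        Finset.sum_congr rfl fun a _ => ?_
      rw [hsym a j k]; ring
    simp only [add_mul, Finset.sum_add_distrib, a1, a2]
    ring
  have T2 : ∑ j, ∑ k, (D j j * X k y + X j y * D j k) * christoffelTrace Ω G k y
      = (∑ a, D a a) * t y + ∑ a, christoffelTrace Ω G a y * ∑ b, X b y * D b a := by
    simp only [add_mul, Finset.sum_add_distrib]
    congr 1
    · simp only [htdef, Finset.sum_mul, Finset.mul_sum]
      rw [Finset.sum_comm]
      exact Finset.sum_congr rfl fun a _ => Finset.sum_congr rfl fun k _ => by ring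
    · rw [Finset.sum_comm]
      simp only [Finset.mul_sum]
      exact Finset.sum_congr rfl fun a _ => Finset.sum_congr rfl fun k _ => by ring
  have T3 : ∑ j, ∑ k, X j y * X k y * ∑ i, ∑ m, christoffel Ω G i j m y * christoffel Ω G m i k y
      = ∑ a, ∑ c, N a c * N c a := by
    have b1 : ∀ a c, N a c = ∑ j, christoffel Ω G c j a y * X j y := fun a c => by
      simp only [hNdef]
      exact Finset.sum_congr rfl fun j _ => by rw [hsym c a j]
    have b2 : ∀ a c, N a c * N c a
        = ∑ j, ∑ k, X j y * X k y * (christoffel Ω G c j a y * christoffel Ω G a c k y) := by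
      intro a c
      rw [b1 a c, Finset.sum_mul_sum]
      exact Finset.sum_congr rfl fun j _ => Finset.sum_congr rfl fun k _ => by ring
    simp only [b2, Finset.mul_sum]
    have c1 : ∀ j, ∑ k, ∑ i, ∑ m, X j y * X k y * (christoffel Ω G i j m y * christoffel Ω G m i k y)
        = ∑ m, ∑ i, ∑ k, X j y * X k y * (christoffel Ω G i j m y * christoffel Ω G m i k y) := by
      intro j
      rw [Finset.sum_comm]
      simp only [fun i => Finset.sum_comm (s := Finset.univ) (t := Finset.univ) (f := fun k m =>
        X j y * X k y * (christoffel Ω G i j m y * christoffel Ω G m i k y))]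
      rw [Finset.sum_comm]
    simp only [c1]
    rw [Finset.sum_comm]
    exact Finset.sum_congr rfl fun a _ => Finset.sum_comm
  have T4 : trNabla Ω G X y = (∑ a, D a a) + t y := by
    simp only [trNabla, hAD, Finset.sum_add_distrib]
    congr 1
    simp only [hNdef, htdef, christoffelTrace, Finset.mul_sum]
    rw [Finset.sum_comm]
    exact Finset.sum_congr rfl fun a _ => Finset.sum_congr rfl fun k _ => by ring
  have T5 : ∑ a, ∑ c, nablaVec Ω G X a c y * nablaVec Ω G X c a y
      = (∑ a, ∑ c, D a c * D c a) + 2 * (∑ a, ∑ c, D a c * N c a) + ∑ a, ∑ c, N a c * N c a := by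
    have d1 : ∑ a, ∑ c, N a c * D c a = ∑ a, ∑ c, D a c * N c a := by
      rw [Finset.sum_comm]
      exact Finset.sum_congr rfl fun a _ => Finset.sum_congr rfl fun k _ => by ring
    simp only [hAD, add_mul, mul_add, Finset.sum_add_distrib, d1]
    ring
  have T6 : ∑ a, ∑ b, D b b * D a a = (∑ a, D a a) * ∑ a, D a a := by
    rw [Finset.sum_mul_sum, Finset.sum_comm]
  have T7 : ∑ a, christoffelTrace Ω G a y * (X a y * t y) = t y * t y := by
    nth_rw 2 [htdef]
    simp only [Finset.sum_mul]
    exact Finset.sum_congr rfl fun a _ => by ring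
  have T8 : ∑ a, christoffelTrace Ω G a y * ∑ b, D b b * X a y = (∑ a, D a a) * t y := by
    simp only [← Finset.sum_mul]
    simp only [htdef, Finset.mul_sum]
    exact Finset.sum_congr rfl fun a _ => by ring
  simp only [hRdef, Finset.sum_sub_distrib, ricciDensity, mul_sub]
  change (∑ a, christoffelTrace Ω G a y * (X a y * t y))
    + ((∑ j, ∑ k, (D j j * X k y + X j y * D j k) * christoffelTrace Ω G k y)
      - (∑ j, ∑ k, ∑ a, (D a j * X k y + X j y * D a k) * christoffel Ω G a j k y)
      - ∑ j, ∑ k, X j y * X k y * ∑ i, ∑ m, christoffel Ω G i j m y * christoffel Ω G m i k y)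
    = ((∑ a, ∑ b, D a b * D b a) - (∑ a, ∑ b, D b b * D a a))
      + ((∑ a, christoffelTrace Ω G a y * ∑ b, X b y * D b a)
        - ∑ a, christoffelTrace Ω G a y * ∑ b, D b b * X a y)
      + (trNabla Ω G X y * trNabla Ω G X y
        - ∑ a, ∑ c, nablaVec Ω G X a c y * nablaVec Ω G X c a y)
  rw [T1, T2, T3, T4, T5, T6, T7, T8]
  ring

end Ricci

end LowReg

/-! ### Smooth diffeomorphisms and the transport of densities -/

namespace LowReg

section Diffeo

variable {n : ℕ}

/-- `τ : V' → V` is a smooth diffeomorphism with inverse `σ`. -/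
structure IsDiffeo (V' V : Opens (Euc n)) (τ σ : Euc n → Euc n) : Prop where
  contDiffOn : ContDiffOn ℝ ∞ τ V'
  contDiffOn_symm : ContDiffOn ℝ ∞ σ V
  mapsTo : ∀ y ∈ V', τ y ∈ V
  mapsTo_symm : ∀ x ∈ V, σ x ∈ V'
  left_inv : ∀ y ∈ V', σ (τ y) = y
  right_inv : ∀ x ∈ V, τ (σ x) = x

/-- The partial derivative `∂ₐ τ^i`. -/
noncomputable def jac (τ : Euc n → Euc n) (i a : Fin n) (y : Euc n) : ℝ :=
  fderiv ℝ τ y (unitVec a) i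

theorem det_fderiv_eq (τ : Euc n → Euc n) (y : Euc n) :
    (fderiv ℝ τ y).det = (Matrix.of fun i a => jac τ i a y).det := by
  have : (fderiv ℝ τ y).det = LinearMap.det (fderiv ℝ τ y : Euc n →ₗ[ℝ] Euc n) := rfl
  rw [this, ← LinearMap.det_toMatrix (EuclideanSpace.basisFun (Fin n) ℝ).toBasis]
  congr 1

theorem fderiv_apply_eq_sum {F : Type*} [NormedAddCommGroup F] [NormedSpace ℝ F]
    (L : Euc n →L[ℝ] F) (v : Euc n) : L v = ∑ i, v i • L (unitVec i) := by
  conv_lhs => rw [← (EuclideanSpace.basisFun (Fin n) ℝ).sum_repr v]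
  simp

theorem contDiffOn_jac {V : Opens (Euc n)} {τ : Euc n → Euc n} (hτ : ContDiffOn ℝ ∞ τ V)
    (i a : Fin n) : ContDiffOn ℝ ∞ (jac τ i a) V := by
  have h1 : ContDiffOn ℝ ∞ (fderiv ℝ τ) V := hτ.fderiv_of_isOpen V.isOpen (by simp)
  have h2 : ContDiffOn ℝ ∞ (fun y => fderiv ℝ τ y (unitVec a)) V := h1.clm_apply contDiffOn_const
  exact (contDiffOn_euclidean.1 h2) i

theorem contDiffOn_det_fderiv {V : Opens (Euc n)} {τ : Euc n → Euc n} (hτ : ContDiffOn ℝ ∞ τ V) :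
    ContDiffOn ℝ ∞ (fun y => (fderiv ℝ τ y).det) V := by
  simp only [det_fderiv_eq, Matrix.det_apply, Matrix.of_apply]
  exact ContDiffOn.sum fun s _ =>
    (contDiffOn_prod fun i _ => contDiffOn_jac hτ _ _).const_smul _

/-- A function that is smooth on `V` and vanishes off a compact subset of `V` is a test function. -/
theorem contDiff_of_contDiffOn_of_compact {V : Opens (Euc n)} {u : Euc n → ℝ} {K : Set (Euc n)}
    (hK : IsCompact K) (hKV : K ⊆ V) (hu : ContDiffOn ℝ ∞ u V) (h0 : ∀ x ∉ K, u x = 0) :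
    ContDiff ℝ ∞ u ∧ HasCompactSupport u ∧ tsupport u ⊆ K := by
  have hs : tsupport u ⊆ K :=
    closure_minimal (fun x hx => by_contra fun h => hx (h0 x h)) hK.isClosed
  refine ⟨contDiff_iff_contDiffAt.2 fun x => ?_, hK.of_isClosed_subset (isClosed_tsupport u) hs, hs⟩
  by_cases hx : x ∈ V
  · exact hu.contDiffAt (V.isOpen.mem_nhds hx)
  · refine (contDiffAt_const (c := (0 : ℝ))).congr_of_eventuallyEq ?_
    filter_upwards [hK.isClosed.isOpen_compl.mem_nhds fun h => hx (hKV h)] with z hz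
    exact h0 z hz

/-- The function `u ∘ σ |det Dσ|` on `V`, extended by zero. -/
noncomputable def pushDensity (V : Opens (Euc n)) (σ : Euc n → Euc n) (u : Euc n → ℝ) : Euc n → ℝ :=
  (V : Set (Euc n)).indicator fun x => u (σ x) * |(fderiv ℝ σ x).det|

namespace IsDiffeo

variable {V V' : Opens (Euc n)} {τ σ : Euc n → Euc n}

theorem symm (h : IsDiffeo V' V τ σ) : IsDiffeo V V' σ τ :=
  ⟨h.contDiffOn_symm, h.contDiffOn, h.mapsTo_symm, h.mapsTo, h.right_inv, h.left_inv⟩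

theorem differentiableAt (h : IsDiffeo V' V τ σ) {y : Euc n} (hy : y ∈ V') :
    DifferentiableAt ℝ τ y :=
  (h.contDiffOn.contDiffAt (V'.isOpen.mem_nhds hy)).differentiableAt (by simp)

theorem image_eq (h : IsDiffeo V' V τ σ) : τ '' (V' : Set (Euc n)) = V := by
  ext x
  exact ⟨fun ⟨y, hy, e⟩ => e ▸ h.mapsTo y hy, fun hx => ⟨σ x, h.mapsTo_symm x hx, h.right_inv x hx⟩⟩

theorem injOn (h : IsDiffeo V' V τ σ) : InjOn τ V' := fun y hy z hz e => by
  rw [← h.left_inv y hy, ← h.left_inv z hz, e]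

theorem fderiv_comp (h : IsDiffeo V' V τ σ) {y : Euc n} (hy : y ∈ V') :
    (fderiv ℝ σ (τ y)).comp (fderiv ℝ τ y) = ContinuousLinearMap.id ℝ (Euc n) := by
  have h1 : HasFDerivAt (σ ∘ τ) ((fderiv ℝ σ (τ y)).comp (fderiv ℝ τ y)) y :=
    (h.symm.differentiableAt (h.mapsTo y hy)).hasFDerivAt.comp y (h.differentiableAt hy).hasFDerivAt
  have h2 : HasFDerivAt (σ ∘ τ) (ContinuousLinearMap.id ℝ (Euc n)) y := by
    refine (hasFDerivAt_id y).congr_of_eventuallyEq ?_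
    filter_upwards [V'.isOpen.mem_nhds hy] with z hz
    exact h.left_inv z hz
  exact h1.unique h2

theorem det_mul (h : IsDiffeo V' V τ σ) {y : Euc n} (hy : y ∈ V') :
    (fderiv ℝ σ (τ y)).det * (fderiv ℝ τ y).det = 1 := by
  have := congrArg (fun L : Euc n →L[ℝ] Euc n => L.det) (h.fderiv_comp hy)
  simpa [ContinuousLinearMap.det] using this

theorem det_ne_zero (h : IsDiffeo V' V τ σ) {y : Euc n} (hy : y ∈ V') :
    (fderiv ℝ τ y).det ≠ 0 := right_ne_zero_of_mul_eq_one (h.det_mul hy)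

theorem setIntegral_eq (h : IsDiffeo V' V τ σ) (F : Euc n → ℝ) :
    ∫ x in (V : Set (Euc n)), F x = ∫ y in (V' : Set (Euc n)), F (τ y) * |(fderiv ℝ τ y).det| := by
  have := integral_image_eq_integral_abs_det_fderiv_smul volume V'.isOpen.measurableSet
    (fun y hy => (h.differentiableAt hy).hasFDerivAt.hasFDerivWithinAt) h.injOn F
  rw [h.image_eq] at this
  rw [this]
  simp only [smul_eq_mul, mul_comm]

/-- Change of variables: `pushDensity` is the transpose of composition with τ. -/
theorem integral_comp_mul (h : IsDiffeo V' V τ σ) (F u : Euc n → ℝ) (hu : ∀ y ∉ V', u y = 0) :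
    ∫ y, F (τ y) * u y = ∫ x, F x * pushDensity V σ u x := by
  have e1 : ∫ y, F (τ y) * u y = ∫ y in (V' : Set (Euc n)), F (τ y) * u y :=
    (setIntegral_eq_integral_of_forall_compl_eq_zero fun y hy => by rw [hu y hy, mul_zero]).symm
  have e2 : ∫ x, F x * pushDensity V σ u x
      = ∫ x in (V : Set (Euc n)), F (τ (σ x)) * u (σ x) * |(fderiv ℝ σ x).det| := by
    rw [← setIntegral_eq_integral_of_forall_compl_eq_zero (s := (V : Set (Euc n)))]
    · refine setIntegral_congr_fun V.isOpen.measurableSet fun x hx => ?_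
      simp only [pushDensity, indicator_of_mem hx, h.right_inv x hx]
      ring
    · intro x hx
      rw [pushDensity, indicator_of_notMem hx, mul_zero]
  rw [e1, e2, h.symm.setIntegral_eq]

theorem pushDensity_test (h : IsDiffeo V' V τ σ) {u : Euc n → ℝ} (h1 : ContDiff ℝ ∞ u)
    (h2 : HasCompactSupport u) (h3 : tsupport u ⊆ V') :
    ContDiff ℝ ∞ (pushDensity V σ u) ∧ HasCompactSupport (pushDensity V σ u) ∧
      tsupport (pushDensity V σ u) ⊆ V := by
  have hc : IsCompact (τ '' tsupport u) := h2.image_of_continuousOn (h.contDiffOn.continuousOn.mono h3)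
  have hsub : τ '' tsupport u ⊆ V := by
    rintro _ ⟨y, hy, rfl⟩; exact h.mapsTo y (h3 hy)
  have hsm : ContDiffOn ℝ ∞ (fun x => u (σ x) * |(fderiv ℝ σ x).det|) V := by
    refine (h1.comp_contDiffOn h.contDiffOn_symm).mul fun x hx => ?_
    exact ((contDiffAt_abs (h.symm.det_ne_zero hx)).comp_contDiffWithinAt x
      (contDiffOn_det_fderiv h.contDiffOn_symm x hx))
  have := contDiff_of_contDiffOn_of_compact hc hsub
    (hsm.congr fun x hx => by rw [pushDensity, indicator_of_mem hx]) (u := pushDensity V σ u)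
    fun x hx => by
      by_cases hxV : x ∈ V
      · rw [pushDensity, indicator_of_mem (s := (V : Set (Euc n))) hxV,
          image_eq_zero_of_notMem_tsupport fun hs => hx ⟨σ x, hs, h.right_inv x hxV⟩, zero_mul]
      · exact indicator_of_notMem hxV _
  exact ⟨this.1, this.2.1, this.2.2.trans hsub⟩

/-- On a compact set the Jacobian is continuous and nonzero, so it can be divided out of the change
of variables formula. -/
theorem locallyIntegrableOn_comp (h : IsDiffeo V' V τ σ) {f : Euc n → ℝ}
    (hf : LocallyIntegrableOn f V volume) : LocallyIntegrableOn (fun y => f (τ y)) V' volume := by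
  rw [locallyIntegrableOn_iff V'.isOpen.isLocallyClosed]
  intro K hK hKc
  have hc : IsCompact (τ '' K) := hKc.image_of_continuousOn (h.contDiffOn.continuousOn.mono hK)
  have hsub : τ '' K ⊆ V := by rintro _ ⟨y, hy, rfl⟩; exact h.mapsTo y (hK hy)
  have h1 := hf.integrableOn_compact_subset hsub hc
  rw [integrableOn_image_iff_integrableOn_abs_det_fderiv_smul volume hKc.measurableSet
    (fun y hy => (h.differentiableAt (hK hy)).hasFDerivAt.hasFDerivWithinAt)
    (h.injOn.mono hK)] at h1
  have h2 : ContinuousOn (fun y => |(fderiv ℝ τ y).det|⁻¹) K :=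
    ((contDiffOn_det_fderiv h.contDiffOn).continuousOn.mono hK).abs.inv₀ fun y hy =>
      abs_ne_zero.2 (h.det_ne_zero (hK hy))
  refine (h1.mul_continuousOn h2 hKc).congr_fun (fun y hy => ?_) hKc.measurableSet
  have := abs_ne_zero.2 (h.det_ne_zero (hK hy))
  simp only [smul_eq_mul]
  field_simp

theorem fderiv_comp_apply (h : IsDiffeo V' V τ σ) {g : Euc n → ℝ} (hg : ContDiff ℝ ∞ g) {y : Euc n}
    (hy : y ∈ V') (a : Fin n) :
    fderiv ℝ (fun z => g (τ z)) y (unitVec a)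
      = ∑ i, fderiv ℝ g (τ y) (unitVec i) * jac τ i a y := by
  have h1 : HasFDerivAt (fun z => g (τ z)) ((fderiv ℝ g (τ y)).comp (fderiv ℝ τ y)) y :=
    (hg.differentiable (by simp) (τ y)).hasFDerivAt.comp y (h.differentiableAt hy).hasFDerivAt
  rw [h1.fderiv, ContinuousLinearMap.comp_apply, fderiv_apply_eq_sum (fderiv ℝ g (τ y))]
  exact Finset.sum_congr rfl fun i _ => by rw [smul_eq_mul, mul_comm]; rfl

end IsDiffeo

end Diffeo

end LowReg

/-! ### The Piola identity and the chain rule for weak derivatives -/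

namespace LowReg

section ChainRule

variable {n : ℕ}

theorem integral_mul_fderiv_of_compactSupport {f g : Euc n → ℝ} (hf : ContDiff ℝ ∞ f)
    (hg : ContDiff ℝ ∞ g) (hc : HasCompactSupport g) (v : Euc n) :
    ∫ x, f x * fderiv ℝ g x v = -∫ x, fderiv ℝ f x v * g x := by
  have h1 : Continuous fun x => fderiv ℝ f x v := (contDiff_fderiv_apply hf v).continuous
  have h2 : Continuous fun x => fderiv ℝ g x v := (contDiff_fderiv_apply hg v).continuous
  exact integral_mul_fderiv_eq_neg_fderiv_mul_of_integrable
    ((h1.mul hg.continuous).integrable_of_hasCompactSupport hc.mul_left)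
    ((hf.continuous.mul h2).integrable_of_hasCompactSupport (hc.fderiv_apply ℝ v).mul_left)
    ((hf.continuous.mul hg.continuous).integrable_of_hasCompactSupport hc.mul_left)
    (fun x _ => hf.differentiable (by simp) x) (fun x _ => hg.differentiable (by simp) x)

theorem locallyLipschitzOn_of_contDiffOn {V : Opens (Euc n)} {f : Euc n → ℝ}
    (hf : ContDiffOn ℝ ∞ f V) : LocallyLipschitzOn V f := by
  intro x hx
  obtain ⟨K, t, ht, hK⟩ := (((hf.contDiffAt (V.isOpen.mem_nhds hx)).of_le
    (by exact_mod_cast le_top) : ContDiffAt ℝ 1 f x)).exists_lipschitzOnWith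
  exact ⟨K, t, mem_nhdsWithin_of_mem_nhds ht, hK⟩

theorem memWFin_of_contDiffOn {V : Opens (Euc n)} {f : Euc n → ℝ} (hf : ContDiffOn ℝ ∞ f V) :
    MemWFin V f := (locallyLipschitzOn_of_contDiffOn hf).memWFin

theorem weakDeriv_of_contDiffOn {V : Opens (Euc n)} {f : Euc n → ℝ} (hf : ContDiffOn ℝ ∞ f V)
    (i : Fin n) : weakDeriv V i f =ᵐ[volume.restrict V] fun y => fderiv ℝ f y (unitVec i) := by
  have h := locallyLipschitzOn_of_contDiffOn hf
  filter_upwards [h.memWFin.weakDeriv_ae_eq (h.memLFin_lineDeriv _) (h.isWeakDeriv_lineDeriv i),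
    ae_restrict_mem V.isOpen.measurableSet] with y h1 hy
  rw [h1, ((hf.contDiffAt (V.isOpen.mem_nhds hy)).differentiableAt (by simp)).lineDeriv_eq_fderiv]

namespace IsDiffeo

variable {V V' : Opens (Euc n)} {τ σ : Euc n → Euc n}

theorem mul_jac_test (h : IsDiffeo V' V τ σ) {φ : Euc n → ℝ} (h1 : ContDiff ℝ ∞ φ)
    (h2 : HasCompactSupport φ) (h3 : tsupport φ ⊆ V') (i a : Fin n) :
    ContDiff ℝ ∞ (fun y => φ y * jac τ i a y) ∧ HasCompactSupport (fun y => φ y * jac τ i a y) ∧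
      tsupport (fun y => φ y * jac τ i a y) ⊆ V' := by
  have := contDiff_of_contDiffOn_of_compact (u := fun y => φ y * jac τ i a y) h2 h3
    (h1.contDiffOn.mul (contDiffOn_jac h.contDiffOn i a))
    fun x hx => by rw [image_eq_zero_of_notMem_tsupport hx, zero_mul]
  exact ⟨this.1, this.2.1, this.2.2.trans h3⟩

theorem comp_test (h : IsDiffeo V' V τ σ) {g : Euc n → ℝ} (h1 : ContDiff ℝ ∞ g)
    (h2 : HasCompactSupport g) (h3 : tsupport g ⊆ V) :
    ContDiff ℝ ∞ ((V' : Set (Euc n)).indicator fun y => g (τ y)) := by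
  have hsub : σ '' tsupport g ⊆ V' := by
    rintro _ ⟨y, hy, rfl⟩; exact h.mapsTo_symm y (h3 hy)
  refine (contDiff_of_contDiffOn_of_compact
    (h2.image_of_continuousOn (h.contDiffOn_symm.continuousOn.mono h3)) hsub
    ((h1.comp_contDiffOn h.contDiffOn).congr fun x hx => indicator_of_mem hx _) fun y hy => ?_).1
  by_cases hyV : y ∈ V'
  · rw [indicator_of_mem (s := (V' : Set (Euc n))) hyV]
    exact image_eq_zero_of_notMem_tsupport (f := g) fun hs => hy ⟨τ y, hs, h.left_inv y hyV⟩
  · exact indicator_of_notMem hyV _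

/-- The Piola identity `σ_*(∂ₐ φ) = ∑ᵢ ∂ᵢ (σ_*(φ ∂ₐ τ^i))` for densities. -/
theorem pushDensity_fderiv (h : IsDiffeo V' V τ σ) {φ : Euc n → ℝ} (h1 : ContDiff ℝ ∞ φ)
    (h2 : HasCompactSupport φ) (h3 : tsupport φ ⊆ V') (a : Fin n) :
    pushDensity V σ (fun y => fderiv ℝ φ y (unitVec a)) = fun x =>
      ∑ i, fderiv ℝ (pushDensity V σ fun y => φ y * jac τ i a y) x (unitVec i) := by
  have hd := h.pushDensity_test (contDiff_fderiv_apply h1 (unitVec a)) (h2.fderiv_apply ℝ _)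
    ((tsupport_fderiv_apply_subset' φ _).trans h3)
  have hu := fun i => h.mul_jac_test h1 h2 h3 i a
  have hp := fun i => h.pushDensity_test (hu i).1 (hu i).2.1 (hu i).2.2
  have hc1 := hd.1.continuous
  have hc2 : Continuous fun x =>
      ∑ i, fderiv ℝ (pushDensity V σ fun y => φ y * jac τ i a y) x (unitVec i) :=
    continuous_finsetSum _ fun i _ => (contDiff_fderiv_apply (hp i).1 _).continuous
  -- Both sides are continuous, so it is enough to test them against g. After integration by parts
  -- and change of variables this is the ordinary chain rule for g ∘ τ, and no derivative of a
  -- determinant is computed.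
  have key := V.isOpen.ae_eq_zero_of_integral_contDiff_smul_eq_zero (μ := volume)
    ((hc1.sub hc2).locallyIntegrable.locallyIntegrableOn _) ?_
  · rw [← hc1.ae_eq_iff_eq volume hc2]
    filter_upwards [key] with x hx
    by_cases hxV : x ∈ V
    · exact sub_eq_zero.1 (hx hxV)
    · rw [pushDensity, indicator_of_notMem hxV]
      symm
      refine Finset.sum_eq_zero fun i _ => ?_
      rw [image_eq_zero_of_notMem_tsupport fun hs => hxV ((hp i).2.2 (tsupport_fderiv_subset ℝ hs))]
      rfl
  · intro g g1 g2 g3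
    have hi1 : Integrable fun x => g x * pushDensity V σ (fun y => fderiv ℝ φ y (unitVec a)) x :=
      (g1.continuous.mul hc1).integrable_of_hasCompactSupport g2.mul_right
    have hi2 : ∀ i, Integrable fun x => g x *
        fderiv ℝ (pushDensity V σ fun y => φ y * jac τ i a y) x (unitVec i) := fun i =>
      (g1.continuous.mul (contDiff_fderiv_apply (hp i).1 _).continuous).integrable_of_hasCompactSupport
        g2.mul_right
    simp only [smul_eq_mul, Pi.sub_apply, mul_sub, Finset.mul_sum]
    rw [integral_sub hi1 (integrable_finsetSum _ fun i _ => hi2 i),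
      integral_finsetSum _ fun i _ => hi2 i, sub_eq_zero]
    have hz : ∀ y ∉ V', φ y = 0 := fun y hy => image_eq_zero_of_notMem_tsupport fun hs => hy (h3 hs)
    have e1 : ∀ i, ∫ x, g x * fderiv ℝ (pushDensity V σ fun y => φ y * jac τ i a y) x (unitVec i)
        = -∫ y, fderiv ℝ g (τ y) (unitVec i) * (φ y * jac τ i a y) := fun i => by
      rw [integral_mul_fderiv_of_compactSupport g1 (hp i).1 (hp i).2.1, h.integral_comp_mul
        (fun x => fderiv ℝ g x (unitVec i)) _ fun y hy => by rw [hz y hy, zero_mul]]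
    -- Outside V' the composite g ∘ τ is uncontrolled; cutting it off there makes it smooth on the
    -- whole space without changing the integral.
    have e2 : ∫ y, g (τ y) * fderiv ℝ φ y (unitVec a)
        = ∫ y, (V' : Set (Euc n)).indicator (fun y => g (τ y)) y * fderiv ℝ φ y (unitVec a) := by
      refine integral_congr_ae (Filter.Eventually.of_forall fun y => ?_)
      by_cases hy : y ∈ V'
      · simp only [indicator_of_mem (s := (V' : Set (Euc n))) hy]
      · simp only [image_eq_zero_of_notMem_tsupport fun hs => hy
          (h3 (tsupport_fderiv_apply_subset' φ (unitVec a) hs)), mul_zero]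
    rw [← h.integral_comp_mul g _ fun y hy => image_eq_zero_of_notMem_tsupport fun hs => hy
      (h3 (tsupport_fderiv_apply_subset' φ (unitVec a) hs)), e2,
      integral_mul_fderiv_of_compactSupport (h.comp_test g1 g2 g3) h1 h2]
    simp only [e1, Finset.sum_neg_distrib]
    have hi3 : ∀ i, Integrable fun y => fderiv ℝ g (τ y) (unitVec i) * (φ y * jac τ i a y) := by
      intro i
      have hk := contDiff_of_contDiffOn_of_compact
        (u := fun y => fderiv ℝ g (τ y) (unitVec i) * (φ y * jac τ i a y)) h2 h3
        (((contDiff_fderiv_apply g1 (unitVec i)).comp_contDiffOn h.contDiffOn).mul (hu i).1.contDiffOn)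
        fun x hx => by rw [image_eq_zero_of_notMem_tsupport hx, zero_mul, mul_zero]
      exact hk.1.continuous.integrable_of_hasCompactSupport hk.2.1
    rw [← integral_finsetSum _ fun i _ => hi3 i]
    congr 1
    refine integral_congr_ae (Filter.Eventually.of_forall fun y => ?_)
    by_cases hy : y ∈ V'
    · have : fderiv ℝ ((V' : Set (Euc n)).indicator fun y => g (τ y)) y
          = fderiv ℝ (fun y => g (τ y)) y := by
        refine Filter.EventuallyEq.fderiv_eq ?_
        filter_upwards [V'.isOpen.mem_nhds hy] with z hz
        exact indicator_of_mem hz _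
      simp only [this, h.fderiv_comp_apply g1 hy, Finset.sum_mul]
      exact Finset.sum_congr rfl fun i _ => by ring
    · simp [hz y hy]

/-- The chain rule for weak derivatives. -/
theorem isWeakDeriv_comp (h : IsDiffeo V' V τ σ) {f : Euc n → ℝ} {f' : Fin n → Euc n → ℝ}
    (hf' : ∀ i, LocallyIntegrableOn (f' i) V volume)
    (hf : LocallyIntegrableOn f V volume)
    (H : ∀ i, IsWeakDeriv V i f (f' i)) (a : Fin n) :
    IsWeakDeriv V' a (fun y => f (τ y)) fun y => ∑ i, f' i (τ y) * jac τ i a y := by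
  intro φ h1 h2 h3
  have hu := fun i => h.mul_jac_test h1 h2 h3 i a
  have hp := fun i => h.pushDensity_test (hu i).1 (hu i).2.1 (hu i).2.2
  have hz : ∀ y ∉ V', φ y = 0 := fun y hy => image_eq_zero_of_notMem_tsupport fun hs => hy (h3 hs)
  have hi : ∀ i, Integrable fun x => f x *
      fderiv ℝ (pushDensity V σ fun y => φ y * jac τ i a y) x (unitVec i) := fun i =>
    integrable_mul_test hf (contDiff_fderiv_apply (hp i).1 _).continuous
      ((hp i).2.1.fderiv_apply ℝ _) ((tsupport_fderiv_apply_subset' _ _).trans (hp i).2.2)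
  have hi' : ∀ i, Integrable fun y => f' i (τ y) * (φ y * jac τ i a y) := fun i =>
    integrable_mul_test (h.locallyIntegrableOn_comp (hf' i)) (hu i).1.continuous (hu i).2.1 (hu i).2.2
  -- The integral is carried to V, where the Piola identity writes the transported ∂ₐφ as a sum of
  -- derivatives of test functions. The weak derivatives of f apply there, and the result is carried
  -- back.
  rw [h.integral_comp_mul f _ fun y hy => image_eq_zero_of_notMem_tsupport fun hs => hy
      (h3 (tsupport_fderiv_apply_subset' φ (unitVec a) hs)), h.pushDensity_fderiv h1 h2 h3]
  simp only [Finset.mul_sum, Finset.sum_mul, mul_assoc]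
  rw [integral_finsetSum _ fun i _ => hi i, integral_finsetSum, ← Finset.sum_neg_distrib]
  · refine Finset.sum_congr rfl fun i _ => ?_
    rw [H i _ (hp i).1 (hp i).2.1 (hp i).2.2, ← h.integral_comp_mul (f' i) _ fun y hy => by
      rw [hz y hy, zero_mul]]
    simp only [mul_comm (φ _)]
  · intro i _
    simpa only [mul_comm (φ _)] using hi' i

end IsDiffeo

end ChainRule

end LowReg

/-! ### Change of coordinates for Christoffel symbols and ∇X -/

namespace LowReg

section Transformation

variable {n : ℕ}

/-- The transformation law of Christoffel symbols under a change of frame `J` with derivative `H`,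
at a point. -/
theorem sum_mul_christoffel_transform {J g g' : Fin n → Fin n → ℝ} {H D D' Γ Γ' : Fin n → Fin n → Fin n → ℝ}
    (hg : ∀ i j, g i j = g j i) (hJ0 : (Matrix.of J).det ≠ 0) (hg0 : (Matrix.of g).det ≠ 0)
    (hH : ∀ k a b, H k a b = H k b a)
    (hΓ : ∀ l i j, ∑ k, g l k * Γ k i j = (1 / 2) * (D i j l + D j i l - D l i j))
    (hΓ' : ∀ l i j, ∑ k, g' l k * Γ' k i j = (1 / 2) * (D' i j l + D' j i l - D' l i j))
    (hg' : ∀ a b, g' a b = ∑ i, ∑ j, J i a * J j b * g i j)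
    (hD' : ∀ c a b, D' c a b = ∑ i, ∑ j, ((H i c a * J j b + J i a * H j c b) * g i j
      + J i a * J j b * ∑ k, D k i j * J k c)) (k a b : Fin n) :
    ∑ c, J k c * Γ' c a b = H k a b + ∑ i, ∑ j, Γ k i j * J i a * J j b := by
  -- P holds the second derivatives of the coordinate change, Q the transformed derivatives of the
  -- metric. In the combination defining Γ', the symmetry of H cancels all P terms except P a b l.
  let P : Fin n → Fin n → Fin n → ℝ := fun a b c => ∑ i, ∑ j, H i a b * J j c * g i j
  let Q : Fin n → Fin n → Fin n → ℝ := fun c a b => ∑ i, ∑ j, ∑ k, J i a * J j b * D k i j * J k c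
  have e1 : ∀ c a b, D' c a b = P c a b + P c b a + Q c a b := fun c a b => by
    have : P c b a = ∑ i, ∑ j, J i a * H j c b * g i j := by
      simp only [P]
      rw [Finset.sum_comm]
      exact Finset.sum_congr rfl fun i _ => Finset.sum_congr rfl fun j _ => by rw [hg j i]; ring
    rw [hD', this]
    simp only [P, Q, ← Finset.sum_add_distrib, add_mul, Finset.mul_sum, mul_assoc]
  have e2 : ∀ l, ∑ k, g' l k * Γ' k a b = ∑ i, J i l * ∑ m, g i m * ∑ c, J m c * Γ' c a b := fun l => by
    simp only [hg', Finset.sum_mul, Finset.mul_sum]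
    rw [Finset.sum_comm]
    refine Finset.sum_congr rfl fun i _ => ?_
    rw [Finset.sum_comm]
    exact Finset.sum_congr rfl fun m _ => Finset.sum_congr rfl fun c _ => by ring
  have e3 : ∀ l, ∑ i, J i l * ∑ m, g i m * H m a b = P a b l := fun l => by
    simp only [P, Finset.mul_sum]
    rw [Finset.sum_comm]
    exact Finset.sum_congr rfl fun i _ => Finset.sum_congr rfl fun j _ => by rw [hg j i]; ring
  have e4 : ∀ l, ∑ i, J i l * ∑ m, g i m * ∑ p, ∑ q, Γ m p q * J p a * J q b
      = (1 / 2) * (Q a b l + Q b a l - Q l a b) := fun l => by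
    have h1 : ∀ i, ∑ m, g i m * ∑ p, ∑ q, Γ m p q * J p a * J q b
        = ∑ p, ∑ q, J p a * J q b * ((1 / 2) * (D p q i + D q p i - D i p q)) := fun i => by
      simp only [← hΓ, Finset.mul_sum]
      rw [Finset.sum_comm]
      refine Finset.sum_congr rfl fun p _ => ?_
      rw [Finset.sum_comm]
      exact Finset.sum_congr rfl fun q _ => Finset.sum_congr rfl fun m _ => by ring
    have q1 : Q a b l = ∑ i, ∑ p, ∑ q, J i l * (J p a * J q b * D p q i) := by
      simp only [Q]
      rw [Finset.sum_comm]
      refine Finset.sum_congr rfl fun i _ => ?_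
      rw [Finset.sum_comm]
      exact Finset.sum_congr rfl fun p _ => Finset.sum_congr rfl fun q _ => by ring
    have q2 : Q b a l = ∑ i, ∑ p, ∑ q, J i l * (J p a * J q b * D q p i) := by
      simp only [Q]
      rw [Finset.sum_comm]
      exact Finset.sum_congr rfl fun i _ => Finset.sum_congr rfl fun p _ =>
        Finset.sum_congr rfl fun q _ => by ring
    have q3 : Q l a b = ∑ i, ∑ p, ∑ q, J i l * (J p a * J q b * D i p q) := by
      simp only [Q]
      conv_rhs => rw [Finset.sum_comm]
      refine Finset.sum_congr rfl fun p _ => ?_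
      conv_rhs => rw [Finset.sum_comm]
      exact Finset.sum_congr rfl fun q _ => Finset.sum_congr rfl fun i _ => by ring
    rw [q1, q2, q3]
    simp only [h1]
    simp only [Finset.mul_sum, ← Finset.sum_add_distrib, ← Finset.sum_sub_distrib]
    exact Finset.sum_congr rfl fun i _ => Finset.sum_congr rfl fun p _ =>
      Finset.sum_congr rfl fun q _ => by ring
  -- w is the difference of the two sides. It is annihilated by the invertible matrix Jᵀ g, hence
  -- zero.
  let w : Fin n → ℝ := fun m =>
    ∑ c, J m c * Γ' c a b - (H m a b + ∑ i, ∑ j, Γ m i j * J i a * J j b)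
  have hw : ∀ l, ∑ i, J i l * ∑ m, g i m * w m = 0 := fun l => by
    have : ∑ i, J i l * ∑ m, g i m * w m = ∑ k, g' l k * Γ' k a b
        - (P a b l + (1 / 2) * (Q a b l + Q b a l - Q l a b)) := by
      rw [e2, ← e3, ← e4]
      simp only [w, mul_sub, mul_add, Finset.sum_sub_distrib, Finset.sum_add_distrib]
    rw [this, hΓ', e1, e1, e1]
    have s1 : P b a l = P a b l := by simp only [P, hH _ b a]
    have s2 : P l a b = P a l b := by simp only [P, hH _ l a]
    have s3 : P l b a = P b l a := by simp only [P, hH _ l b]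
    rw [s1, s2, s3]; ring
  have hdet : ((Matrix.of J).transpose * Matrix.of g).det ≠ 0 := by
    rw [Matrix.det_mul, Matrix.det_transpose]; exact mul_ne_zero hJ0 hg0
  have := Matrix.eq_zero_of_mulVec_eq_zero hdet (v := w) (by
    rw [← Matrix.mulVec_mulVec]
    ext l
    simpa [Matrix.mulVec, dotProduct] using hw l)
  exact sub_eq_zero.1 (congrFun this k)

/-- The second derivative `∂ₐ ∂_b τ^i`. -/
noncomputable def hess (τ : Euc n → Euc n) (i a b : Fin n) (y : Euc n) : ℝ :=
  fderiv ℝ (jac τ i b) y (unitVec a)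

/-- The components of a metric and a vector field in two coordinate systems related by `τ`. -/
structure IsCoordChange (V' V : Opens (Euc n)) (τ σ : Euc n → Euc n)
    (G' G : Fin n → Fin n → Euc n → ℝ) (X' X : Fin n → Euc n → ℝ) : Prop where
  diffeo : IsDiffeo V' V τ σ
  metric' : IsLipMetric V' G'
  metric : IsLipMetric V G
  vec' : ∀ i, MemWFin V' (X' i)
  vec : ∀ i, MemWFin V (X i)
  metric_eq : ∀ y ∈ V', ∀ a b, G' a b y = ∑ i, ∑ j, jac τ i a y * jac τ j b y * G i j (τ y)
  vec_eq : ∀ y ∈ V', ∀ i, X i (τ y) = ∑ a, jac τ i a y * X' a y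

variable {V V' : Opens (Euc n)} {τ σ : Euc n → Euc n}

theorem locallyIntegrableOn_sum {ι : Type*} {s : Finset ι} {f : ι → Euc n → ℝ}
    (hf : ∀ i ∈ s, LocallyIntegrableOn (f i) V volume) :
    LocallyIntegrableOn (fun y => ∑ i ∈ s, f i y) V volume := by
  rw [locallyIntegrableOn_iff V.isOpen.isLocallyClosed]
  exact fun K hK hKc => integrable_finsetSum _ fun i hi => (hf i hi).integrableOn_compact_subset hK hKc

namespace IsDiffeo

theorem hess_symm (h : IsDiffeo V' V τ σ) {y : Euc n} (hy : y ∈ V') (i a b : Fin n) :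
    hess τ i a b y = hess τ i b a y := by
  have h0 : ContDiffAt ℝ ∞ τ y := h.contDiffOn.contDiffAt (V'.isOpen.mem_nhds hy)
  have h1 : DifferentiableAt ℝ (fderiv ℝ τ) y :=
    (h0.fderiv_right (m := ∞) (by simp)).differentiableAt (by simp)
  have key : ∀ a b, hess τ i a b y = fderiv ℝ (fderiv ℝ τ) y (unitVec a) (unitVec b) i := by
    intro a b
    have h2 : HasFDerivAt (jac τ i b)
        (((EuclideanSpace.proj i : Euc n →L[ℝ] ℝ).comp
          (ContinuousLinearMap.apply ℝ (Euc n) (unitVec b))).comp (fderiv ℝ (fderiv ℝ τ) y)) y :=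
      ((EuclideanSpace.proj i : Euc n →L[ℝ] ℝ).comp
          (ContinuousLinearMap.apply ℝ (Euc n) (unitVec b))).hasFDerivAt.comp y h1.hasFDerivAt
    rw [hess, h2.fderiv]
    simp
  rw [key, key, h0.isSymmSndFDerivAt (by simpa using ENat.LEInfty.out)]

/-- The chain rule for the weak derivatives of a composition that is known to be weakly
differentiable. -/
theorem weakDeriv_comp (h : IsDiffeo V' V τ σ) {f : Euc n → ℝ} (hf : MemWFin V f)
    (hf' : MemWFin V' fun y => f (τ y)) (a : Fin n) :
    weakDeriv V' a (fun y => f (τ y)) =ᵐ[volume.restrict V']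
      fun y => ∑ i, weakDeriv V i f (τ y) * jac τ i a y := by
  have h1 := fun i => (hf.weakDeriv i).locallyIntegrableOn
  refine (hf'.isWeakDeriv a).unique (hf'.weakDeriv a).locallyIntegrableOn
    (locallyIntegrableOn_sum fun i _ => ?_)
    (h.isWeakDeriv_comp h1 hf.memLFin.locallyIntegrableOn (fun i => hf.isWeakDeriv i) a)
  exact (h.locallyIntegrableOn_comp (h1 i)).mul_continuousOn
    (contDiffOn_jac h.contDiffOn i a).continuousOn V'.isOpen.isLocallyClosed

theorem memWFin_comp_lip (h : IsDiffeo V' V τ σ) {f : Euc n → ℝ} (hf : LocallyLipschitzOn V f) :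
    MemWFin V' fun y => f (τ y) := by
  refine LocallyLipschitzOn.memWFin fun y hy => ?_
  obtain ⟨C, u, hu, hC⟩ := ((h.contDiffOn.contDiffAt (V'.isOpen.mem_nhds hy)).of_le
    (by exact_mod_cast le_top) : ContDiffAt ℝ 1 τ y).exists_lipschitzOnWith
  obtain ⟨K, t, ht, hK⟩ := hf (h.mapsTo y hy)
  rw [nhdsWithin_eq_nhds.2 (V.isOpen.mem_nhds (h.mapsTo y hy))] at ht
  exact ⟨K * C, u ∩ τ ⁻¹' t, mem_nhdsWithin_of_mem_nhds
    (Filter.inter_mem hu ((h.differentiableAt hy).continuousAt ht)),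
    hK.comp (hC.mono inter_subset_left) fun y hy => hy.2⟩

theorem memWFin_jac (h : IsDiffeo V' V τ σ) (i a : Fin n) : MemWFin V' (jac τ i a) :=
  memWFin_of_contDiffOn (contDiffOn_jac h.contDiffOn i a)

theorem weakDeriv_jac (h : IsDiffeo V' V τ σ) :
    ∀ᵐ y ∂volume.restrict V', ∀ c i a, weakDeriv V' c (jac τ i a) y = hess τ i c a y :=
  ae_all_iff.2 fun c => ae_all_iff.2 fun i => ae_all_iff.2 fun a =>
    weakDeriv_of_contDiffOn (contDiffOn_jac h.contDiffOn i a) c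

end IsDiffeo

namespace IsCoordChange

variable {G G' : Fin n → Fin n → Euc n → ℝ} {X X' : Fin n → Euc n → ℝ}

theorem weakDeriv_metric' (h : IsCoordChange V' V τ σ G' G X' X) :
    ∀ᵐ y ∂volume.restrict V', ∀ c a b, weakDeriv V' c (G' a b) y = ∑ i, ∑ j,
      ((hess τ i c a y * jac τ j b y + jac τ i a y * hess τ j c b y) * G i j (τ y)
        + jac τ i a y * jac τ j b y * ∑ k, weakDeriv V k (G i j) (τ y) * jac τ k c y) := by
  have hJ := h.diffeo.memWFin_jac
  have hc : ∀ i j, MemWFin V' fun y => G i j (τ y) := fun i j =>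
    h.diffeo.memWFin_comp_lip (h.metric.lip i j)
  have hJJ := fun i j a b => (hJ i a).mul (hJ j b)
  have hJJG := fun i j a b => (hJJ i j a b).mul (hc i j)
  have e0 : ∀ a b, G' a b =ᵐ[volume.restrict V']
      fun y => ∑ i, ∑ j, jac τ i a y * jac τ j b y * G i j (τ y) := fun a b =>
    (ae_restrict_iff' V'.isOpen.measurableSet).2 <|
      Filter.Eventually.of_forall fun y hy => h.metric_eq y hy a b
  have e1 : ∀ᵐ y ∂volume.restrict V', ∀ c a b, weakDeriv V' c (G' a b) y
      = ∑ i, weakDeriv V' c (fun y => ∑ j, jac τ i a y * jac τ j b y * G i j (τ y)) y :=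
    ae_all_iff.2 fun c => ae_all_iff.2 fun a => ae_all_iff.2 fun b => by
      rw [weakDeriv_congr c (e0 a b)]
      exact weakDeriv_sum c fun i _ => .sum fun j _ => hJJG i j a b
  have e2 : ∀ᵐ y ∂volume.restrict V', ∀ c a b i,
      weakDeriv V' c (fun y => ∑ j, jac τ i a y * jac τ j b y * G i j (τ y)) y
      = ∑ j, weakDeriv V' c (fun y => jac τ i a y * jac τ j b y * G i j (τ y)) y :=
    ae_all_iff.2 fun c => ae_all_iff.2 fun a => ae_all_iff.2 fun b => ae_all_iff.2 fun i =>
      weakDeriv_sum c fun j _ => hJJG i j a b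
  have e3 : ∀ᵐ y ∂volume.restrict V', ∀ c a b i j,
      weakDeriv V' c (fun y => jac τ i a y * jac τ j b y * G i j (τ y)) y
      = weakDeriv V' c (fun y => jac τ i a y * jac τ j b y) y * G i j (τ y)
        + jac τ i a y * jac τ j b y * weakDeriv V' c (fun y => G i j (τ y)) y :=
    ae_all_iff.2 fun c => ae_all_iff.2 fun a => ae_all_iff.2 fun b => ae_all_iff.2 fun i =>
      ae_all_iff.2 fun j => weakDeriv_mul (hJJ i j a b) (hc i j) c
  have e4 : ∀ᵐ y ∂volume.restrict V', ∀ c a b i j,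
      weakDeriv V' c (fun y => jac τ i a y * jac τ j b y) y
      = weakDeriv V' c (jac τ i a) y * jac τ j b y + jac τ i a y * weakDeriv V' c (jac τ j b) y :=
    ae_all_iff.2 fun c => ae_all_iff.2 fun a => ae_all_iff.2 fun b => ae_all_iff.2 fun i =>
      ae_all_iff.2 fun j => weakDeriv_mul (hJ i a) (hJ j b) c
  have e5 : ∀ᵐ y ∂volume.restrict V', ∀ c i j, weakDeriv V' c (fun y => G i j (τ y)) y
      = ∑ k, weakDeriv V k (G i j) (τ y) * jac τ k c y :=
    ae_all_iff.2 fun c => ae_all_iff.2 fun i => ae_all_iff.2 fun j =>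
      h.diffeo.weakDeriv_comp (h.metric.memWFin i j) (hc i j) c
  filter_upwards [e1, e2, e3, e4, e5, h.diffeo.weakDeriv_jac] with y h1 h2 h3 h4 h5 h6 c a b
  simp only [h1, h2, h3, h4, h5, h6]

/-- X ∘ τ = J X' is differentiated in two ways. Sobolev regularity of X ∘ τ is read off from the
right side, where J is smooth; the chain rule then identifies its derivative. -/
theorem weakDeriv_vec (h : IsCoordChange V' V τ σ G' G X' X) :
    ∀ᵐ y ∂volume.restrict V', ∀ c i, ∑ k, weakDeriv V k (X i) (τ y) * jac τ k c y
      = ∑ a, (hess τ i c a y * X' a y + jac τ i a y * weakDeriv V' c (X' a) y) := by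
  have hJ := h.diffeo.memWFin_jac
  have hJX := fun i a => (hJ i a).mul (h.vec' a)
  have e0 : ∀ i, (fun y => X i (τ y)) =ᵐ[volume.restrict V'] fun y => ∑ a, jac τ i a y * X' a y :=
    fun i => (ae_restrict_iff' V'.isOpen.measurableSet).2 <|
      Filter.Eventually.of_forall fun y hy => h.vec_eq y hy i
  have hc : ∀ i, MemWFin V' fun y => X i (τ y) := fun i =>
    (MemWFin.sum fun a _ => hJX i a).congr (e0 i).symm
  have e1 : ∀ᵐ y ∂volume.restrict V', ∀ c i, weakDeriv V' c (fun y => X i (τ y)) y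
      = ∑ a, weakDeriv V' c (fun y => jac τ i a y * X' a y) y :=
    ae_all_iff.2 fun c => ae_all_iff.2 fun i => by
      rw [weakDeriv_congr c (e0 i)]
      exact weakDeriv_sum c fun a _ => hJX i a
  have e2 : ∀ᵐ y ∂volume.restrict V', ∀ c i a, weakDeriv V' c (fun y => jac τ i a y * X' a y) y
      = weakDeriv V' c (jac τ i a) y * X' a y + jac τ i a y * weakDeriv V' c (X' a) y :=
    ae_all_iff.2 fun c => ae_all_iff.2 fun i => ae_all_iff.2 fun a =>
      weakDeriv_mul (hJ i a) (h.vec' a) c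
  have e3 : ∀ᵐ y ∂volume.restrict V', ∀ c i, weakDeriv V' c (fun y => X i (τ y)) y
      = ∑ k, weakDeriv V k (X i) (τ y) * jac τ k c y :=
    ae_all_iff.2 fun c => ae_all_iff.2 fun i => h.diffeo.weakDeriv_comp (h.vec i) (hc i) c
  filter_upwards [e1, e2, e3, h.diffeo.weakDeriv_jac] with y h1 h2 h3 h4 c i
  rw [← h3, h1]
  simp only [h2, h4]

theorem sum_mul_christoffel (h : IsCoordChange V' V τ σ G' G X' X) :
    ∀ᵐ y ∂volume.restrict V', ∀ k a b, ∑ c, jac τ k c y * christoffel V' G' c a b y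
      = hess τ k a b y
        + ∑ i, ∑ j, christoffel V G k i j (τ y) * jac τ i a y * jac τ j b y := by
  filter_upwards [h.weakDeriv_metric', ae_restrict_mem V'.isOpen.measurableSet] with y h1 hy k a b
  have hτ := h.diffeo.mapsTo y hy
  exact sum_mul_christoffel_transform (J := fun i a => jac τ i a y) (g := fun i j => G i j (τ y))
    (g' := fun i j => G' i j y) (H := fun i a b => hess τ i a b y)
    (D := fun k i j => weakDeriv V k (G i j) (τ y)) (D' := fun k i j => weakDeriv V' k (G' i j) y)
    (Γ := fun k i j => christoffel V G k i j (τ y)) (Γ' := fun k i j => christoffel V' G' k i j y)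
    (h.metric.symm _ hτ) (by rw [← det_fderiv_eq]; exact h.diffeo.det_ne_zero hy)
    (h.metric.det_ne _ hτ) (fun k => h.diffeo.hess_symm hy k)
    (fun l i j => h.metric.sum_mul_christoffel hτ l i j)
    (fun l i j => h.metric'.sum_mul_christoffel hy l i j) (h.metric_eq y hy) h1 k a b

/-- The covariant derivative of a vector field is a tensor. -/
theorem sum_mul_nablaVec (h : IsCoordChange V' V τ σ G' G X' X) :
    ∀ᵐ y ∂volume.restrict V', ∀ a i, ∑ d, jac τ i d y * nablaVec V' G' X' a d y
      = ∑ j, jac τ j a y * nablaVec V G X j i (τ y) := by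
  filter_upwards [h.sum_mul_christoffel, h.weakDeriv_vec, ae_restrict_mem V'.isOpen.measurableSet]
    with y h1 h2 hy a i
  have e1 : ∑ d, jac τ i d y * ∑ b, christoffel V' G' d a b y * X' b y
      = ∑ b, (hess τ i a b y
        + ∑ p, ∑ q, christoffel V G i p q (τ y) * jac τ p a y * jac τ q b y) * X' b y := by
    simp only [← h1, Finset.mul_sum, Finset.sum_mul]
    rw [Finset.sum_comm]
    exact Finset.sum_congr rfl fun b _ => Finset.sum_congr rfl fun d _ => by ring
  have e2 : ∑ b, (∑ p, ∑ q, christoffel V G i p q (τ y) * jac τ p a y * jac τ q b y) * X' b y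
      = ∑ p, jac τ p a y * ∑ q, christoffel V G i p q (τ y) * X q (τ y) := by
    simp only [h.vec_eq y hy, Finset.mul_sum, Finset.sum_mul]
    rw [Finset.sum_comm]
    refine Finset.sum_congr rfl fun p _ => ?_
    rw [Finset.sum_comm]
    exact Finset.sum_congr rfl fun b _ => Finset.sum_congr rfl fun d _ => by ring
  have h3 := h2 a i
  simp only [nablaVec, mul_add, Finset.sum_add_distrib, add_mul, e1] at h3 ⊢
  rw [e2]
  -- The second derivatives of τ occur once in the law for Γ and once in the derivative of J X',
  -- with opposite effect.
  simp only [mul_comm (jac τ _ a y) (weakDeriv V _ (X i) (τ y)), h3]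
  ring

end IsCoordChange

end Transformation

end LowReg

/-! ### Invariance of the functions and vector fields in the identity -/

namespace LowReg

section Invariance

variable {n : ℕ}

open Matrix in
-- In matrix form, invariance reduces to cancelling J against its inverse. Rows of the matrix of ∇X
-- carry the direction of differentiation, columns the component.
theorem trNabla_eq_trace (V : Opens (Euc n)) (G : Fin n → Fin n → Euc n → ℝ)
    (X : Fin n → Euc n → ℝ) (y : Euc n) :
    trNabla V G X y = trace (of fun a i => nablaVec V G X a i y) := rfl

open Matrix in
theorem ricciDensity_eq_trace (V : Opens (Euc n)) (G : Fin n → Fin n → Euc n → ℝ)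
    (X : Fin n → Euc n → ℝ) (y : Euc n) :
    ricciDensity V G X y = trNabla V G X y * trNabla V G X y
      - trace ((of fun a i => nablaVec V G X a i y) * of fun a i => nablaVec V G X a i y) := by
  simp [ricciDensity, trace, mul_apply]

open Matrix in
theorem normSqNabla_eq_trace {V : Opens (Euc n)} {G : Fin n → Fin n → Euc n → ℝ}
    (hG : IsLipMetric V G) (X : Fin n → Euc n → ℝ) {y : Euc n} (hy : y ∈ V) :
    normSqNabla V G X y = trace ((of fun a b => G a b y)⁻¹ * (of fun a i => nablaVec V G X a i y)
      * (of fun a b => G a b y) * (of fun a i => nablaVec V G X a i y)ᵀ) := by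
  simp only [normSqNabla, trace, diag, mul_apply, transpose_apply, of_apply, Finset.sum_mul]
  refine Finset.sum_congr rfl fun a _ => ?_
  rw [Finset.sum_comm]
  refine Finset.sum_congr rfl fun i _ => ?_
  rw [Finset.sum_comm]
  refine Finset.sum_congr rfl fun j _ => Finset.sum_congr rfl fun b _ => ?_
  rw [hG.symm y hy i j, ginv]; ring

open Matrix in
theorem gradHalfSq_eq_mulVec (V : Opens (Euc n)) (G : Fin n → Fin n → Euc n → ℝ)
    (X : Fin n → Euc n → ℝ) (a : Fin n) (y : Euc n) :
    gradHalfSq V G X a y = ((of fun a b => G a b y)⁻¹ *ᵥ (of fun a i => nablaVec V G X a i y) *ᵥ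
      (of fun a b => G a b y)ᵀ *ᵥ fun c => X c y) a := by
  simp only [gradHalfSq, mulVec, dotProduct, transpose_apply, of_apply]
  refine Finset.sum_congr rfl fun b _ => ?_
  rw [ginv, Finset.sum_comm]
  simp only [Finset.mul_sum]
  exact Finset.sum_congr rfl fun c _ => Finset.sum_congr rfl fun d _ => by ring

variable {V V' : Opens (Euc n)} {τ σ : Euc n → Euc n}

open Matrix in
theorem IsDiffeo.jac_mul_jac (h : IsDiffeo V' V τ σ) {y : Euc n} (hy : y ∈ V') :
    (of fun a i => jac σ a i (τ y)) * (of fun i a => jac τ i a y) = 1 := by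
  ext a b
  have := congrArg (fun L : Euc n →L[ℝ] Euc n => L (unitVec b) a) (h.fderiv_comp hy)
  simp only [ContinuousLinearMap.comp_apply, fderiv_apply_eq_sum (fderiv ℝ σ (τ y))
    (fderiv ℝ τ y (unitVec b))] at this
  simp only [mul_apply, of_apply, jac, one_apply]
  simpa [mul_comm, Pi.single_apply] using this

namespace IsCoordChange

variable {G G' : Fin n → Fin n → Euc n → ℝ} {X X' : Fin n → Euc n → ℝ}

open Matrix in
theorem metric_eq_matrix (h : IsCoordChange V' V τ σ G' G X' X) {y : Euc n} (hy : y ∈ V') :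
    (of fun a b => G' a b y)
      = (of fun i a => jac τ i a y)ᵀ * (of fun i j => G i j (τ y)) * of fun i a => jac τ i a y := by
  ext a b
  simp only [mul_apply, of_apply, transpose_apply, h.metric_eq y hy, Finset.sum_mul]
  rw [Finset.sum_comm]
  exact Finset.sum_congr rfl fun i _ => Finset.sum_congr rfl fun j _ => by ring

open Matrix in
theorem inv_metric_eq (h : IsCoordChange V' V τ σ G' G X' X) {y : Euc n} (hy : y ∈ V') :
    (of fun a b => G' a b y)⁻¹ = (of fun a i => jac σ a i (τ y)) * (of fun i j => G i j (τ y))⁻¹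
      * (of fun a i => jac σ a i (τ y))ᵀ := by
  have hSJ := h.diffeo.jac_mul_jac hy
  have hJS := mul_eq_one_comm.1 hSJ
  have hg := mul_nonsing_inv (of fun i j => G i j (τ y))
    (isUnit_iff_ne_zero.2 (h.metric.det_ne _ (h.diffeo.mapsTo y hy)))
  have hT := congrArg transpose hSJ
  rw [transpose_mul, transpose_one] at hT
  refine inv_eq_right_inv ?_
  rw [h.metric_eq_matrix hy]
  simp only [Matrix.mul_assoc]
  rw [← Matrix.mul_assoc (of fun i a => jac τ i a y) (of fun a i => jac σ a i (τ y)), hJS,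
    Matrix.one_mul, ← Matrix.mul_assoc (of fun i j => G i j (τ y)), hg, Matrix.one_mul, hT]

open Matrix in
-- Tensoriality of ∇X solved for the new components; the Jacobian of σ at τ y is the inverse of J.
theorem nablaVec_mul (h : IsCoordChange V' V τ σ G' G X' X) :
    ∀ᵐ y ∂volume.restrict V', (of fun a i => nablaVec V' G' X' a i y)
      = (of fun i a => jac τ i a y)ᵀ * (of fun a i => nablaVec V G X a i (τ y))
        * (of fun a i => jac σ a i (τ y))ᵀ := by
  filter_upwards [h.sum_mul_nablaVec, ae_restrict_mem V'.isOpen.measurableSet] with y h1 hy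
  have hT := congrArg transpose (h.diffeo.jac_mul_jac hy)
  rw [transpose_mul, transpose_one] at hT
  have h2 : (of fun a i => nablaVec V' G' X' a i y) * (of fun i a => jac τ i a y)ᵀ
      = (of fun i a => jac τ i a y)ᵀ * (of fun a i => nablaVec V G X a i (τ y)) := by
    ext a i
    simp only [mul_apply, of_apply, transpose_apply, ← h1, mul_comm]
  rw [← h2, Matrix.mul_assoc, hT, Matrix.mul_one]

open Matrix in
theorem trNabla_eq (h : IsCoordChange V' V τ σ G' G X' X) :
    ∀ᵐ y ∂volume.restrict V', trNabla V' G' X' y = trNabla V G X (τ y) := by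
  filter_upwards [h.nablaVec_mul, ae_restrict_mem V'.isOpen.measurableSet] with y hA hy
  have hT := congrArg transpose (mul_eq_one_comm.1 (h.diffeo.jac_mul_jac hy))
  rw [transpose_mul, transpose_one] at hT
  rw [trNabla_eq_trace, trNabla_eq_trace, hA, trace_mul_cycle, hT, Matrix.one_mul]

open Matrix in
theorem ricciDensity_eq (h : IsCoordChange V' V τ σ G' G X' X) :
    ∀ᵐ y ∂volume.restrict V', ricciDensity V' G' X' y = ricciDensity V G X (τ y) := by
  filter_upwards [h.nablaVec_mul, h.trNabla_eq, ae_restrict_mem V'.isOpen.measurableSet]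
    with y hA ht hy
  have hT := congrArg transpose (mul_eq_one_comm.1 (h.diffeo.jac_mul_jac hy))
  rw [transpose_mul, transpose_one] at hT
  rw [ricciDensity_eq_trace, ricciDensity_eq_trace, hA, ht, trace_mul_comm]
  congr 1
  simp only [Matrix.mul_assoc]
  rw [trace_mul_comm]
  simp only [Matrix.mul_assoc]
  rw [hT, Matrix.mul_one, ← Matrix.mul_assoc _ᵀ, hT, Matrix.one_mul]

open Matrix in
theorem normSqNabla_eq (h : IsCoordChange V' V τ σ G' G X' X) :
    ∀ᵐ y ∂volume.restrict V', normSqNabla V' G' X' y = normSqNabla V G X (τ y) := by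
  filter_upwards [h.nablaVec_mul, ae_restrict_mem V'.isOpen.measurableSet] with y hA hy
  have hSJ := h.diffeo.jac_mul_jac hy
  have hJS := mul_eq_one_comm.1 hSJ
  have hT := congrArg transpose hSJ
  have hT' := congrArg transpose hJS
  rw [transpose_mul, transpose_one] at hT hT'
  rw [normSqNabla_eq_trace h.metric' _ hy, normSqNabla_eq_trace h.metric _ (h.diffeo.mapsTo y hy),
    hA, h.inv_metric_eq hy, h.metric_eq_matrix hy]
  -- From here the claim is an identity for abstract matrices with J S = 1; the trace is cyclic and
  -- all Jacobians cancel in pairs.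
  generalize (of fun a i => jac σ a i (τ y)) = S at *
  generalize (of fun i a => jac τ i a y) = J at *
  generalize (of fun i j => G i j (τ y)) = g at *
  generalize (of fun a i => nablaVec V G X a i (τ y)) = A at *
  have e : S * g⁻¹ * Sᵀ * (Jᵀ * A * Sᵀ) * (Jᵀ * g * J) * (Jᵀ * A * Sᵀ)ᵀ
      = S * (g⁻¹ * (Sᵀ * Jᵀ) * A * (Sᵀ * Jᵀ) * g * (J * S) * Aᵀ) * J := by
    simp only [transpose_mul, transpose_transpose, Matrix.mul_assoc]
  rw [e, hT', hJS, trace_mul_cycle, hJS]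
  simp only [Matrix.one_mul, Matrix.mul_one]

open Matrix in
theorem sum_mul_gradHalfSq (h : IsCoordChange V' V τ σ G' G X' X) :
    ∀ᵐ y ∂volume.restrict V', ∀ i,
      ∑ a, jac τ i a y * gradHalfSq V' G' X' a y = gradHalfSq V G X i (τ y) := by
  filter_upwards [h.nablaVec_mul, ae_restrict_mem V'.isOpen.measurableSet] with y hA hy i
  have hSJ := h.diffeo.jac_mul_jac hy
  have hJS := mul_eq_one_comm.1 hSJ
  have hT' := congrArg transpose hJS
  rw [transpose_mul, transpose_one] at hT'
  have hx : (fun c => X c (τ y)) = (of fun i a => jac τ i a y) *ᵥ fun c => X' c y := by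
    ext c; simp only [h.vec_eq y hy, mulVec, dotProduct, of_apply]
  have e : ∑ a, jac τ i a y * gradHalfSq V' G' X' a y
      = ((of fun i a => jac τ i a y) *ᵥ fun a => gradHalfSq V' G' X' a y) i := by
    simp only [mulVec, dotProduct, of_apply]
  rw [e]
  simp only [gradHalfSq_eq_mulVec]
  rw [hA, h.inv_metric_eq hy, h.metric_eq_matrix hy, hx]
  generalize (of fun a i => jac σ a i (τ y)) = S at *
  generalize (of fun i a => jac τ i a y) = J at *
  generalize (of fun i j => G i j (τ y)) = g at *
  generalize (of fun a i => nablaVec V G X a i (τ y)) = A at *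
  have e : J *ᵥ (S * g⁻¹ * Sᵀ) *ᵥ (Jᵀ * A * Sᵀ) *ᵥ (Jᵀ * g * J)ᵀ *ᵥ (fun c => X' c y)
      = ((J * S) * g⁻¹ * (Sᵀ * Jᵀ) * A * (Sᵀ * Jᵀ) * gᵀ) *ᵥ J *ᵥ (fun c => X' c y) := by
    simp only [mulVec_mulVec, transpose_mul, transpose_transpose, Matrix.mul_assoc]
  change (J *ᵥ (S * g⁻¹ * Sᵀ) *ᵥ (Jᵀ * A * Sᵀ) *ᵥ (Jᵀ * g * J)ᵀ *ᵥ (fun c => X' c y)) i = _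
  rw [e, hT', hJS]
  simp only [Matrix.one_mul, Matrix.mul_one, mulVec_mulVec, Matrix.mul_assoc]

theorem sum_mul_ricciFlux (h : IsCoordChange V' V τ σ G' G X' X) :
    ∀ᵐ y ∂volume.restrict V', ∀ i,
      ∑ a, jac τ i a y * ricciFlux V' G' X' a y = ricciFlux V G X i (τ y) := by
  filter_upwards [h.sum_mul_nablaVec, h.trNabla_eq, ae_restrict_mem V'.isOpen.measurableSet]
    with y hA ht hy i
  simp only [ricciFlux, mul_sub, Finset.sum_sub_distrib, h.vec_eq y hy, ht]
  congr 1
  · simp only [Finset.mul_sum, Finset.sum_mul]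
    rw [Finset.sum_comm]
    have : ∀ b, ∑ a, jac τ i a y * (X' b y * nablaVec V' G' X' b a y)
        = X' b y * ∑ a, jac τ i a y * nablaVec V' G' X' b a y := fun b => by
      rw [Finset.mul_sum]; exact Finset.sum_congr rfl fun a _ => by ring
    simp only [this, hA, Finset.mul_sum]
    rw [Finset.sum_comm]
    exact Finset.sum_congr rfl fun b _ => Finset.sum_congr rfl fun a _ => by ring
  · rw [Finset.mul_sum]
    exact Finset.sum_congr rfl fun a _ => by ring

/-- The transformation law of the traces of the Christoffel symbols. -/
theorem christoffelTrace_eq (h : IsCoordChange V' V τ σ G' G X' X) :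
    ∀ᵐ y ∂volume.restrict V', ∀ a, christoffelTrace V' G' a y
      = ∑ i, ∑ b, hess τ i a b y * jac σ b i (τ y)
        + ∑ j, christoffelTrace V G j (τ y) * jac τ j a y := by
  filter_upwards [h.sum_mul_christoffel, ae_restrict_mem V'.isOpen.measurableSet] with y h1 hy a
  have hSJ := h.diffeo.jac_mul_jac hy
  have hJS := mul_eq_one_comm.1 hSJ
  have hsj : ∀ d c, ∑ k, jac σ d k (τ y) * jac τ k c y = if d = c then 1 else 0 := fun d c => by
    simpa [Matrix.mul_apply, Matrix.one_apply] using congrFun (congrFun hSJ d) c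
  have hjs : ∀ i k, ∑ d, jac τ i d y * jac σ d k (τ y) = if i = k then 1 else 0 := fun d c => by
    simpa [Matrix.mul_apply, Matrix.one_apply] using congrFun (congrFun hJS d) c
  -- The law for Γ is solved for Γ' with the inverse Jacobian before taking the trace.
  have e1 : ∀ d, christoffel V' G' d d a y = ∑ k, jac σ d k (τ y) * (hess τ k a d y
        + ∑ i, ∑ j, christoffel V G k i j (τ y) * jac τ i d y * jac τ j a y) := fun d => by
    simp only [h.diffeo.hess_symm hy _ a d, ← h1, Finset.mul_sum, ← mul_assoc]
    rw [Finset.sum_comm]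
    simp only [← Finset.sum_mul, hsj]
    simp
  simp only [christoffelTrace, e1, mul_add, Finset.sum_add_distrib]
  congr 1
  · rw [Finset.sum_comm]
    exact Finset.sum_congr rfl fun i _ => Finset.sum_congr rfl fun b _ => mul_comm _ _
  · have e2 : ∀ j, (∑ k, christoffel V G k k j (τ y)) * jac τ j a y
        = ∑ k, ∑ i, christoffel V G k i j (τ y) * jac τ j a y * ∑ d, jac τ i d y * jac σ d k (τ y) := by
      intro j
      simp [hjs, Finset.sum_mul]
    simp only [e2, Finset.mul_sum]
    rw [Finset.sum_comm]
    conv_rhs => rw [Finset.sum_comm]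
    refine Finset.sum_congr rfl fun k _ => ?_
    rw [Finset.sum_comm]
    conv_rhs => rw [Finset.sum_comm]
    refine Finset.sum_congr rfl fun i _ => ?_
    rw [Finset.sum_comm]
    exact Finset.sum_congr rfl fun j _ => Finset.sum_congr rfl fun d _ => by ring

end IsCoordChange

end Invariance

end LowReg

/-! ### Invariance of the divergence -/

namespace LowReg

section DivergenceInvariance

variable {n : ℕ} {V V' : Opens (Euc n)} {τ σ : Euc n → Euc n}

namespace IsDiffeo

/-- The relation between φ and φ' inverts `pushDensity`, because the Jacobians of τ and σ are
reciprocal. The Piola identity for φ' thereby becomes a statement about φ. -/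
theorem pushDensity_eq (h : IsDiffeo V' V τ σ) {φ φ' : Euc n → ℝ} (h3 : tsupport φ ⊆ V)
    (he : ∀ y ∈ V', φ' y = φ (τ y) * |(fderiv ℝ τ y).det|) : pushDensity V σ φ' = φ := by
  ext x
  by_cases hx : x ∈ V
  · have hs := h.mapsTo_symm x hx
    have hd := h.det_mul hs
    rw [h.right_inv x hx] at hd
    rw [pushDensity, indicator_of_mem (s := (V : Set (Euc n))) hx, he _ hs, h.right_inv x hx,
      mul_assoc, ← abs_mul, mul_comm (fderiv ℝ τ _).det, hd, abs_one, mul_one]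
  · rw [pushDensity, indicator_of_notMem hx, image_eq_zero_of_notMem_tsupport fun hs => hx (h3 hs)]

/-- The derivative of the density `φ' = (φ ∘ τ) |det Dτ|`; the last term is the logarithmic
derivative of the Jacobian determinant. -/
theorem sum_jac_mul_fderiv (h : IsDiffeo V' V τ σ) {φ φ' : Euc n → ℝ} (h0 : ContDiff ℝ ∞ φ)
    (h0' : tsupport φ ⊆ V) (h1 : ContDiff ℝ ∞ φ') (h2 : HasCompactSupport φ')
    (h3 : tsupport φ' ⊆ V') (he : ∀ y ∈ V', φ' y = φ (τ y) * |(fderiv ℝ τ y).det|)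
    {y : Euc n} (hy : y ∈ V') (a : Fin n) :
    (∑ i, jac τ i a y * fderiv ℝ φ (τ y) (unitVec i)) * |(fderiv ℝ τ y).det|
      = fderiv ℝ φ' y (unitVec a) - φ' y * ∑ i, ∑ b, hess τ i a b y * jac σ b i (τ y) := by
  have hτ := h.mapsTo y hy
  -- The Piola identity is evaluated at τ y. Expanding its right side by the product rule produces
  -- the logarithmic derivative of the Jacobian without differentiating a determinant.
  have hp := congrFun (h.pushDensity_fderiv h1 h2 h3 a) (τ y)
  rw [pushDensity, indicator_of_mem (s := (V : Set (Euc n))) hτ, h.left_inv y hy] at hp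
  have e : ∀ i, fderiv ℝ (pushDensity V σ fun y => φ' y * jac τ i a y) (τ y) (unitVec i)
      = jac τ i a y * fderiv ℝ φ (τ y) (unitVec i)
        + φ (τ y) * ∑ b, hess τ i a b y * jac σ b i (τ y) := by
    intro i
    -- Near τ y the transported density is φ times the smooth function ∂ₐτ^i ∘ σ.
    have hev : (pushDensity V σ fun y => φ' y * jac τ i a y) =ᶠ[nhds (τ y)]
        fun x => φ x * jac τ i a (σ x) := by
      filter_upwards [V.isOpen.mem_nhds hτ] with x hx
      rw [← h.pushDensity_eq h0' he, pushDensity, pushDensity,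
        indicator_of_mem (s := (V : Set (Euc n))) hx, indicator_of_mem (s := (V : Set (Euc n))) hx]
      ring
    have hj : DifferentiableAt ℝ (jac τ i a) (σ (τ y)) := by
      rw [h.left_inv y hy]
      exact ((contDiffOn_jac h.contDiffOn i a).contDiffAt (V'.isOpen.mem_nhds hy)).differentiableAt
        (by simp)
    have hd : HasFDerivAt (fun x => jac τ i a (σ x))
        ((fderiv ℝ (jac τ i a) (σ (τ y))).comp (fderiv ℝ σ (τ y))) (τ y) :=
      hj.hasFDerivAt.comp (τ y) (h.symm.differentiableAt hτ).hasFDerivAt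
    have hm := (h0.differentiable (by simp) (τ y)).hasFDerivAt.mul hd
    rw [hev.fderiv_eq, (hm.congr_of_eventuallyEq (f₁ := fun x => φ x * jac τ i a (σ x))
      (Filter.Eventually.of_forall fun x => rfl)).fderiv, h.left_inv y hy]
    simp only [add_apply, smul_apply, smul_eq_mul,
      ContinuousLinearMap.comp_apply]
    rw [fderiv_apply_eq_sum (fderiv ℝ (jac τ i a) y), add_comm]
    congr 2
    refine Finset.sum_congr rfl fun b _ => ?_
    rw [h.hess_symm hy i a b, smul_eq_mul, mul_comm]
    rfl
  simp only [e, Finset.sum_add_distrib, ← Finset.mul_sum] at hp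
  have hd : |(fderiv ℝ σ (τ y)).det| * |(fderiv ℝ τ y).det| = 1 := by
    rw [← abs_mul, h.det_mul hy, abs_one]
  rw [he y hy]
  linear_combination (-|(fderiv ℝ τ y).det|) * hp + fderiv ℝ φ' y (unitVec a) * hd

end IsDiffeo

/-- The divergence of a vector field is invariant under changes of coordinates. -/
theorem IsCoordChange.setIntegral_div_eq {G G' : Fin n → Fin n → Euc n → ℝ}
    {X X' : Fin n → Euc n → ℝ} (h : IsCoordChange V' V τ σ G' G X' X) {F F' : Fin n → Euc n → ℝ}
    (hF : ∀ᵐ y ∂volume.restrict V', ∀ i, ∑ a, jac τ i a y * F' a y = F i (τ y))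
    {φ φ' : Euc n → ℝ} (h0 : ContDiff ℝ ∞ φ)
    (h0' : tsupport φ ⊆ V) (h1 : ContDiff ℝ ∞ φ') (h2 : HasCompactSupport φ')
    (h3 : tsupport φ' ⊆ V') (he : ∀ y ∈ V', φ' y = φ (τ y) * |(fderiv ℝ τ y).det|) :
    ∫ x in (V : Set (Euc n)), ((∑ a, christoffelTrace V G a x * F a x) * φ x
        - ∑ a, F a x * fderiv ℝ φ x (unitVec a))
      = ∫ y in (V' : Set (Euc n)), ((∑ a, christoffelTrace V' G' a y * F' a y) * φ' y
        - ∑ a, F' a y * fderiv ℝ φ' y (unitVec a)) := by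
  rw [h.diffeo.setIntegral_eq]
  refine integral_congr_ae ?_
  filter_upwards [hF, h.christoffelTrace_eq, ae_restrict_mem V'.isOpen.measurableSet] with y hF hγ hy
  have e1 : (∑ i, F i (τ y) * fderiv ℝ φ (τ y) (unitVec i)) * |(fderiv ℝ τ y).det|
      = ∑ a, F' a y * (fderiv ℝ φ' y (unitVec a)
        - φ' y * ∑ i, ∑ b, hess τ i a b y * jac σ b i (τ y)) := by
    simp only [← h.diffeo.sum_jac_mul_fderiv h0 h0' h1 h2 h3 he hy]
    simp only [← hF, Finset.mul_sum, Finset.sum_mul]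
    rw [Finset.sum_comm]
    exact Finset.sum_congr rfl fun a _ => Finset.sum_congr rfl fun i _ => by ring
  have e2 : ∑ a, christoffelTrace V G a (τ y) * F a (τ y)
      = ∑ a, (∑ j, christoffelTrace V G j (τ y) * jac τ j a y) * F' a y := by
    simp only [← hF, Finset.mul_sum, Finset.sum_mul]
    rw [Finset.sum_comm]
    exact Finset.sum_congr rfl fun a _ => Finset.sum_congr rfl fun i _ => by ring
  rw [sub_mul, e1, mul_assoc, ← he y hy, e2]
  -- The second derivatives of τ in the law for the contracted symbols are exactly those arising
  -- from the derivative of the density φ'.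
  simp only [hγ, mul_sub, add_mul, Finset.sum_sub_distrib, Finset.sum_add_distrib]
  have e3 : ∑ a, F' a y * (φ' y * ∑ i, ∑ b, hess τ i a b y * jac σ b i (τ y))
      = (∑ a, (∑ i, ∑ b, hess τ i a b y * jac σ b i (τ y)) * F' a y) * φ' y := by
    rw [Finset.sum_mul]
    exact Finset.sum_congr rfl fun a _ => by ring
  rw [e3]; ring

end DivergenceInvariance

/-! ### Restriction to smaller open sets -/

section Restriction

variable {n : ℕ} {V Ω : Opens (Euc n)} {G : Fin n → Fin n → Euc n → ℝ} {X : Fin n → Euc n → ℝ}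

theorem MemWFin.mono {f : Euc n → ℝ} (hf : MemWFin Ω f) (hV : V ≤ Ω) : MemWFin V f :=
  .of_isWeakDeriv (hf.memLFin.mono hV) (fun i => (hf.weakDeriv i).mono hV) fun i =>
    (hf.isWeakDeriv i).mono hV

/-- Weak derivatives are chosen separately on each open set, so agreement on the smaller one is a
matter of uniqueness and holds almost everywhere. -/
theorem MemWFin.weakDeriv_restrict {f : Euc n → ℝ} (hf : MemWFin Ω f) (hV : V ≤ Ω) (i : Fin n) :
    LowReg.weakDeriv V i f =ᵐ[volume.restrict V] LowReg.weakDeriv Ω i f :=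
  (hf.mono hV).weakDeriv_ae_eq ((hf.weakDeriv i).mono hV) ((hf.isWeakDeriv i).mono hV)

theorem IsLipMetric.mono (hG : IsLipMetric Ω G) (hV : V ≤ Ω) : IsLipMetric V G :=
  ⟨fun i j => (hG.lip i j).mono hV, fun y hy => hG.symm y (hV hy), fun y hy => hG.det_ne y (hV hy)⟩

theorem IsLipMetric.christoffel_restrict (hG : IsLipMetric Ω G) (hV : V ≤ Ω) :
    ∀ᵐ y ∂volume.restrict V, ∀ k i j, christoffel V G k i j y = christoffel Ω G k i j y := by
  have : ∀ᵐ y ∂volume.restrict V, ∀ k i j, weakDeriv V k (G i j) y = weakDeriv Ω k (G i j) y :=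
    ae_all_iff.2 fun k => ae_all_iff.2 fun i => ae_all_iff.2 fun j =>
      (hG.memWFin i j).weakDeriv_restrict hV k
  filter_upwards [this] with y hy k i j
  simp only [christoffel, hy]

theorem IsLipMetric.nablaVec_restrict (hG : IsLipMetric Ω G) (hX : ∀ i, MemWFin Ω (X i))
    (hV : V ≤ Ω) :
    ∀ᵐ y ∂volume.restrict V, ∀ a i, nablaVec V G X a i y = nablaVec Ω G X a i y := by
  have : ∀ᵐ y ∂volume.restrict V, ∀ a i, weakDeriv V a (X i) y = weakDeriv Ω a (X i) y :=
    ae_all_iff.2 fun a => ae_all_iff.2 fun i => (hX i).weakDeriv_restrict hV a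
  filter_upwards [this, hG.christoffel_restrict hV] with y h1 h2 a i
  simp only [nablaVec, h1, h2]

theorem setIntegral_eq_ofFun_apply {f f' : Euc n → ℝ} (hf : MemLFin Ω f)
    (hff : f' =ᵐ[volume.restrict V] f) {φ : 𝓓(Ω, ℝ)} (hφ : tsupport φ ⊆ V) :
    ofFun Ω f φ = ∫ x in (V : Set (Euc n)), f' x * φ x := by
  rw [ofFun_apply hf.locallyIntegrableOn, ← setIntegral_eq_integral_of_forall_compl_eq_zero
    (s := (V : Set (Euc n))) fun x hx => by
      rw [image_eq_zero_of_notMem_tsupport fun hs => hx (hφ hs), mul_zero]]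
  refine integral_congr_ae ?_
  filter_upwards [hff] with x hx
  rw [hx]

theorem IsLipMetric.divVec_apply_eq_setIntegral (hG : IsLipMetric Ω G) (hV : V ≤ Ω)
    {F F' : Fin n → Euc n → ℝ} (hF : ∀ a, MemLFin Ω (F a))
    (hFF : ∀ᵐ x ∂volume.restrict V, ∀ a, F' a x = F a x) {φ : 𝓓(Ω, ℝ)} (hφ : tsupport φ ⊆ V) :
    divVec G F φ = ∫ x in (V : Set (Euc n)), ((∑ a, christoffelTrace V G a x * F' a x) * φ x
        - ∑ a, F' a x * fderiv ℝ φ x (unitVec a)) := by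
  have hz : ∀ x ∉ V, φ x = 0 := fun x hx => image_eq_zero_of_notMem_tsupport fun hs => hx (hφ hs)
  have hz' : ∀ a, ∀ x ∉ V, fderiv ℝ φ x (unitVec a) = 0 := fun a x hx =>
    image_eq_zero_of_notMem_tsupport (f := fun x => fderiv ℝ φ x (unitVec a)) fun hs =>
      hx (hφ (tsupport_fderiv_apply_subset' φ _ hs))
  have hi : Integrable fun x => (∑ a, christoffelTrace Ω G a x * F a x) * φ x :=
    integrable_mul_test (hG.memLFin_trace_mul hF).locallyIntegrableOn φ.contDiff.continuous
      φ.hasCompactSupport φ.tsupport_subset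
  have hi' : ∀ a, Integrable fun x => F a x * fderiv ℝ φ x (unitVec a) := fun a =>
    integrable_mul_test (hF a).locallyIntegrableOn (contDiff_fderiv_apply φ.contDiff _).continuous
      (φ.hasCompactSupport.fderiv_apply ℝ _)
      ((tsupport_fderiv_apply_subset' φ _).trans φ.tsupport_subset)
  rw [divVec, divForm_apply (hG.memLFin_trace_mul hF).locallyIntegrableOn
      fun a => (hF a).locallyIntegrableOn,
    ← integral_finsetSum _ fun a _ => hi' a, ← integral_sub hi (integrable_finsetSum _ fun a _ => hi' a),
    ← setIntegral_eq_integral_of_forall_compl_eq_zero (s := (V : Set (Euc n))) fun x hx => by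
      simp only [hz x hx, hz' _ x hx, mul_zero, Finset.sum_const_zero, sub_zero]]
  refine integral_congr_ae ?_
  filter_upwards [hFF, hG.christoffel_restrict hV] with x h1 h2
  simp only [h1, christoffelTrace, h2]

end Restriction

end LowReg

/-! ### Compatibility between charts for test functions on an overlap -/

namespace LowReg

section LocalInvariance

variable {n : ℕ} {V V' Ω Ω' : Opens (Euc n)} {τ σ : Euc n → Euc n}
  {G G' : Fin n → Fin n → Euc n → ℝ} {X X' : Fin n → Euc n → ℝ}

/-- `G, X` on `Ω` and `G', X'` on `Ω'` are the components of a metric and a vector field in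
coordinates that are related by `τ` on `V' ⊆ Ω'` and `V ⊆ Ω`. -/
structure IsTransition (Ω' Ω V' V : Opens (Euc n)) (τ σ : Euc n → Euc n)
    (G' G : Fin n → Fin n → Euc n → ℝ) (X' X : Fin n → Euc n → ℝ) : Prop where
  metric' : IsLipMetric Ω' G'
  metric : IsLipMetric Ω G
  vec' : ∀ i, MemWFin Ω' (X' i)
  vec : ∀ i, MemWFin Ω (X i)
  le' : V' ≤ Ω'
  le : V ≤ Ω
  diffeo : IsDiffeo V' V τ σ
  metric_eq : ∀ y ∈ V', ∀ a b, G' a b y = ∑ i, ∑ j, jac τ i a y * jac τ j b y * G i j (τ y)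
  vec_eq : ∀ y ∈ V', ∀ i, X i (τ y) = ∑ a, jac τ i a y * X' a y

namespace IsTransition

theorem isCoordChange (h : IsTransition Ω' Ω V' V τ σ G' G X' X) :
    IsCoordChange V' V τ σ G' G X' X :=
  ⟨h.diffeo, h.metric'.mono h.le', h.metric.mono h.le, fun i => (h.vec' i).mono h.le',
    fun i => (h.vec i).mono h.le, h.metric_eq, h.vec_eq⟩

/-- Here `fV` and `fV'` are the versions built from weak derivatives on the overlap, for which the
change of coordinates is known; `f` and `f'` are those of the full chart domains. -/
theorem ofFun_apply_eq (h : IsTransition Ω' Ω V' V τ σ G' G X' X) {f f' fV fV' : Euc n → ℝ}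
    (hf : MemLFin Ω f) (hf' : MemLFin Ω' f') (e : fV =ᵐ[volume.restrict V] f)
    (e' : fV' =ᵐ[volume.restrict V'] f') (hff : ∀ᵐ y ∂volume.restrict V', fV' y = fV (τ y))
    {φ : 𝓓(Ω, ℝ)} {φ' : 𝓓(Ω', ℝ)} (hφ : tsupport φ ⊆ V) (hφ' : tsupport φ' ⊆ V')
    (he : ∀ y ∈ V', φ' y = φ (τ y) * |(fderiv ℝ τ y).det|) :
    ofFun Ω f φ = ofFun Ω' f' φ' := by
  rw [setIntegral_eq_ofFun_apply hf e hφ, setIntegral_eq_ofFun_apply hf' e' hφ',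
    h.diffeo.setIntegral_eq]
  refine integral_congr_ae ?_
  filter_upwards [hff, ae_restrict_mem V'.isOpen.measurableSet] with y h1 hy
  rw [h1, he y hy, mul_assoc]

theorem divVec_apply_eq (h : IsTransition Ω' Ω V' V τ σ G' G X' X) {F F' FV FV' : Fin n → Euc n → ℝ}
    (hF : ∀ a, MemLFin Ω (F a)) (hF' : ∀ a, MemLFin Ω' (F' a))
    (e : ∀ᵐ x ∂volume.restrict V, ∀ a, FV a x = F a x)
    (e' : ∀ᵐ x ∂volume.restrict V', ∀ a, FV' a x = F' a x)
    (hFF : ∀ᵐ y ∂volume.restrict V', ∀ i, ∑ a, jac τ i a y * FV' a y = FV i (τ y))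
    {φ : 𝓓(Ω, ℝ)} {φ' : 𝓓(Ω', ℝ)} (hφ : tsupport φ ⊆ V) (hφ' : tsupport φ' ⊆ V')
    (he : ∀ y ∈ V', φ' y = φ (τ y) * |(fderiv ℝ τ y).det|) :
    divVec G F φ = divVec G' F' φ' := by
  rw [h.metric.divVec_apply_eq_setIntegral h.le hF e hφ,
    h.metric'.divVec_apply_eq_setIntegral h.le' hF' e' hφ',
    h.isCoordChange.setIntegral_div_eq hFF φ.contDiff hφ φ'.contDiff φ'.hasCompactSupport hφ' he]

variable (h : IsTransition Ω' Ω V' V τ σ G' G X' X) {φ : 𝓓(Ω, ℝ)} {φ' : 𝓓(Ω', ℝ)}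
  (hφ : tsupport φ ⊆ V) (hφ' : tsupport φ' ⊆ V')
  (he : ∀ y ∈ V', φ' y = φ (τ y) * |(fderiv ℝ τ y).det|)

include h hφ hφ' he

theorem ofFun_normSqNabla_apply_eq :
    ofFun Ω (normSqNabla Ω G X) φ = ofFun Ω' (normSqNabla Ω' G' X') φ' := by
  refine h.ofFun_apply_eq (memLFin_normSqNabla h.metric h.vec) (memLFin_normSqNabla h.metric' h.vec')
    ?_ ?_ h.isCoordChange.normSqNabla_eq hφ hφ' he
  · filter_upwards [h.metric.nablaVec_restrict h.vec h.le] with y hy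
    simp only [normSqNabla, hy]
  · filter_upwards [h.metric'.nablaVec_restrict h.vec' h.le'] with y hy
    simp only [normSqNabla, hy]

theorem ofFun_ricciDensity_apply_eq :
    ofFun Ω (ricciDensity Ω G X) φ = ofFun Ω' (ricciDensity Ω' G' X') φ' := by
  refine h.ofFun_apply_eq (memLFin_ricciDensity h.metric h.vec)
    (memLFin_ricciDensity h.metric' h.vec') ?_ ?_ h.isCoordChange.ricciDensity_eq hφ hφ' he
  · filter_upwards [h.metric.nablaVec_restrict h.vec h.le] with y hy
    simp only [ricciDensity, trNabla, hy]
  · filter_upwards [h.metric'.nablaVec_restrict h.vec' h.le'] with y hy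
    simp only [ricciDensity, trNabla, hy]

theorem divVec_gradHalfSq_apply_eq :
    divVec G (gradHalfSq Ω G X) φ = divVec G' (gradHalfSq Ω' G' X') φ' := by
  refine h.divVec_apply_eq (memLFin_gradHalfSq h.metric h.vec) (memLFin_gradHalfSq h.metric' h.vec')
    ?_ ?_ h.isCoordChange.sum_mul_gradHalfSq hφ hφ' he
  · filter_upwards [h.metric.nablaVec_restrict h.vec h.le] with y hy a
    simp only [gradHalfSq, hy]
  · filter_upwards [h.metric'.nablaVec_restrict h.vec' h.le'] with y hy a
    simp only [gradHalfSq, hy]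

theorem divVec_ricciFlux_apply_eq :
    divVec G (ricciFlux Ω G X) φ = divVec G' (ricciFlux Ω' G' X') φ' := by
  refine h.divVec_apply_eq (memLFin_ricciFlux h.metric h.vec) (memLFin_ricciFlux h.metric' h.vec')
    ?_ ?_ h.isCoordChange.sum_mul_ricciFlux hφ hφ' he
  · filter_upwards [h.metric.nablaVec_restrict h.vec h.le] with y hy a
    simp only [ricciFlux, trNabla, hy]
  · filter_upwards [h.metric'.nablaVec_restrict h.vec' h.le'] with y hy a
    simp only [ricciFlux, trNabla, hy]

end IsTransition

end LocalInvariance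

/-! ### Membership in W^{-1,1+1/n}_loc -/

section NegativeOrder

variable {n : ℕ} {Ω : Opens (Euc n)}

theorem MemLFin.memLp_mul_test {f φ : Euc n → ℝ} (hf : MemLFin Ω f) {q : ℝ≥0∞} (h1 : 1 ≤ q)
    (h2 : q < ⊤) (hφ : Continuous φ) (hc : HasCompactSupport φ) (hs : tsupport φ ⊆ Ω) :
    MemLp (fun x => φ x * f x) q := by
  have hK := hf q h1 h2 (tsupport φ) hc hs
  obtain ⟨C, hC⟩ := hφ.bounded_above_of_compact_support hc
  have h3 : MemLp (fun x => φ x * f x) q (volume.restrict (tsupport φ)) := by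
    refine MemLp.of_le_mul (c := C) hK (hφ.aestronglyMeasurable.mul hK.1) ?_
    refine Filter.Eventually.of_forall fun x => ?_
    rw [norm_mul]
    exact mul_le_mul_of_nonneg_right (hC x) (norm_nonneg _)
  have h4 : (tsupport φ).indicator (fun x => φ x * f x) = fun x => φ x * f x := by
    refine indicator_eq_self.2 fun x hx => ?_
    by_contra hs
    exact hx (by simp only [image_eq_zero_of_notMem_tsupport hs, zero_mul])
  rw [← h4]
  exact (memLp_indicator_iff_restrict hc.isClosed.measurableSet).2 h3

/-- The Leibniz rule φ ∂ᵢ fᵢ = ∂ᵢ(φ fᵢ) - (∂ᵢφ) fᵢ; multiplication by φ or ∂ᵢφ turns local into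
global integrability. -/
theorem HasDivForm.memWNegOneLoc [NeZero n] {T : 𝓓'(Ω, ℝ)} (hT : HasDivForm T) :
    MemWNegOneLoc (expo n) T := by
  obtain ⟨f₀, f, hf₀, hf, rfl⟩ := hT
  intro φ
  have hm : ∀ (ψ : Euc n → ℝ) (u : Euc n → ℝ), MemLFin Ω u → Continuous ψ → HasCompactSupport ψ →
      tsupport ψ ⊆ Ω → MemLp (fun x => ψ x * u x) (expo n) := fun ψ u hu h1 h2 h3 =>
    hu.memLp_mul_test one_le_expo expo_lt_top h1 h2 h3
  have hφ := φ.contDiff.continuous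
  have hd := fun i : Fin n => (contDiff_fderiv_apply φ.contDiff (unitVec i)).continuous
  have hl : ∀ {u : Euc n → ℝ}, MemLp u (expo n) → LocallyIntegrableOn u Ω volume := fun hu =>
    (hu.locallyIntegrable one_le_expo).locallyIntegrableOn _
  have m0 : MemLp (fun x => φ x * f₀ x - ∑ i, fderiv ℝ φ x (unitVec i) * f i x) (expo n) :=
    (hm φ f₀ hf₀ hφ φ.hasCompactSupport φ.tsupport_subset).sub <| memLp_finsetSum _ fun i _ =>
      hm _ (f i) (hf i) (hd i) (φ.hasCompactSupport.fderiv_apply ℝ _)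
        ((tsupport_fderiv_apply_subset' φ _).trans φ.tsupport_subset)
  have m1 := fun i => hm φ (f i) (hf i) hφ φ.hasCompactSupport φ.tsupport_subset
  refine ⟨_, _, m0.restrict Ω, fun i => (m1 i).restrict Ω, fun ψ => ?_⟩
  change _ = divForm Ω _ _ ψ
  rw [divForm_apply (hl m0) (fun i => hl (m1 i)), divForm_apply hf₀.locallyIntegrableOn
    fun i => (hf i).locallyIntegrableOn]
  have hψ := ψ.contDiff.continuous
  have i1 : ∀ {u ρ : Euc n → ℝ}, MemLFin Ω u → Continuous ρ → HasCompactSupport ρ →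
      tsupport ρ ⊆ Ω → Integrable fun x => u x * ρ x := fun hu h1 h2 h3 =>
    integrable_mul_test hu.locallyIntegrableOn h1 h2 h3
  have j1 : ∀ i, Integrable fun x => f i x * (fderiv ℝ φ x (unitVec i) * ψ x) := fun i =>
    i1 (hf i) ((hd i).mul hψ) ψ.hasCompactSupport.mul_left
      ((tsupport_mul_subset_right (f := fun x => fderiv ℝ φ x (unitVec i))).trans ψ.tsupport_subset)
  have j2 : ∀ i, Integrable fun x => f i x * (φ x * fderiv ℝ ψ x (unitVec i)) := fun i =>
    i1 (hf i) (hφ.mul (contDiff_fderiv_apply ψ.contDiff _).continuous)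
      φ.hasCompactSupport.mul_right
      ((tsupport_mul_subset_left (f := φ)).trans φ.tsupport_subset)
  have j0 : Integrable fun x => f₀ x * (φ x * ψ x) :=
    i1 hf₀ (hφ.mul hψ) φ.hasCompactSupport.mul_right
      ((tsupport_mul_subset_left (f := φ)).trans φ.tsupport_subset)
  have e1 : ∀ i, ∫ x, f i x * fderiv ℝ (mulTest φ ψ) x (unitVec i)
      = (∫ x, f i x * (fderiv ℝ φ x (unitVec i) * ψ x))
        + ∫ x, φ x * f i x * fderiv ℝ ψ x (unitVec i) := fun i => by
    have : ∀ x, φ x * f i x * fderiv ℝ ψ x (unitVec i)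
      = f i x * (φ x * fderiv ℝ ψ x (unitVec i)) := fun x => by ring
    simp only [this]
    rw [← integral_add (j1 i) (j2 i)]
    congr 1
    ext x
    have hm : HasFDerivAt (mulTest φ ψ) (φ x • fderiv ℝ ψ x + ψ x • fderiv ℝ φ x) x :=
      (φ.contDiff.differentiable (by simp) x).hasFDerivAt.mul
        (ψ.contDiff.differentiable (by simp) x).hasFDerivAt
    rw [hm.fderiv]
    simp only [add_apply, smul_apply, smul_eq_mul]
    ring
  have e0 : ∫ x, (φ x * f₀ x - ∑ i, fderiv ℝ φ x (unitVec i) * f i x) * ψ x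
      = (∫ x, f₀ x * (φ x * ψ x)) - ∑ i, ∫ x, f i x * (fderiv ℝ φ x (unitVec i) * ψ x) := by
    rw [← integral_finsetSum _ fun i _ => j1 i, ← integral_sub j0 (integrable_finsetSum _ fun i _ => j1 i)]
    congr 1
    ext x
    rw [sub_mul, Finset.sum_mul]
    congr 1
    · ring
    · exact Finset.sum_congr rfl fun i _ => by ring
  rw [e0]
  simp only [e1, Finset.sum_add_distrib]
  change (∫ x, f₀ x * (φ x * ψ x)) - _ = _
  ring

end NegativeOrder

end LowReg

/-! ### Metrics and vector fields in the charts of a manifold -/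

namespace LowReg

section Charts

variable {n : ℕ} {M : Type*} [TopologicalSpace M] [ChartedSpace (Euc n) M]

/-- The metric at a point, as a bilinear form on `ℝⁿ`. -/
noncomputable def metricForm (g : Metric n M) (x : M) : Euc n →L[ℝ] Euc n →L[ℝ] ℝ := g.inner x

/-- The derivative of a chart, as a linear map on `ℝⁿ`. -/
noncomputable def Chart.deriv (e : Chart n M) (x : M) : Euc n →L[ℝ] Euc n :=
  mfderiv (𝓡 n) (𝓡 n) e.1 x

/-- The derivative of the inverse of a chart, as a linear map on `ℝⁿ`. -/
noncomputable def Chart.derivSymm (e : Chart n M) (y : Euc n) : Euc n →L[ℝ] Euc n :=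
  mfderiv (𝓡 n) (𝓡 n) e.1.symm y

theorem metricCoord_eq (g : Metric n M) (e : Chart n M) (i j : Fin n) (y : Euc n) :
    metricCoord g e i j y = metricForm g (e.1.symm y) (e.derivSymm y (unitVec i))
      (e.derivSymm y (unitVec j)) := rfl

theorem vecCoord_eq (X : ∀ x : M, TangentSpace (𝓡 n) x) (e : Chart n M) (i : Fin n) (y : Euc n) :
    vecCoord X e i y = e.deriv (e.1.symm y) (X (e.1.symm y) : Euc n) i := rfl

theorem metricForm_pos (g : Metric n M) (x : M) {v : Euc n} (hv : v ≠ 0) :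
    0 < metricForm g x v v := g.pos x v hv

theorem bilin_eq_sum (B : Euc n →L[ℝ] Euc n →L[ℝ] ℝ) (v w : Euc n) :
    B v w = ∑ i, ∑ j, v i * w j * B (unitVec i) (unitVec j) := by
  rw [fderiv_apply_eq_sum B v]
  simp only [sum_apply, smul_apply, smul_eq_mul]
  refine Finset.sum_congr rfl fun i _ => ?_
  rw [fderiv_apply_eq_sum (B (unitVec i)) w, Finset.mul_sum]
  exact Finset.sum_congr rfl fun j _ => by rw [smul_eq_mul]; ring

namespace Chart

theorem mdifferentiable (e : Chart n M) : e.1.MDifferentiable (𝓡 n) (𝓡 n) :=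
  ⟨(contMDiffOn_of_mem_maximalAtlas e.2).mdifferentiableOn (by simp),
    (contMDiffOn_symm_of_mem_maximalAtlas e.2).mdifferentiableOn (by simp)⟩

theorem derivSymm_deriv (e : Chart n M) {x : M} (hx : x ∈ e.1.source) (v : Euc n) :
    e.derivSymm (e.1 x) (e.deriv x v) = v :=
  congrArg (fun L : Euc n →L[ℝ] Euc n => L v) (e.mdifferentiable.symm_comp_deriv hx)

theorem deriv_derivSymm (e : Chart n M) {y : Euc n} (hy : y ∈ e.1.target) (v : Euc n) :
    e.deriv (e.1.symm y) (e.derivSymm y v) = v :=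
  congrArg (fun L : Euc n →L[ℝ] Euc n => L v) (e.mdifferentiable.comp_symm_deriv hy)

/-- The chain rule through M, which expresses the Jacobian of a transition map by the derivatives of
the two charts. -/
theorem fderiv_transition (e e' : Chart n M) {y : Euc n} (hy : y ∈ (e'.1.symm.trans e.1).source)
    (v : Euc n) : fderiv ℝ (fun z => e.1 (e'.1.symm z)) y v
      = e.deriv (e'.1.symm y) (e'.derivSymm y v) := by
  have h1 : y ∈ e'.1.target := hy.1
  have h2 : e'.1.symm y ∈ e.1.source := hy.2
  have := mfderiv_comp y (e.mdifferentiable.mdifferentiableAt h2)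
    (e'.mdifferentiable.mdifferentiableAt_symm h1)
  rw [← mfderiv_eq_fderiv]
  exact congrArg (fun L : Euc n →L[ℝ] Euc n => L v) this

theorem isLipMetric (e : Chart n M) {g : Metric n M} (hg : IsLocLipschitzMetric g) :
    IsLipMetric e.img (metricCoord g e) where
  lip := hg e
  symm y _ i j := g.symm _ _ _
  -- A kernel vector of the Gram matrix would be the coordinate vector of a tangent vector of length
  -- zero. Positivity makes that tangent vector vanish, and the derivative of the inverse chart is
  -- injective.
  det_ne y hy h := by
    obtain ⟨v, hv, h0⟩ := Matrix.exists_mulVec_eq_zero_iff.2 h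
    let w : Euc n := WithLp.toLp 2 v
    have h1 : metricForm g (e.1.symm y) (e.derivSymm y w) (e.derivSymm y w) = 0 := by
      have := bilin_eq_sum ((metricForm g (e.1.symm y)).bilinearComp (e.derivSymm y)
        (e.derivSymm y)) w w
      rw [ContinuousLinearMap.bilinearComp_apply] at this
      rw [this]
      refine Finset.sum_eq_zero fun i _ => ?_
      have h2 := congrFun h0 i
      simp only [Matrix.mulVec, dotProduct, Matrix.of_apply, Pi.zero_apply] at h2
      have : ∀ j, w i * w j * ((metricForm g (e.1.symm y)).bilinearComp (e.derivSymm y)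
        (e.derivSymm y)) (unitVec i) (unitVec j) = v i * (metricCoord g e i j y * v j) := fun j => by
        rw [ContinuousLinearMap.bilinearComp_apply, metricCoord_eq]; simp only [w]; ring
      simp only [this, ← Finset.mul_sum, h2, mul_zero]
    have h2 : e.derivSymm y w = 0 := by
      by_contra h3
      exact (metricForm_pos g _ h3).ne' h1
    have h3 := e.deriv_derivSymm hy w
    rw [h2, map_zero] at h3
    exact hv (congrArg WithLp.ofLp h3.symm)

theorem memWFin (e : Chart n M) {X : ∀ x : M, TangentSpace (𝓡 n) x} (hX : MemW1InftyMinusLoc X)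
    (i : Fin n) : MemWFin e.img (vecCoord X e i) := hX e i

theorem inner_eq_sum (e : Chart n M) (g : Metric n M) (X : ∀ x : M, TangentSpace (𝓡 n) x)
    {y : Euc n} (hy : y ∈ e.1.target) :
    g.inner (e.1.symm y) (X (e.1.symm y)) (X (e.1.symm y))
      = ∑ i, ∑ j, metricCoord g e i j y * vecCoord X e i y * vecCoord X e j y := by
  have h1 := e.derivSymm_deriv (e.1.map_target hy) (X (e.1.symm y) : Euc n)
  rw [e.1.right_inv hy] at h1
  have := bilin_eq_sum ((metricForm g (e.1.symm y)).bilinearComp (e.derivSymm y)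
    (e.derivSymm y)) (e.deriv (e.1.symm y) (X (e.1.symm y) : Euc n))
      (e.deriv (e.1.symm y) (X (e.1.symm y) : Euc n))
  rw [ContinuousLinearMap.bilinearComp_apply, h1] at this
  refine Eq.trans this <| Finset.sum_congr rfl fun i _ => Finset.sum_congr rfl fun j _ => ?_
  rw [ContinuousLinearMap.bilinearComp_apply, metricCoord_eq, vecCoord_eq, vecCoord_eq]
  ring

/-- The domain of the transition map from `e` to `e'`. -/
def overlap (e e' : Chart n M) : Opens (Euc n) :=
  ⟨(e.1.symm.trans e'.1).source, (e.1.symm.trans e'.1).open_source⟩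

theorem contDiffOn_transition (e e' : Chart n M) :
    ContDiffOn ℝ ∞ (fun z => e.1 (e'.1.symm z)) (e'.overlap e) := by
  rw [← contMDiffOn_iff_contDiffOn]
  exact (contMDiffOn_of_mem_maximalAtlas e.2).comp
    ((contMDiffOn_symm_of_mem_maximalAtlas e'.2).mono fun y hy => hy.1) fun y hy => hy.2

theorem transition_left_inv (e e' : Chart n M) {y : Euc n} (hy : y ∈ e'.overlap e) :
    e.1.symm (e.1 (e'.1.symm y)) = e'.1.symm y := e.1.left_inv hy.2

theorem transition_mem (e e' : Chart n M) {y : Euc n} (hy : y ∈ e'.overlap e) :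
    e.1 (e'.1.symm y) ∈ e.overlap e' :=
  ⟨e.1.map_source hy.2, by
    change e.1.symm (e.1 (e'.1.symm y)) ∈ e'.1.source
    rw [transition_left_inv e e' hy]; exact e'.1.map_target hy.1⟩

theorem transition_transition (e e' : Chart n M) {y : Euc n} (hy : y ∈ e'.overlap e) :
    e'.1 (e.1.symm (e.1 (e'.1.symm y))) = y := by
  rw [transition_left_inv e e' hy]; exact e'.1.right_inv hy.1

theorem isDiffeo (e e' : Chart n M) : IsDiffeo (e'.overlap e) (e.overlap e')
    (fun z => e.1 (e'.1.symm z)) (fun z => e'.1 (e.1.symm z)) where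
  contDiffOn := contDiffOn_transition e e'
  contDiffOn_symm := contDiffOn_transition e' e
  mapsTo _ hy := transition_mem e e' hy
  mapsTo_symm _ hy := transition_mem e' e hy
  left_inv _ hy := transition_transition e e' hy
  right_inv _ hy := transition_transition e' e hy

theorem isTransition (e e' : Chart n M) {g : Metric n M} (hg : IsLocLipschitzMetric g)
    {X : ∀ x : M, TangentSpace (𝓡 n) x} (hX : MemW1InftyMinusLoc X) :
    IsTransition e'.img e.img (e'.overlap e) (e.overlap e')
      (fun z => e.1 (e'.1.symm z)) (fun z => e'.1 (e.1.symm z))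
      (metricCoord g e') (metricCoord g e) (vecCoord X e') (vecCoord X e) where
  metric' := e'.isLipMetric hg
  metric := e.isLipMetric hg
  vec' := e'.memWFin hX
  vec := e.memWFin hX
  le' y hy := hy.1
  le y hy := hy.1
  diffeo := isDiffeo e e'
  metric_eq y hy a b := by
    have h2 : e'.1.symm y ∈ e.1.source := hy.2
    have h1 : ∀ a, e'.derivSymm y (unitVec a) = e.derivSymm (e.1 (e'.1.symm y))
        (fderiv ℝ (fun z => e.1 (e'.1.symm z)) y (unitVec a)) := fun a => by
      rw [fderiv_transition e e' hy, e.derivSymm_deriv h2]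
    have := bilin_eq_sum ((metricForm g (e'.1.symm y)).bilinearComp
      (e.derivSymm (e.1 (e'.1.symm y))) (e.derivSymm (e.1 (e'.1.symm y))))
      (fderiv ℝ (fun z => e.1 (e'.1.symm z)) y (unitVec a))
      (fderiv ℝ (fun z => e.1 (e'.1.symm z)) y (unitVec b))
    rw [ContinuousLinearMap.bilinearComp_apply, ← h1, ← h1] at this
    rw [metricCoord_eq, this]
    refine Finset.sum_congr rfl fun i _ => Finset.sum_congr rfl fun j _ => ?_
    rw [metricCoord_eq, e.1.left_inv h2, ContinuousLinearMap.bilinearComp_apply]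
    rfl
  vec_eq y hy i := by
    have h1 : y ∈ e'.1.target := hy.1
    have h2 : e'.1.symm y ∈ e.1.source := hy.2
    -- All tangent spaces are definitionally the model space; forgetting the dependence on the point
    -- allows base points to be rewritten.
    let Y : M → Euc n := X
    have h3 := e'.derivSymm_deriv (e'.1.map_target h1) (Y (e'.1.symm y))
    rw [e'.1.right_inv h1] at h3
    have h4 := fderiv_transition e e' hy (e'.deriv (e'.1.symm y) (Y (e'.1.symm y)))
    rw [h3, fderiv_apply_eq_sum] at h4
    have h5 : vecCoord X e i (e.1 (e'.1.symm y)) = e.deriv (e'.1.symm y) (Y (e'.1.symm y)) i := by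
      change e.deriv (e.1.symm (e.1 (e'.1.symm y))) (Y (e.1.symm (e.1 (e'.1.symm y)))) i = _
      rw [e.1.left_inv h2]
    rw [h5, ← h4]
    simp only [WithLp.ofLp_sum, Finset.sum_apply, WithLp.ofLp_smul, Pi.smul_apply, smul_eq_mul]
    exact Finset.sum_congr rfl fun a _ => mul_comm _ _

end Chart

end Charts

end LowReg

/-! ### The four terms as distributions on M, and the identity -/

namespace LowReg

section Membership

variable {n : ℕ} {M : Type*} [TopologicalSpace M] [ChartedSpace (Euc n) M] {g : Metric n M}
  {X : ∀ x : M, TangentSpace (𝓡 n) x}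

/-- Reduces membership in `Distr` to a statement about coordinates related by a transition map, as
the local invariance results provide. -/
theorem sameDensity_apply_eq {T : ∀ e : Chart n M, 𝓓'(e.img, ℝ)}
    (hg : IsLocLipschitzMetric g) (hX : MemW1InftyMinusLoc X)
    (hT : ∀ (e e' : Chart n M) (φ : 𝓓(e.img, ℝ)) (φ' : 𝓓(e'.img, ℝ)),
      IsTransition e'.img e.img (e'.overlap e) (e.overlap e')
        (fun z => e.1 (e'.1.symm z)) (fun z => e'.1 (e.1.symm z))
        (metricCoord g e') (metricCoord g e) (vecCoord X e') (vecCoord X e) →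
      tsupport φ ⊆ e.overlap e' → tsupport φ' ⊆ e'.overlap e →
      (∀ y ∈ e'.overlap e, φ' y = φ (e.1 (e'.1.symm y))
        * |(fderiv ℝ (fun z => e.1 (e'.1.symm z)) y).det|) → T e φ = T e' φ') : T ∈ Distr n M :=
  fun e e' φ φ' h => hT e e' φ φ' (Chart.isTransition e e' hg hX) h.1 h.2.1 h.2.2

theorem laplace_eq_divVec [NeZero n] (hg : IsLocLipschitzMetric g) (hX : MemW1InftyMinusLoc X)
    (e : Chart n M) :
    laplace g (fun x => g.inner x (X x) (X x) / 2) e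
      = divVec (metricCoord g e) (gradHalfSq e.img (metricCoord g e) (vecCoord X e)) := by
  rw [← laplaceLocal_halfSq (e.isLipMetric hg) (e.memWFin hX), laplace]
  have h : (fun y => g.inner (e.1.symm y) (X (e.1.symm y)) (X (e.1.symm y)) / 2)
      =ᵐ[volume.restrict e.img] fun y =>
        (∑ i, ∑ j, metricCoord g e i j y * vecCoord X e i y * vecCoord X e j y) / 2 :=
    (ae_restrict_iff' e.img.isOpen.measurableSet).2 <| Filter.Eventually.of_forall fun y hy => by
      simp only [e.inner_eq_sum g X hy]
  simp only [laplaceLocal, weakDeriv_congr _ h]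

theorem gradNormSq_mem [NeZero n] (hg : IsLocLipschitzMetric g) (hX : MemW1InftyMinusLoc X) :
    gradNormSq g X ∈ WNegOneLoc n M (expo n) :=
  ⟨sameDensity_apply_eq hg hX fun _ _ _ _ h h1 h2 h3 => h.ofFun_normSqNabla_apply_eq h1 h2 h3,
    fun e => (hasDivForm_ofFun (memLFin_normSqNabla (e.isLipMetric hg) (e.memWFin hX))).memWNegOneLoc⟩

theorem laplace_mem [NeZero n] (hg : IsLocLipschitzMetric g) (hX : MemW1InftyMinusLoc X) :
    laplace g (fun x => g.inner x (X x) (X x) / 2) ∈ WNegOneLoc n M (expo n) := by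
  refine ⟨sameDensity_apply_eq hg hX fun e e' φ φ' h h1 h2 h3 => ?_, fun e => ?_⟩
  · rw [laplace_eq_divVec hg hX, laplace_eq_divVec hg hX]
    exact h.divVec_gradHalfSq_apply_eq h1 h2 h3
  · rw [laplace_eq_divVec hg hX]
    exact ((e.isLipMetric hg).hasDivForm_divVec
      (memLFin_gradHalfSq (e.isLipMetric hg) (e.memWFin hX))).memWNegOneLoc

theorem ricci_mem [NeZero n] (hg : IsLocLipschitzMetric g) (hX : MemW1InftyMinusLoc X) :
    ricci g X ∈ WNegOneLoc n M (expo n) := by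
  refine ⟨sameDensity_apply_eq hg hX fun e e' φ φ' h h1 h2 h3 => ?_, fun e => ?_⟩
  · rw [ricci, ricci, ricciLocal_eq h.metric h.vec, ricciLocal_eq h.metric' h.vec']
    exact congrArg₂ (· + ·) (h.divVec_ricciFlux_apply_eq h1 h2 h3)
      (h.ofFun_ricciDensity_apply_eq h1 h2 h3)
  · rw [ricci, ricciLocal_eq (e.isLipMetric hg) (e.memWFin hX)]
    exact (((e.isLipMetric hg).hasDivForm_divVec
      (memLFin_ricciFlux (e.isLipMetric hg) (e.memWFin hX))).add
      (hasDivForm_ofFun (memLFin_ricciDensity (e.isLipMetric hg) (e.memWFin hX)))).memWNegOneLoc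

theorem bochner_identity [NeZero n] (hg : IsLocLipschitzMetric g) (hX : MemW1InftyMinusLoc X) :
    ricci g X = laplace g (fun x => g.inner x (X x) (X x) / 2) - gradNormSq g X + hodge g X := by
  ext1 e
  rw [Pi.add_apply, Pi.sub_apply, laplace_eq_divVec hg hX, ricci, gradNormSq, hodge,
    ricciLocal_eq (e.isLipMetric hg) (e.memWFin hX), hodgeLocal_eq (e.isLipMetric hg) (e.memWFin hX)]
  abel

theorem hodge_mem [NeZero n] (hg : IsLocLipschitzMetric g) (hX : MemW1InftyMinusLoc X) :
    hodge g X ∈ WNegOneLoc n M (expo n) := by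
  refine ⟨?_, fun e => ?_⟩
  -- Compatibility between charts needs no separate check: by the identity in each chart, the term
  -- is a combination of three compatible families.
  · have : hodge g X = ricci g X - laplace g (fun x => g.inner x (X x) (X x) / 2)
        + gradNormSq g X := by
      rw [bochner_identity hg hX]; abel
    rw [this]
    exact add_mem (sub_mem (ricci_mem hg hX).1 (laplace_mem hg hX).1) (gradNormSq_mem hg hX).1
  · have hG := e.isLipMetric hg
    have hx := e.memWFin hX
    rw [hodge, hodgeLocal_eq hG hx]
    exact ((((hasDivForm_ofFun (memLFin_normSqNabla hG hx)).add
      (hasDivForm_ofFun (memLFin_ricciDensity hG hx))).add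
      (hG.hasDivForm_divVec (memLFin_ricciFlux hG hx))).sub
      (hG.hasDivForm_divVec (memLFin_gradHalfSq hG hx))).memWNegOneLoc

end Membership

end LowReg
theorem theorem3 {n : ℕ} (hn : 1 ≤ n) {M : Type*} [TopologicalSpace M] [T2Space M]
    [SecondCountableTopology M] [ChartedSpace (LowReg.Euc n) M] [IsManifold (𝓡 n) ∞ M]
    (g : LowReg.Metric n M) (hg : LowReg.IsLocLipschitzMetric g)
    (X : ∀ x : M, TangentSpace (𝓡 n) x) (hX : LowReg.MemW1InftyMinusLoc X) :
    LowReg.ricci g X ∈ LowReg.WNegOneLoc n M (LowReg.expo n) ∧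
    LowReg.laplace g (fun x => g.inner x (X x) (X x) / 2) ∈
      LowReg.WNegOneLoc n M (LowReg.expo n) ∧
    LowReg.gradNormSq g X ∈ LowReg.WNegOneLoc n M (LowReg.expo n) ∧
    LowReg.hodge g X ∈ LowReg.WNegOneLoc n M (LowReg.expo n) ∧
    LowReg.ricci g X = LowReg.laplace g (fun x => g.inner x (X x) (X x) / 2)
      - LowReg.gradNormSq g X + LowReg.hodge g X := by
  have : NeZero n := ⟨by omega⟩
  exact ⟨LowReg.ricci_mem hg hX, LowReg.laplace_mem hg hX, LowReg.gradNormSq_mem hg hX,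
    LowReg.hodge_mem hg hX, LowReg.bochner_identity hg hX⟩
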